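/- Let $(\Omega,\mathscr F,\mathbb P)$ be a probability space, let $n=n(d)$ be a sequence of integers with $n(d)\to\infty$ as $d\to\infty$, and for each $d\ge 1$ let $X^{(d)}=(X^{(d)}_1,\dots,X^{(d)}_d)$ be a random vector in $\mathbb R^d$ such that (a) $\mathbb E X^{(d)}=0$ and $\mathbb E\|X^{(d)}\|_2^2=1$ for all $d\ge1$; (b) $\mathbb E[X^{(d)}_aX^{(d)}_{a'}]=0$ for all $d\ge 1$ and $a\ne a'$ in $\{1,\dots,d\}$; (c) $\lim_{c\to\infty}\sup_{d\ge1}\mathbb E\big[\|X^{(d)}\|_2^2\,\mathbf 1\{\|X^{(d)}\|_2^2>c\}\big]=0$; (d) $\lim_{d\to\infty}\max_{1\le a\le d}\mathbb E (X^{(d)}_a)^2=0$. The Gromov–Hausdorff distance of two metric spaces is the infimum of the Hausdorff distances between their images under isometric maps into an arbitrary third metric space. Random subsets $K_d$ of $\mathbb R^d$ (with the Euclidean metric) converge in probability to a deterministic metric space $Y$ if for every $\varepsilon>0$ the probability that the Gromov–Hausdorff distance between $K_d$ and $Y$ is at least $\varepsilon$ tends to $0$ as $d\to\infty$. For a probability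 space $(\mathbb X,\mathsf F,\mu)$ and a non-empty $\mathcal A\subset\mathsf F$, the Wiener spiral on $\mathcal A$ with governing measure $\mu$ is $\mathcal A$ with the metric $\rho_\mu(A,B)=\mu(A\triangle B)^{1/2}$, sets at distance $0$ being identified. The $m$-variate Wiener spiral $\mathbb{WS}_m$ is the one obtained from $\mathbb X=[0,1]^m$ with Lebesgue measure and $\mathcal A=\{[0,t_1]\times\dots\times[0,t_m]:t_1,\dots,t_m\in[0,1]\}$. **Theorem.** (1) (Multiple sums.) Let $m\ge1$ be fixed and, for each $d\ge 1$, let $X^{(d)}(\mathbf k)$, $\mathbf k\in\{0,\dots,n\}^m$, be independent copies of $X^{(d)}$. Put $S^{(d)}_{\mathbf k}=\sum_{\mathbf 0\le\mathbf i\le\mathbf k}X^{(d)}(\mathbf i)$, where the inequalities are componentwise; thus $S^{(d)}_{\mathbf k}$ is the sum over the integer rectangle $([0,k_1]\times\dots\times[0,k_m])\cap\mathbb Z^m$. Then, as $d\to\infty$, $n^{-m/2}\{S^{(d)}_{\mathbf k}:\mathbf k\in\{0,\dots,n\}^m\}$ converges in probability to $\mathbb{WS}_m$. (2) (Set-indexed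 sums.) Let $(\mathbb X,\mathsf F,\mu)$ be a probability space, and let $\mathcal M\subset\mathsf F$ be a non-empty VC class, that is, for some $k$ and every set $I\subset\mathbb X$ of $k+1$ points, not every subset of $I$ is of the form $I\cap A$ with $A\in\mathcal M$. Assume that $\mathcal M$ is $\mu$-measurable in the usual sense of empirical process theory: for all $k$ and $e\in\mathbb R^k$, the function $(x_1,\dots,x_k)\mapsto\sup_{A\in\mathcal M}\big|\sum_{i=1}^k e_i\mathbf 1_A(x_i)\big|$ is measurable with respect to the completion of $\mu^{\otimes k}$. Let $U_1,U_2,\dots$ be i.i.d. with distribution $\mu$ and, for each $d\ge 1$, let $X^{(d)}(1),\dots,X^{(d)}(n)$ be independent copies of $X^{(d)}$ that are independent of $(U_j)_{j\ge1}$. Put $S^{(d)}_n(A)=\sum_{j=1}^nX^{(d)}(j)\mathbf 1\{U_j\in A\}$. Then, as $d\to\infty$, $n^{-1/2}\{S^{(d)}_n(A):A\in\mathcal M\}$ converges in probability to the Wiener spiral on $\mathcal M$ with governing measure $\mu$. -/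

import Mathlib

open MeasureTheory ProbabilityTheory Filter Topology Set
open scoped ENNReal Pointwise symmDiff

/-! ### Gromov-Hausdorff distance and convergence in probability -/

/-- The Gromov-Hausdorff distance of two metric spaces: the infimum of the Hausdorff distances
between the images of the two spaces under isometric maps to an arbitrary third metric space.
Unlike `GromovHausdorff.ghDist`, it makes sense without compactness; this is needed because a
Wiener spiral on a family of sets is totally bounded in the situation of interest, but it need not
be complete. -/
noncomputable def ghEDist.{u, v} (X : Type u) (Y : Type v) [MetricSpace X] [MetricSpace Y] :
    ℝ≥0∞ :=
  ⨅ (Z : Type (max u v)) (_ : MetricSpace Z) (f : X → Z) (g : Y → Z)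
    (_ : Isometry f) (_ : Isometry g), Metric.hausdorffEDist (range f) (range g)

/-- The random subsets `K d` of the metric spaces `E d`, viewed as metric spaces with the induced
metric, converge in probability to the deterministic metric space `Y` with respect to the
Gromov-Hausdorff distance. -/
def GHTendstoInProbability {Ω : Type*} [MeasurableSpace Ω] (P : Measure Ω)
    {E : ℕ → Type*} [∀ d, MetricSpace (E d)] (K : (d : ℕ) → Ω → Set (E d))
    (Y : Type*) [MetricSpace Y] : Prop :=
  ∀ ε : ℝ≥0∞, 0 < ε →
    Tendsto (fun d => P {ω | ε ≤ ghEDist (K d ω) Y}) atTop (𝓝 0)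

/-! ### Wiener spirals -/

/-- A family `𝒜` of subsets of `𝕏`, to be endowed with the pseudometric
`ρ_μ(A, B) = μ(A ∆ B) ^ (1/2)`. -/
def SetFamily {𝕏 : Type*} [MeasurableSpace 𝕏] (_μ : Measure 𝕏) (𝒜 : Set (Set 𝕏)) : Type _ :=
  {A : Set 𝕏 // A ∈ 𝒜}

noncomputable instance SetFamily.instPseudoMetricSpace {𝕏 : Type*} [MeasurableSpace 𝕏]
    (μ : Measure 𝕏) [IsProbabilityMeasure μ] (𝒜 : Set (Set 𝕏)) :
    PseudoMetricSpace (SetFamily μ 𝒜) where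
  dist A B := Real.sqrt (μ.real (A.1 ∆ B.1))
  dist_self A := by simp
  dist_comm A B := by rw [symmDiff_comm]
  dist_triangle A B C := by
    have h : μ.real (A.1 ∆ C.1) ≤ μ.real (A.1 ∆ B.1) + μ.real (B.1 ∆ C.1) :=
      (measureReal_mono (symmDiff_triangle A.1 B.1 C.1)).trans (measureReal_union_le _ _)
    refine Real.sqrt_le_iff.2 ⟨by positivity, ?_⟩
    have h1 := Real.sq_sqrt (measureReal_nonneg (μ := μ) (s := A.1 ∆ B.1))
    have h2 := Real.sq_sqrt (measureReal_nonneg (μ := μ) (s := B.1 ∆ C.1))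
    have h3 := mul_nonneg (Real.sqrt_nonneg (μ.real (A.1 ∆ B.1)))
      (Real.sqrt_nonneg (μ.real (B.1 ∆ C.1)))
    nlinarith

/-- The Wiener spiral on `𝒜` with governing measure `μ`: the family `𝒜` with the metric
`ρ_μ(A, B) = μ(A ∆ B) ^ (1/2)`, sets at distance zero being identified. -/
abbrev WienerSpiral {𝕏 : Type*} [MeasurableSpace 𝕏] (μ : Measure 𝕏) [IsProbabilityMeasure μ]
    (𝒜 : Set (Set 𝕏)) : Type _ :=
  SeparationQuotient (SetFamily μ 𝒜)

/-- The family of rectangles `[0, t_1] × ⋯ × [0, t_m]`, `t_1, …, t_m ∈ [0, 1]`, in `[0, 1]^m`. -/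
def unitRectangles (m : ℕ) : Set (Set (Fin m → unitInterval)) :=
  {A | ∃ t : Fin m → unitInterval, A = Set.univ.pi fun i => Set.Icc 0 (t i)}

/-- The `m`-variate Wiener spiral: the Wiener spiral on the rectangles in `[0, 1]^m` anchored at
the origin, governed by the Lebesgue measure on `[0, 1]^m`. -/
abbrev MultivariateWienerSpiral (m : ℕ) : Type :=
  WienerSpiral (volume : Measure (Fin m → unitInterval)) (unitRectangles m)

/-! ### Ranges of sums indexed by sets of marks -/

/-- `S(A)`: the sum of those vectors `x j` whose mark `mark j` lies in `A`. -/
noncomputable def markedSum {ι M E : Type*} [Fintype ι] [AddCommMonoid E]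
    (x : ι → E) (mark : ι → M) (A : Set M) : E :=
  ∑ j, A.indicator (fun _ => x j) (mark j)

/-- The range `{S(A) : A ∈ 𝓜}` of the set-indexed sums. -/
def markedSumRange {ι M E : Type*} [Fintype ι] [AddCommMonoid E]
    (x : ι → E) (mark : ι → M) (𝓜 : Set (Set M)) : Set E :=
  markedSum x mark '' 𝓜

/-- The integer rectangles `([0, k_1] × ⋯ × [0, k_m]) ∩ ℤ^m` with `k_1, …, k_m ∈ {0, 1, 2, …}`. -/
def integerRectangles (m : ℕ) : Set (Set (Fin m → ℤ)) :=
  {A | ∃ k : Fin m → ℕ, A = {z | ∀ i, 0 ≤ z i ∧ z i ≤ (k i : ℤ)}}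

/-- The point of `ℤ^m` that marks the multi-index `k ∈ {0, …, n}^m`. -/
def latticeMark {m n : ℕ} (k : Fin m → Fin (n + 1)) : Fin m → ℤ := fun i => ((k i : ℕ) : ℤ)

/-! ### Assumptions on the increments -/

/-- Conditions (a)-(d) on the generic increments `ξ d`, a random vector in `ℝ^d`, `d = 1, 2, …`.
(The value `ξ 0` in the zero space is irrelevant; its contribution in (c) is zero.) -/
structure IncrementConditions {Ω : Type*} [MeasurableSpace Ω] (P : Measure Ω)
    (ξ : (d : ℕ) → Ω → EuclideanSpace ℝ (Fin d)) : Prop where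
  aemeasurable : ∀ d, AEMeasurable (ξ d) P
  /-- (a), first part: the increments are centred. -/
  centred : ∀ d, 1 ≤ d → ∫ ω, ξ d ω ∂P = 0
  /-- (a), second part: the increments are normalised. -/
  normalised : ∀ d, 1 ≤ d → ∫ ω, ‖ξ d ω‖ ^ 2 ∂P = 1
  /-- (b): the components are uncorrelated. -/
  uncorrelated : ∀ d, 1 ≤ d → ∀ a a' : Fin d, a ≠ a' → ∫ ω, ξ d ω a * ξ d ω a' ∂P = 0
  /-- (c): the squared norms are uniformly integrable. -/
  uniformlyIntegrable :
    Tendsto (fun c : ℝ => ⨆ d, ∫⁻ ω in {ω | c < ‖ξ d ω‖ ^ 2}, ENNReal.ofReal (‖ξ d ω‖ ^ 2) ∂P)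
      atTop (𝓝 0)
  /-- (d): the components are uniformly negligible. -/
  negligible : Tendsto (fun d => ⨆ a : Fin d, ∫ ω, (ξ d ω a) ^ 2 ∂P) atTop (𝓝 0)

/-- For every `d = 1, 2, …`, the random vectors `X d j`, `j ∈ ι d`, are independent and
distributed as `ξ d`. -/
structure IsIncrementArray {Ω : Type*} [MeasurableSpace Ω] (P : Measure Ω)
    (ξ : (d : ℕ) → Ω → EuclideanSpace ℝ (Fin d)) {ι : ℕ → Type*}
    (X : (d : ℕ) → ι d → Ω → EuclideanSpace ℝ (Fin d)) : Prop where
  indep : ∀ d, 1 ≤ d → iIndepFun (X d) P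
  identDistrib : ∀ d, 1 ≤ d → ∀ j, IdentDistrib (X d j) (ξ d) P P

/-! ### Vapnik-Chervonenkis classes -/

/-- The family `𝓜` shatters the finite set `I`: each subset `J ⊆ I` is `I ∩ A` for some
`A ∈ 𝓜`. -/
def ShattersFinset {𝕏 : Type*} (𝓜 : Set (Set 𝕏)) (I : Finset 𝕏) : Prop :=
  ∀ J : Finset 𝕏, J ⊆ I → ∃ A ∈ 𝓜, (I : Set 𝕏) ∩ A = (J : Set 𝕏)

/-- `𝓜` is a VC class: for some `k`, no set of `k + 1` points is shattered by `𝓜`. -/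
def IsVCClass {𝕏 : Type*} (𝓜 : Set (Set 𝕏)) : Prop :=
  ∃ k : ℕ, ∀ I : Finset 𝕏, I.card = k + 1 → ¬ ShattersFinset 𝓜 I

/-- `𝓜` is a `μ`-measurable class in the usual sense of empirical process theory: for all `k` and
all `e ∈ ℝ^k`, the function `(x_1, …, x_k) ↦ sup_{A ∈ 𝓜} |∑ i, e_i 1_A(x_i)|` is measurable with
respect to the completion of the product measure `μ^k`.
(The supremum is over numbers bounded by `∑ i, |e_i|`.) -/
def IsMeasurableClass {𝕏 : Type*} [MeasurableSpace 𝕏] (μ : Measure 𝕏) (𝓜 : Set (Set 𝕏)) : Prop :=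
  ∀ (k : ℕ) (e : Fin k → ℝ),
    NullMeasurable
      (fun x : Fin k → 𝕏 => ⨆ A : 𝓜, |∑ i, e i * (A : Set 𝕏).indicator (fun _ => (1 : ℝ)) (x i)|)
      (Measure.pi fun _ : Fin k => μ)

/-!
For index sets `J`, `K` of increments, `‖∑ J X - ∑ K X‖ ^ 2` is close to `|J ∆ K|`: the diagonal
part of the square is a sum of independent variables with mean `1`, to which the law of large
numbers applies, and the off-diagonal part has a small second moment, because the covariance of an
increment is diagonal with small entries and trace `1`. After scaling by the number `N` of
increments, distances between the sums are therefore square roots of proportions `|J ∆ K| / N`,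
which converge to the measures `μ (A ∆ B)`: by direct counting for lattice rectangles, by the
Glivenko-Cantelli theorem for a VC class. So finitely many of the sums form, up to a small error, an
isometric copy of finitely many points of the Wiener spiral, and a correspondence of finite nets
bounds the Gromov-Hausdorff distance (`ghEDist_le_of_nets`).

What has to be controlled is the oscillation of the sums between the points of a net, uniformly over
a family of index sets of bounded VC dimension (`TruncatedIncrements.integral_norm_diff_le`).
Symmetrization reduces the bound to Rademacher sums `∑ j, ± X j` over differences of index sets.
These take values in a Euclidean space whose dimension is unbounded, where the maximum of finitely
many of them is estimated by an exponential moment (`sum_norm_signOn_le`). A sampling argument and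
the Sauer-Shelah lemma give nets of polynomial size in the metric `∑ j ∈ J ∆ K, ‖X j‖ ^ 2`
(`exists_finset_net`), and chaining along them bounds the oscillation in this metric
(`sum_norm_signOn_chaining`). The squared norms have no moments beyond uniform integrability; a
truncation of them suffices to pass to the counting metric `|J ∆ K|`.

Both parts of the theorem are instances of `ghTendstoInProbability_range_of_uniform_law`: the index
sets are random in the second part, but independent of the increments, and take finitely many values,
so that one may condition on them.

The class `𝓜` is only `μ`-measurable, and the family of traces of `𝓜` on a sample is seen by the
suprema in the definition up to the empty trace (`nullMeasurableSet_traces_eq`); adding the empty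
trace to the family is harmless. The Glivenko-Cantelli theorem is obtained from the same maximal
inequality, applied to a double sample (`tendsto_measure_exists_abs_card_sub`).
-/

/-! ### Rademacher sums in a Hilbert space -/

/-- The sign pattern on `ι` that is `1` on `s` and `-1` off `s`. Averages over independent
Rademacher signs are written as sums over all `s : Finset ι`. -/
noncomputable def signOn {ι : Type*} (s : Finset ι) (j : ι) : ℝ := by
  classical exact if j ∈ s then 1 else -1

section Rademacher

variable {ι E : Type*} [NormedAddCommGroup E] [InnerProductSpace ℝ E]

lemma abs_signOn (s : Finset ι) (j : ι) : |signOn s j| = 1 := by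
  unfold signOn; split_ifs <;> norm_num

/-- Of two pairs of nonnegative numbers with the same sum, the one that is spread out more has the
larger sum of `k`-th powers. -/
lemma pow_add_pow_le_of_add_eq {p q p' q' : ℝ} (hq' : 0 ≤ q') (h1 : q' ≤ p) (h2 : p ≤ p')
    (hsum : p + q = p' + q') (k : ℕ) : p ^ k + q ^ k ≤ p' ^ k + q' ^ k := by
  have hmem : p ∈ segment ℝ p' q' := by
    rw [segment_symm, segment_eq_Icc (h1.trans h2)]; exact ⟨h1, h2⟩
  obtain ⟨a, b, ha, hb, hab, rfl⟩ := hmem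
  have hq : q = b • p' + a • q' := by
    simp only [smul_eq_mul] at *
    have : b = 1 - a := by linarith
    subst this; linarith
  subst hq
  have hp0 : p' ∈ Set.Ici (0 : ℝ) := hq'.trans (h1.trans h2)
  have hq0 : q' ∈ Set.Ici (0 : ℝ) := hq'
  have e1 := (convexOn_pow (𝕜 := ℝ) k).2 hp0 hq0 ha hb hab
  have e2 := (convexOn_pow (𝕜 := ℝ) k).2 hp0 hq0 hb ha (by linarith)
  simp only [smul_eq_mul] at *
  have : b = 1 - a := by linarith
  subst this
  linarith

/-- Since `t ↦ cosh √t` has a power series with nonnegative coefficients, the average of `cosh ‖·‖`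
at `x + y` and `x - y` is largest when `x` and `y` are parallel. -/
lemma cosh_norm_add_add_cosh_norm_sub_le (x y : E) :
    Real.cosh ‖x + y‖ + Real.cosh ‖x - y‖ ≤ 2 * Real.cosh ‖y‖ * Real.cosh ‖x‖ := by
  have h : 2 * Real.cosh ‖y‖ * Real.cosh ‖x‖
      = Real.cosh (‖x‖ + ‖y‖) + Real.cosh (‖x‖ - ‖y‖) := by
    rw [Real.cosh_add, Real.cosh_sub]; ring
  rw [h]
  refine hasSum_le (fun k => ?_) ((Real.hasSum_cosh ‖x + y‖).add (Real.hasSum_cosh ‖x - y‖))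
    ((Real.hasSum_cosh (‖x‖ + ‖y‖)).add (Real.hasSum_cosh (‖x‖ - ‖y‖)))
  rw [← add_div, ← add_div, pow_mul, pow_mul, pow_mul, pow_mul]
  refine div_le_div_of_nonneg_right ?_ (Nat.cast_nonneg _)
  have hc := abs_le.1 (abs_real_inner_le_norm x y)
  refine pow_add_pow_le_of_add_eq (sq_nonneg _) ?_ ?_ ?_ k
  · rw [norm_add_sq_real]; nlinarith [hc.1]
  · rw [norm_add_sq_real]; nlinarith [hc.2]
  · rw [norm_add_sq_real, norm_sub_sq_real]; ring

lemma sum_powerset_cosh_norm_le (y : ι → E) (F : Finset ι) :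
    ∑ s ∈ F.powerset, Real.cosh ‖∑ j ∈ F, signOn s j • y j‖
      ≤ 2 ^ F.card * ∏ j ∈ F, Real.cosh ‖y j‖ := by
  classical
  induction F using Finset.induction_on with
  | empty => simp
  | insert a F ha ih =>
    rw [Finset.sum_powerset_insert ha, ← Finset.sum_add_distrib, Finset.card_insert_of_notMem ha,
      Finset.prod_insert ha]
    have key : ∀ s ∈ F.powerset,
        Real.cosh ‖∑ j ∈ insert a F, signOn s j • y j‖
          + Real.cosh ‖∑ j ∈ insert a F, signOn (insert a s) j • y j‖
        ≤ 2 * Real.cosh ‖y a‖ * Real.cosh ‖∑ j ∈ F, signOn s j • y j‖ := by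
      intro s hs
      have has : a ∉ s := fun h => ha (Finset.mem_powerset.1 hs h)
      have e1 : ∑ j ∈ insert a F, signOn s j • y j = ∑ j ∈ F, signOn s j • y j - y a := by
        rw [Finset.sum_insert ha]; simp [signOn, has]; abel
      have e2 : ∑ j ∈ insert a F, signOn (insert a s) j • y j
          = ∑ j ∈ F, signOn s j • y j + y a := by
        rw [Finset.sum_insert ha]
        have : ∑ j ∈ F, signOn (insert a s) j • y j = ∑ j ∈ F, signOn s j • y j := by
          refine Finset.sum_congr rfl fun j hj => ?_
          have : j ≠ a := fun h => ha (h ▸ hj)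
          simp [signOn, this]
        rw [this]; simp [signOn]; abel
      rw [e1, e2, add_comm]
      exact cosh_norm_add_add_cosh_norm_sub_le _ _
    refine (Finset.sum_le_sum key).trans ?_
    rw [← Finset.mul_sum]
    calc 2 * Real.cosh ‖y a‖ * ∑ s ∈ F.powerset, Real.cosh ‖∑ j ∈ F, signOn s j • y j‖
        ≤ 2 * Real.cosh ‖y a‖ * (2 ^ F.card * ∏ j ∈ F, Real.cosh ‖y j‖) := by
          gcongr
      _ = _ := by ring

variable [Fintype ι]

/-- Rademacher sums in a Hilbert space are sub-Gaussian. -/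
lemma sum_cosh_norm_signOn_le (y : ι → E) :
    ∑ s : Finset ι, Real.cosh ‖∑ j, signOn s j • y j‖
      ≤ 2 ^ Fintype.card ι * Real.exp ((∑ j, ‖y j‖ ^ 2) / 2) := by
  have h := sum_powerset_cosh_norm_le y Finset.univ
  rw [Finset.powerset_univ, Finset.card_univ] at h
  refine h.trans ?_
  gcongr
  rw [Finset.sum_div, Real.exp_sum]
  exact Finset.prod_le_prod (fun j _ => (Real.cosh_pos _).le)
    fun j _ => Real.cosh_le_exp_half_sq _

/-- The maximal inequality for finitely many Rademacher sums in a Hilbert space. The index type `G`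
enters through the supremum norm on `G → E`. -/
lemma sum_norm_signOn_le {G : Type*} [Fintype G] (y : G → ι → E) {σ M : ℝ} (hσ : 0 ≤ σ)
    (hM : 1 ≤ M) (hG : (Fintype.card G : ℝ) ≤ M) (hy : ∀ g, ∑ j, ‖y g j‖ ^ 2 ≤ σ ^ 2) :
    ∑ s : Finset ι, ‖fun g => ∑ j, signOn s j • y g j‖
      ≤ 2 ^ Fintype.card ι * (σ * (Real.log (2 * M) + 1 / 2)) := by
  have hL : 0 ≤ Real.log (2 * M) := Real.log_nonneg (by linarith)
  rcases isEmpty_or_nonempty G with hE | hE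
  · have : ∀ s : Finset ι, ‖fun g => ∑ j, signOn s j • y g j‖ = 0 := by
      intro s; rw [Subsingleton.elim (fun g => ∑ j, signOn s j • y g j) 0, norm_zero]
    simp only [this, Finset.sum_const_zero]; positivity
  rcases hσ.eq_or_lt with rfl | hσ
  · have hy0 : ∀ g j, y g j = 0 := by
      intro g j
      have h1 : ‖y g j‖ ^ 2 ≤ 0 := by
        refine (Finset.single_le_sum (f := fun j => ‖y g j‖ ^ 2) (fun i _ => by positivity)
          (Finset.mem_univ j)).trans ((hy g).trans (by norm_num))
      have h2 : ‖y g j‖ = 0 := by nlinarith [norm_nonneg (y g j)]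
      simpa using h2
    have : ∀ s : Finset ι, ‖fun g => ∑ j, signOn s j • y g j‖ = 0 := by
      intro s; simp [hy0, ← Pi.zero_def]
    simp [this]
  set L := Real.log (2 * M) + 1 / 2 with hLdef
  -- `e ^ t ≥ 1 + t` linearizes the exponential moment bound.
  have key : ∀ s : Finset ι, ‖fun g => ∑ j, signOn s j • y g j‖ ≤ σ * (L - 1
      + Real.exp (-L) * ∑ g, 2 * Real.cosh ‖∑ j, signOn s j • (σ⁻¹ • y g j)‖) := by
    intro s
    obtain ⟨g, hg⟩ : ∃ g, ‖fun g => ∑ j, signOn s j • y g j‖ = ‖∑ j, signOn s j • y g j‖ := by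
      obtain ⟨g, hg⟩ := Finite.exists_max fun g => ‖∑ j, signOn s j • y g j‖
      refine ⟨g, le_antisymm ?_ (norm_le_pi_norm (fun g => ∑ j, signOn s j • y g j) g)⟩
      exact (pi_norm_le_iff_of_nonneg (norm_nonneg _)).2 hg
    rw [hg]
    have e : ‖∑ j, signOn s j • (σ⁻¹ • y g j)‖ = σ⁻¹ * ‖∑ j, signOn s j • y g j‖ := by
      have : ∑ j, signOn s j • (σ⁻¹ • y g j) = σ⁻¹ • ∑ j, signOn s j • y g j := by
        rw [Finset.smul_sum]; exact Finset.sum_congr rfl fun j _ => smul_comm _ _ _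
      rw [this, norm_smul, Real.norm_of_nonneg (by positivity)]
    set m := σ⁻¹ * ‖∑ j, signOn s j • y g j‖ with hm
    have h1 : ‖∑ j, signOn s j • y g j‖ = σ * m := by rw [hm]; field_simp
    rw [h1]
    refine mul_le_mul_of_nonneg_left ?_ hσ.le
    have h2 : Real.exp m ≤ 2 * Real.cosh m := by
      rw [Real.cosh_eq]; linarith [Real.exp_pos (-m)]
    have h3 : 2 * Real.cosh m ≤ ∑ g, 2 * Real.cosh ‖∑ j, signOn s j • (σ⁻¹ • y g j)‖ := by
      rw [← e]
      exact Finset.single_le_sum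
        (f := fun g => 2 * Real.cosh ‖∑ j, signOn s j • (σ⁻¹ • y g j)‖)
        (fun i _ => mul_nonneg two_pos.le (Real.cosh_pos _).le) (Finset.mem_univ g)
    have h4 := Real.add_one_le_exp (m - L)
    have h5 : Real.exp (m - L) = Real.exp (-L) * Real.exp m := by
      rw [← Real.exp_add]; ring_nf
    have h6 := mul_le_mul_of_nonneg_left (h2.trans h3) (Real.exp_pos (-L)).le
    linarith
  refine (Finset.sum_le_sum fun s _ => key s).trans ?_
  rw [← Finset.mul_sum, Finset.sum_add_distrib, ← Finset.mul_sum, Finset.sum_comm]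
  have h7 : ∀ g, ∑ s : Finset ι, 2 * Real.cosh ‖∑ j, signOn s j • (σ⁻¹ • y g j)‖
      ≤ 2 * (2 ^ Fintype.card ι * Real.exp (1 / 2)) := by
    intro g
    rw [← Finset.mul_sum]
    refine mul_le_mul_of_nonneg_left ((sum_cosh_norm_signOn_le _).trans ?_) two_pos.le
    gcongr
    have : ∀ j, ‖σ⁻¹ • y g j‖ ^ 2 = (σ ^ 2)⁻¹ * ‖y g j‖ ^ 2 := by
      intro j; rw [norm_smul, Real.norm_of_nonneg (by positivity)]; ring
    simp only [this]
    rw [← Finset.mul_sum, inv_mul_le_iff₀ (by positivity)]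
    linarith [hy g]
  have h8 : ∑ g, ∑ s : Finset ι, 2 * Real.cosh ‖∑ j, signOn s j • (σ⁻¹ • y g j)‖
      ≤ M * (2 * (2 ^ Fintype.card ι * Real.exp (1 / 2))) := by
    refine (Finset.sum_le_sum fun g _ => h7 g).trans ?_
    rw [Finset.sum_const, Finset.card_univ, nsmul_eq_mul]
    gcongr
  have h9 : Real.exp (-L) = (2 * M)⁻¹ * (Real.exp (1 / 2))⁻¹ := by
    rw [hLdef, neg_add, Real.exp_add, Real.exp_neg, Real.exp_log (by linarith), Real.exp_neg]
  have h10 : Real.exp (-L) * ∑ g, ∑ s : Finset ι,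
      2 * Real.cosh ‖∑ j, signOn s j • (σ⁻¹ • y g j)‖ ≤ 2 ^ Fintype.card ι := by
    refine (mul_le_mul_of_nonneg_left h8 (Real.exp_pos _).le).trans (le_of_eq ?_)
    rw [h9]
    have := Real.exp_pos (1 / 2)
    have hM0 : M ≠ 0 := by linarith
    field_simp
  have h11 : ∑ _s : Finset ι, (L - 1) = 2 ^ Fintype.card ι * (L - 1) := by
    rw [Finset.sum_const, Finset.card_univ, Fintype.card_finset, nsmul_eq_mul]; push_cast; ring
  rw [h11]
  have := mul_le_mul_of_nonneg_left (add_le_add_right h10 (2 ^ Fintype.card ι * (L - 1))) hσ.le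
  calc _ ≤ σ * (2 ^ Fintype.card ι * (L - 1) + 2 ^ Fintype.card ι) := this
    _ = _ := by ring

end Rademacher

/-! ### Covering numbers of families with bounded VC dimension -/

section Packing

variable {ι κ : Type*} [DecidableEq ι]

lemma vcDim_image_preimage_le [Fintype κ] [DecidableEq κ] (T : Finset (Finset ι)) (z : κ → ι) :
    (T.image fun J => Finset.univ.filter fun i => z i ∈ J).vcDim ≤ T.vcDim := by
  refine Finset.sup_le fun s hs => ?_
  rw [Finset.mem_shatterer] at hs
  have hmem : ∀ t ⊆ s, ∃ J ∈ T, ∀ i ∈ s, z i ∈ J ↔ i ∈ t := by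
    intro t ht
    obtain ⟨u, hu, hut⟩ := hs ht
    obtain ⟨J, hJ, rfl⟩ := Finset.mem_image.1 hu
    refine ⟨J, hJ, fun i hi => ?_⟩
    rw [← hut]; simp [hi]
  have hinj : Set.InjOn z s := by
    intro a ha b hb hab
    obtain ⟨J, -, hJ⟩ := hmem {a} (by simpa using ha)
    have h1 : z a ∈ J := (hJ a ha).2 (by simp)
    have h2 := (hJ b hb).1 (hab ▸ h1)
    exact (Finset.mem_singleton.1 h2).symm
  rw [← Finset.card_image_of_injOn hinj]
  refine Finset.Shatters.card_le_vcDim fun t ht => ?_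
  obtain ⟨J, hJ, h⟩ := hmem (s.filter fun i => z i ∈ t) (Finset.filter_subset _ _)
  refine ⟨J, hJ, ?_⟩
  ext x
  simp only [Finset.mem_inter, Finset.mem_image]
  constructor
  · rintro ⟨⟨i, hi, rfl⟩, hx⟩
    exact (Finset.mem_filter.1 ((h i hi).1 hx)).2
  · intro hx
    obtain ⟨i, hi, rfl⟩ := Finset.mem_image.1 (ht hx)
    exact ⟨⟨i, hi, rfl⟩, (h i hi).2 (Finset.mem_filter.2 ⟨hi, hx⟩)⟩

/-- The Sauer-Shelah lemma in polynomial form. -/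
lemma card_le_pow_of_vcDim_le [Fintype ι] {T : Finset (Finset ι)} {v : ℕ} (hv : T.vcDim ≤ v) :
    T.card ≤ (Fintype.card ι + 1) ^ v := by
  refine (T.card_le_card_shatterer.trans Finset.card_shatterer_le_sum_vcDim).trans ?_
  calc ∑ k ∈ Finset.Iic T.vcDim, (Fintype.card ι).choose k
      ≤ ∑ k ∈ Finset.range (v + 1), Fintype.card ι ^ k * 1 ^ (v - k) * v.choose k := by
        refine (Finset.sum_le_sum_of_subset (fun k hk => ?_)).trans
          (Finset.sum_le_sum fun k hk => ?_)
        · rw [Finset.mem_Iic] at hk; rw [Finset.mem_range]; omega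
        · have hk' : 0 < v.choose k := Nat.choose_pos (by rw [Finset.mem_range] at hk; omega)
          calc (Fintype.card ι).choose k ≤ Fintype.card ι ^ k := Nat.choose_le_pow _ _
            _ ≤ Fintype.card ι ^ k * 1 ^ (v - k) * v.choose k := by
              rw [one_pow, mul_one]; exact Nat.le_mul_of_pos_right _ hk'
    _ = (Fintype.card ι + 1) ^ v := by rw [add_pow]; simp

/-- A sample of size `n` separates a well separated family with positive probability. The number of
its members is therefore at most the number of traces of the family on the sample. -/
lemma card_le_pow_of_separated [Fintype ι] {w : ι → ℝ} (hw : ∀ j, 0 ≤ w j) (hw1 : ∑ j, w j = 1)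
    {T : Finset (Finset ι)} {v : ℕ} (hv : T.vcDim ≤ v) {δ : ℝ}
    (hsep : ∀ J ∈ T, ∀ K ∈ T, J ≠ K → δ ≤ ∑ j ∈ J ∆ K, w j) {n : ℕ}
    (hn : (T.card : ℝ) ^ 2 * Real.exp (-δ * n) < 1) : T.card ≤ (n + 1) ^ v := by
  classical
  have h1 : ∀ f : ι → ℝ, ∑ z : Fin n → ι, ∏ i, f (z i) = (∑ j, f j) ^ n :=
    fun f => (Fintype.sum_pow f n).symm
  obtain ⟨z, hz⟩ : ∃ z : Fin n → ι, ∀ p ∈ T.offDiag, ∃ i, z i ∈ p.1 ∆ p.2 := by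
    by_contra! hcon
    have h2 : (1 : ℝ) ≤ ∑ z : Fin n → ι, ∑ p ∈ T.offDiag,
        ∏ i, (if z i ∈ p.1 ∆ p.2 then 0 else w (z i)) := by
      calc (1 : ℝ) = ∑ z : Fin n → ι, ∏ i, w (z i) := by rw [h1, hw1, one_pow]
        _ ≤ _ := by
          refine Finset.sum_le_sum fun z _ => ?_
          obtain ⟨p, hp, hpz⟩ := hcon z
          refine le_trans (le_of_eq ?_) (Finset.single_le_sum
            (f := fun p : Finset ι × Finset ι =>
              ∏ i, (if z i ∈ p.1 ∆ p.2 then 0 else w (z i))) (fun q _ => ?_) hp)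
          · exact Finset.prod_congr rfl fun i _ => by rw [if_neg (hpz i)]
          · exact Finset.prod_nonneg fun i _ => by split_ifs <;> simp [hw]
    rw [Finset.sum_comm] at h2
    have h3 : ∀ p ∈ T.offDiag, ∑ z : Fin n → ι,
        ∏ i, (if z i ∈ p.1 ∆ p.2 then 0 else w (z i)) ≤ Real.exp (-δ * n) := by
      intro p hp
      rw [Finset.mem_offDiag] at hp
      rw [h1 fun j => if j ∈ p.1 ∆ p.2 then 0 else w j]
      have h4 : ∑ j, (if j ∈ p.1 ∆ p.2 then 0 else w j) = 1 - ∑ j ∈ p.1 ∆ p.2, w j := by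
        rw [← hw1, ← Finset.sum_filter_add_sum_filter_not Finset.univ (fun j => j ∈ p.1 ∆ p.2) w,
          Finset.filter_univ_mem, add_sub_cancel_left, Finset.sum_filter]
        exact Finset.sum_congr rfl fun j _ => by simp only [ite_not]
      have h5 := hsep p.1 hp.1 p.2 hp.2.1 hp.2.2
      have h6 : 0 ≤ ∑ j, (if j ∈ p.1 ∆ p.2 then 0 else w j) :=
        Finset.sum_nonneg fun j _ => by split_ifs <;> simp [hw]
      have h7 : ∑ j, (if j ∈ p.1 ∆ p.2 then 0 else w j) ≤ Real.exp (-δ) := by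
        rw [h4]; linarith [Real.add_one_le_exp (-δ)]
      calc _ ≤ (Real.exp (-δ)) ^ n := pow_le_pow_left₀ h6 h7 n
        _ = _ := by rw [← Real.exp_nat_mul]; ring_nf
    have h8 := h2.trans (Finset.sum_le_card_nsmul _ _ _ h3)
    rw [nsmul_eq_mul] at h8
    have h9 : ((T.offDiag.card : ℕ) : ℝ) ≤ (T.card : ℝ) ^ 2 := by
      rw [Finset.offDiag_card]
      calc ((T.card * T.card - T.card : ℕ) : ℝ) ≤ ((T.card * T.card : ℕ) : ℝ) := by
            exact_mod_cast Nat.sub_le _ _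
        _ = _ := by push_cast; ring
    have := mul_le_mul_of_nonneg_right h9 (Real.exp_pos (-δ * n)).le
    linarith
  have hinj : Set.InjOn (fun J : Finset ι => Finset.univ.filter fun i => z i ∈ J) T := by
    intro J hJ K hK hJK
    by_contra hne
    obtain ⟨i, hi⟩ := hz (J, K) (Finset.mem_offDiag.2 ⟨hJ, hK, hne⟩)
    have h := Finset.ext_iff.1 hJK i
    simp only [Finset.mem_filter, Finset.mem_univ, true_and] at h
    rw [Finset.mem_symmDiff] at hi
    tauto
  rw [← Finset.card_image_of_injOn hinj]
  simpa using card_le_pow_of_vcDim_le ((vcDim_image_preimage_le T z).trans hv)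

/-- The constant in the bound on the covering numbers of a family of VC dimension at most `v`. -/
def vcConst (v : ℕ) : ℝ := 16 * ((v : ℝ) + 1) ^ 2

lemma vcConst_ge (v : ℕ) : 16 ≤ vcConst v := by
  unfold vcConst; nlinarith [(Nat.cast_nonneg v : (0 : ℝ) ≤ v)]

lemma card_le_exp_of_separated [Fintype ι] {w : ι → ℝ} (hw : ∀ j, 0 ≤ w j) (hw1 : ∑ j, w j = 1)
    {T : Finset (Finset ι)} {v : ℕ} (hv : T.vcDim ≤ v) {l : ℕ}
    (hsep : ∀ J ∈ T, ∀ K ∈ T, J ≠ K → (1 / 4 : ℝ) ^ l ≤ ∑ j ∈ J ∆ K, w j) :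
    (T.card : ℝ) ≤ Real.exp (vcConst v * (l + 1)) := by
  rcases T.eq_empty_or_nonempty with rfl | hne
  · simp [Real.exp_nonneg]
  have hT1 : (1 : ℝ) ≤ T.card := by exact_mod_cast hne.card_pos
  set L := Real.log T.card with hL
  have hexpL : Real.exp L = T.card := Real.exp_log (by linarith)
  have hL0 : 0 ≤ L := Real.log_nonneg hT1
  have h4 : (0 : ℝ) < 4 ^ l := by positivity
  have h41 : (1 : ℝ) ≤ 4 ^ l := one_le_pow₀ (by norm_num)
  -- With `n` about `2 log |T| / δ` points, a union bound over all pairs applies.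
  set n := ⌈(2 * L + 1) * 4 ^ l⌉₊ with hn
  have hn1 : (2 * L + 1) * 4 ^ l ≤ n := Nat.le_ceil _
  have hn2 : (n : ℝ) < (2 * L + 1) * 4 ^ l + 1 := Nat.ceil_lt_add_one (by positivity)
  have hcard := card_le_pow_of_separated hw hw1 (hv.trans (Nat.le_succ v)) hsep (n := n) (by
    rw [← hexpL, ← Real.exp_nat_mul, ← Real.exp_add, Real.exp_lt_one_iff]
    have : (1 / 4 : ℝ) ^ l * ((2 * L + 1) * 4 ^ l) = 2 * L + 1 := by
      rw [one_div, inv_pow]; field_simp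
    have h := mul_le_mul_of_nonneg_left hn1 (by positivity : (0 : ℝ) ≤ (1 / 4) ^ l)
    push_cast
    linarith)
  have hcard' : (T.card : ℝ) ≤ ((n : ℝ) + 1) ^ (v + 1) := by exact_mod_cast hcard
  have hn3 : (n : ℝ) + 1 ≤ 4 ^ l * (2 * L + 3) := by nlinarith
  set V : ℝ := (v : ℝ) + 1 with hV
  have hV1 : 1 ≤ V := by rw [hV]; linarith [(Nat.cast_nonneg v : (0 : ℝ) ≤ v)]
  have h5 : L ≤ V * (l * Real.log 4 + Real.log (2 * L + 3)) := by
    calc L ≤ Real.log (((n : ℝ) + 1) ^ (v + 1)) := Real.log_le_log (by linarith) hcard'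
      _ = V * Real.log ((n : ℝ) + 1) := by rw [Real.log_pow]; push_cast; rfl
      _ ≤ V * Real.log (4 ^ l * (2 * L + 3)) := by
        gcongr
      _ = _ := by rw [Real.log_mul (by positivity) (by positivity), Real.log_pow]
  have hlog4 : Real.log 4 ≤ 2 := by
    have : (4 : ℝ) = 2 ^ 2 := by norm_num
    rw [this, Real.log_pow]; push_cast; linarith [Real.log_two_lt_d9]
  have h6 : Real.log (2 * L + 3) ≤ (2 * L + 3) / (4 * V) + 4 * V := by
    have e : 2 * L + 3 = (2 * L + 3) / (4 * V) * (4 * V) := by field_simp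
    rw [e, Real.log_mul (by positivity) (by positivity), ← e]
    linarith [Real.log_le_sub_one_of_pos (show 0 < (2 * L + 3) / (4 * V) by positivity),
      Real.log_le_sub_one_of_pos (show 0 < 4 * V by positivity)]
  have h7 : V * ((2 * L + 3) / (4 * V)) = (2 * L + 3) / 4 := by field_simp
  have hl0 : (0 : ℝ) ≤ l := Nat.cast_nonneg l
  have h8 : L ≤ V * (l * 2 + ((2 * L + 3) / (4 * V) + 4 * V)) :=
    h5.trans (by gcongr)
  rw [← hexpL, Real.exp_le_exp, vcConst, ← hV]
  have h9 : V * (l * 2 + ((2 * L + 3) / (4 * V) + 4 * V))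
      = 2 * V * l + (2 * L + 3) / 4 + 4 * V ^ 2 := by
    rw [mul_add, mul_add, h7]; ring
  rw [h9] at h8
  have h10 : V * l ≤ V ^ 2 * l := by gcongr; nlinarith
  nlinarith

/-- A family of VC dimension at most `v` has covering numbers of at most polynomial growth with
respect to every weighted counting measure. -/
lemma exists_finset_net [Fintype ι] {w : ι → ℝ} (hw : ∀ j, 0 ≤ w j)
    {T : Finset (Finset ι)} {v : ℕ} (hv : T.vcDim ≤ v) (l : ℕ) :
    ∃ S ⊆ T, (∀ J ∈ T, ∃ K ∈ S, ∑ j ∈ J ∆ K, w j ≤ (1 / 4 : ℝ) ^ l * ∑ j, w j) ∧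
      (S.card : ℝ) ≤ Real.exp (vcConst v * (l + 1)) := by
  classical
  set q := ∑ j, w j with hq
  let sep : Finset (Finset (Finset ι)) := T.powerset.filter fun S =>
    ∀ J ∈ S, ∀ K ∈ S, J ≠ K → (1 / 4 : ℝ) ^ l * q < ∑ j ∈ J ∆ K, w j
  obtain ⟨S, hS, hmax⟩ := sep.exists_max_image Finset.card ⟨∅, by simp [sep]⟩
  simp only [sep, Finset.mem_filter, Finset.mem_powerset] at hS hmax
  refine ⟨S, hS.1, fun J hJ => ?_, ?_⟩
  · by_contra! hcon
    have hJS : J ∉ S := by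
      intro h
      have h1 := hcon J h
      rw [symmDiff_self, Finset.bot_eq_empty, Finset.sum_empty] at h1
      have h2 : 0 ≤ (1 / 4 : ℝ) ^ l * q :=
        mul_nonneg (by positivity) (Finset.sum_nonneg fun j _ => hw j)
      linarith
    have := hmax (insert J S) ⟨Finset.insert_subset hJ hS.1, ?_⟩
    · rw [Finset.card_insert_of_notMem hJS] at this; omega
    · intro A hA B hB hAB
      rcases Finset.mem_insert.1 hA with hA' | hA' <;>
        rcases Finset.mem_insert.1 hB with hB' | hB'
      · exact absurd (hA'.trans hB'.symm) hAB
      · rw [hA']; exact hcon B hB'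
      · rw [hB', symmDiff_comm]; exact hcon A hA'
      · exact hS.2 A hA' B hB' hAB
  · have hq0 : 0 ≤ q := Finset.sum_nonneg fun j _ => hw j
    rcases hq0.eq_or_lt with h0 | hpos
    · have : S.card ≤ 1 := by
        rw [Finset.card_le_one]
        intro A hA B hB
        by_contra hAB
        have h1 := hS.2 A hA B hB hAB
        have h2 : ∑ j ∈ A ∆ B, w j ≤ q :=
          Finset.sum_le_univ_sum_of_nonneg hw
        rw [← h0] at h1 h2
        linarith
      calc (S.card : ℝ) ≤ 1 := by exact_mod_cast this
        _ ≤ _ := Real.one_le_exp (mul_nonneg (by linarith [vcConst_ge v]) (by positivity))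
    · refine card_le_exp_of_separated (w := fun j => w j / q) (fun j => div_nonneg (hw j) hq0)
        (by rw [← Finset.sum_div, ← hq, div_self hpos.ne'])
        ((Finset.vcDim_mono hS.1).trans hv) fun J hJ K hK hJK => ?_
      rw [← Finset.sum_div, le_div_iff₀ hpos]
      exact (hS.2 J hJ K hK hJK).le

end Packing

/-! ### Chaining -/

/-- The coefficients `1_J - 1_K` of the difference of the sums over `J` and over `K`. -/
def diffCoeff {ι : Type*} [DecidableEq ι] (J K : Finset ι) (j : ι) : ℝ :=
  (if j ∈ J then 1 else 0) - (if j ∈ K then 1 else 0)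

lemma diffCoeff_sq {ι : Type*} [DecidableEq ι] (J K : Finset ι) (j : ι) :
    diffCoeff J K j ^ 2 = if j ∈ J ∆ K then 1 else 0 := by
  unfold diffCoeff
  by_cases h1 : j ∈ J <;> by_cases h2 : j ∈ K <;> simp [Finset.mem_symmDiff, h1, h2]

lemma sum_diffCoeff_smul {ι E : Type*} [Fintype ι] [DecidableEq ι] [AddCommGroup E] [Module ℝ E]
    (J K : Finset ι) (x : ι → E) :
    ∑ j, diffCoeff J K j • x j = ∑ j ∈ J, x j - ∑ j ∈ K, x j := by
  simp only [diffCoeff, sub_smul, ite_smul, one_smul, zero_smul, Finset.sum_sub_distrib]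
  simp

lemma sum_diffCoeff_sq_mul {ι : Type*} [Fintype ι] [DecidableEq ι] (J K : Finset ι) (x : ι → ℝ) :
    ∑ j, diffCoeff J K j ^ 2 * x j = ∑ j ∈ J ∆ K, x j := by
  simp only [diffCoeff_sq, ite_mul, one_mul, zero_mul]
  simp

section Chaining

variable {ι E : Type*} [Fintype ι] [DecidableEq ι] [NormedAddCommGroup E] [InnerProductSpace ℝ E]

/-- The maximal inequality for differences of Rademacher sums over pairs of index sets. -/
lemma sum_norm_signOn_diff_le {G : Type*} [Fintype G] (y : ι → E) (J K : G → Finset ι) {σ M : ℝ}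
    (hσ : 0 ≤ σ) (hM : 1 ≤ M) (hG : (Fintype.card G : ℝ) ≤ M)
    (hJK : ∀ g, ∑ j ∈ J g ∆ K g, ‖y j‖ ^ 2 ≤ σ ^ 2) :
    ∑ s : Finset ι, ‖fun g => ∑ j ∈ J g, signOn s j • y j - ∑ j ∈ K g, signOn s j • y j‖
      ≤ 2 ^ Fintype.card ι * (σ * (Real.log (2 * M) + 1 / 2)) := by
  refine le_trans (le_of_eq ?_) (sum_norm_signOn_le (fun g j => diffCoeff (J g) (K g) j • y j)
    hσ hM hG fun g => ?_)
  · refine Finset.sum_congr rfl fun s _ => ?_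
    congr 1; funext g
    rw [← sum_diffCoeff_smul]
    exact Finset.sum_congr rfl fun j _ => smul_comm _ _ _
  · refine le_trans (le_of_eq ?_) (hJK g)
    rw [← sum_diffCoeff_sq_mul]
    exact Finset.sum_congr rfl fun j _ => by
      rw [norm_smul, mul_pow, Real.norm_eq_abs, sq_abs]

lemma norm_sum_sub_sum_le_sqrt (z : ι → E) (J K : Finset ι) :
    ‖∑ j ∈ J, z j - ∑ j ∈ K, z j‖ ^ 2 ≤ Fintype.card ι * ∑ j ∈ J ∆ K, ‖z j‖ ^ 2 := by
  rw [← sum_diffCoeff_smul, ← sum_diffCoeff_sq_mul]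
  calc ‖∑ j, diffCoeff J K j • z j‖ ^ 2 ≤ (∑ j, ‖diffCoeff J K j • z j‖) ^ 2 := by
        gcongr; exact norm_sum_le _ _
    _ ≤ Fintype.card ι * ∑ j, ‖diffCoeff J K j • z j‖ ^ 2 := sq_sum_le_card_mul_sum_sq
    _ = _ := by
      congr 1
      exact Finset.sum_congr rfl fun j _ => by
        rw [norm_smul, mul_pow, Real.norm_eq_abs, sq_abs]

lemma sum_Ico_half_pow_le {l L : ℕ} (h : l ≤ L) :
    ∑ i ∈ Finset.Ico l L, (1 / 2 : ℝ) ^ i * (i + 1) ≤ (1 / 2 : ℝ) ^ l * (2 * l + 4) := by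
  have key : ∑ i ∈ Finset.Ico l L, (1 / 2 : ℝ) ^ i * (i + 1)
      = (1 / 2 : ℝ) ^ l * (2 * l + 4) - (1 / 2 : ℝ) ^ L * (2 * L + 4) := by
    induction L, h using Nat.le_induction with
    | base => simp
    | succ n hn ih => rw [Finset.sum_Ico_succ_top hn, ih]; push_cast; ring
  rw [key]
  have : 0 ≤ (1 / 2 : ℝ) ^ L * (2 * L + 4) := by positivity
  linarith

lemma sum_symmDiff_le_of_sum_symmDiff_le {w : ι → ℝ} (hw : ∀ j, 0 ≤ w j) (J K R : Finset ι) :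
    ∑ j ∈ J ∆ R, w j ≤ ∑ j ∈ J ∆ K, w j + ∑ j ∈ K ∆ R, w j := by
  calc ∑ j ∈ J ∆ R, w j ≤ ∑ j ∈ J ∆ K ∪ K ∆ R, w j :=
        Finset.sum_le_sum_of_subset_of_nonneg (symmDiff_triangle J K R) fun j _ _ => hw j
    _ ≤ _ := by
      rw [← Finset.sum_union_inter]
      linarith [Finset.sum_nonneg fun j (_ : j ∈ (J ∆ K) ∩ (K ∆ R)) => hw j]

/-- Chaining for Rademacher sums in a Hilbert space over a family of index sets with bounded VC
dimension. The increments are sub-Gaussian with respect to the metric given by the weights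
`‖y j‖ ^ 2`, and the bound depends on the family through its VC dimension only. The first term on
the right comes from the scales finer than `2 ^ (-l)`, and the second one from scale `2 ^ (-l)`. -/
theorem sum_norm_signOn_chaining {G : Type*} [Fintype G] (y : ι → E) {T : Finset (Finset ι)}
    {v : ℕ} (hv : T.vcDim ≤ v) (J K : G → Finset ι) (hJ : ∀ g, J g ∈ T) (hK : ∀ g, K g ∈ T)
    {D : ℝ} (hD : 0 ≤ D) (hJK : ∀ g, ∑ j ∈ J g ∆ K g, ‖y j‖ ^ 2 ≤ D ^ 2) (l : ℕ) :
    ∑ s : Finset ι, ‖fun g => ∑ j ∈ J g, signOn s j • y j - ∑ j ∈ K g, signOn s j • y j‖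
      ≤ 2 ^ Fintype.card ι * (40 * vcConst v * (l + 2) * (1 / 2) ^ l * √(∑ j, ‖y j‖ ^ 2)
        + 3 * vcConst v * (l + 1) * D) := by
  set C := vcConst v with hC
  have hC16 : 16 ≤ C := vcConst_ge v
  set q := ∑ j, ‖y j‖ ^ 2 with hq
  have hq0 : 0 ≤ q := Finset.sum_nonneg fun j _ => by positivity
  have hqs : √q ^ 2 = q := Real.sq_sqrt hq0
  have hw : ∀ j, 0 ≤ ‖y j‖ ^ 2 := fun j => by positivity
  -- nets at all scales, and the projections to them
  choose S hST hSnet hScard using fun i => exists_finset_net hw hv i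
  choose! π hπS hπ using hSnet
  obtain ⟨L, hlL, hL⟩ : ∃ L, l ≤ L ∧ (Fintype.card ι : ℝ) ≤ 4 ^ (L - l) := by
    obtain ⟨k, hk⟩ := pow_unbounded_of_one_lt (Fintype.card ι : ℝ) (by norm_num : (1 : ℝ) < 4)
    exact ⟨l + k, by omega, by simpa using hk.le⟩
  have h24 : ∀ i : ℕ, ((1 / 2 : ℝ) ^ i) ^ 2 = (1 / 4) ^ i := by
    intro i; rw [← pow_mul, mul_comm, pow_mul]; norm_num
  let Z : Finset ι → Finset ι → E := fun s A => ∑ j ∈ A, signOn s j • y j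
  let Link : ℕ → Finset (Finset ι × Finset ι) := fun i =>
    (S i ×ˢ S (i + 1)).filter fun p => ∑ j ∈ p.1 ∆ p.2, ‖y j‖ ^ 2 ≤ (2 * (1 / 2) ^ i * √q) ^ 2
  let Mid : Finset (Finset ι × Finset ι) :=
    (S l ×ˢ S l).filter fun p => ∑ j ∈ p.1 ∆ p.2, ‖y j‖ ^ 2 ≤ (D + 2 * (1 / 2) ^ l * √q) ^ 2
  let link : Finset ι → ℕ → ℝ := fun s i => ‖fun p : Link i => Z s p.1.1 - Z s p.1.2‖
  let mid : Finset ι → ℝ := fun s => ‖fun p : Mid => Z s p.1.1 - Z s p.1.2‖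
  have hlink : ∀ i, ∑ s, link s i
      ≤ 2 ^ Fintype.card ι * (√q * (8 * C) * ((1 / 2) ^ i * (i + 1))) := by
    intro i
    have hcard : (Fintype.card (Link i) : ℝ) ≤ Real.exp (C * (i + 1) + C * (i + 1 + 1)) := by
      rw [Fintype.card_coe, Real.exp_add]
      calc ((Link i).card : ℝ) ≤ ((S i ×ˢ S (i + 1)).card : ℝ) := by
            exact_mod_cast Finset.card_filter_le _ _
        _ = (S i).card * (S (i + 1)).card := by rw [Finset.card_product]; push_cast; rfl
        _ ≤ _ := by
          have := hScard (i + 1)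
          push_cast at this
          exact mul_le_mul (hScard i) this (by positivity) (by positivity)
    refine (sum_norm_signOn_diff_le y (fun p : Link i => p.1.1) (fun p => p.1.2)
      (σ := 2 * (1 / 2) ^ i * √q) (by positivity) (Real.one_le_exp (by positivity)) hcard
      fun p => (Finset.mem_filter.1 p.2).2).trans ?_
    gcongr 2 ^ Fintype.card ι * ?_
    rw [Real.log_mul (by norm_num) (Real.exp_pos _).ne', Real.log_exp]
    have hi : (0 : ℝ) ≤ i := Nat.cast_nonneg i
    have h1 : Real.log 2 + (C * (i + 1) + C * (i + 1 + 1)) + 1 / 2 ≤ 4 * C * (i + 1) := by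
      nlinarith [Real.log_two_lt_d9]
    calc _ ≤ 2 * (1 / 2) ^ i * √q * (4 * C * (i + 1)) := by gcongr
      _ = _ := by ring
  have hmid : ∑ s, mid s
      ≤ 2 ^ Fintype.card ι * ((D + 2 * (1 / 2) ^ l * √q) * (3 * C * (l + 1))) := by
    have hcard : (Fintype.card Mid : ℝ) ≤ Real.exp (C * (l + 1) + C * (l + 1)) := by
      rw [Fintype.card_coe, Real.exp_add]
      calc (Mid.card : ℝ) ≤ ((S l ×ˢ S l).card : ℝ) := by
            exact_mod_cast Finset.card_filter_le _ _
        _ = (S l).card * (S l).card := by rw [Finset.card_product]; push_cast; rfl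
        _ ≤ _ := mul_le_mul (hScard l) (hScard l) (by positivity) (by positivity)
    refine (sum_norm_signOn_diff_le y (fun p : Mid => p.1.1) (fun p => p.1.2)
      (σ := D + 2 * (1 / 2) ^ l * √q) (by positivity) (Real.one_le_exp (by positivity)) hcard
      fun p => (Finset.mem_filter.1 p.2).2).trans ?_
    gcongr 2 ^ Fintype.card ι * ((D + 2 * (1 / 2) ^ l * √q) * ?_)
    rw [Real.log_mul (by norm_num) (Real.exp_pos _).ne', Real.log_exp]
    have hi : (0 : ℝ) ≤ l := Nat.cast_nonneg l
    nlinarith [Real.log_two_lt_d9]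
  -- the chain from a member of the family to its projection at scale `2 ^ (-l)`
  have hchain : ∀ s, ∀ A ∈ T, dist (Z s A) (Z s (π l A))
      ≤ ∑ i ∈ Finset.Ico l L, link s i + (1 / 2) ^ l * √q := by
    intro s A hA
    have hend : dist (Z s (π L A)) (Z s A) ≤ (1 / 2) ^ l * √q := by
      rw [dist_comm, dist_eq_norm]
      refine (pow_le_pow_iff_left₀ (norm_nonneg _) (by positivity) two_ne_zero).1 ?_
      refine (norm_sum_sub_sum_le_sqrt _ _ _).trans ?_
      have h1 : ∑ j ∈ A ∆ π L A, ‖signOn s j • y j‖ ^ 2 ≤ (1 / 4) ^ L * q := by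
        refine le_trans (le_of_eq ?_) (hπ L A hA)
        exact Finset.sum_congr rfl fun j _ => by
          rw [norm_smul, Real.norm_eq_abs, abs_signOn, one_mul]
      calc _ ≤ (4 : ℝ) ^ (L - l) * ((1 / 4) ^ L * q) := by
            gcongr
        _ = ((1 / 2) ^ l * √q) ^ 2 := by
          obtain ⟨k, rfl⟩ := Nat.exists_eq_add_of_le hlL
          rw [mul_pow, hqs, h24, Nat.add_sub_cancel_left, pow_add, one_div, inv_pow, inv_pow]
          field_simp
    have hsteps : dist (Z s (π l A)) (Z s (π L A)) ≤ ∑ i ∈ Finset.Ico l L, link s i := by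
      refine (dist_le_Ico_sum_dist (fun i => Z s (π i A)) hlL).trans
        (Finset.sum_le_sum fun i _ => ?_)
      have hp : (π i A, π (i + 1) A) ∈ Link i := by
        refine Finset.mem_filter.2 ⟨Finset.mem_product.2 ⟨hπS i A hA, hπS (i + 1) A hA⟩, ?_⟩
        refine (sum_symmDiff_le_of_sum_symmDiff_le hw _ A _).trans ?_
        rw [symmDiff_comm]
        refine (add_le_add (hπ i A hA) (hπ (i + 1) A hA)).trans ?_
        rw [mul_pow, mul_pow, hqs, h24, pow_succ]
        have : 0 ≤ (1 / 4 : ℝ) ^ i * q := by positivity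
        rw [← hq]
        linarith
      rw [dist_eq_norm]
      exact norm_le_pi_norm (fun p : Link i => Z s p.1.1 - Z s p.1.2) ⟨_, hp⟩
    rw [dist_comm]
    exact (dist_triangle _ (Z s (π L A)) _).trans (add_le_add hsteps hend)
  have hpoint : ∀ s, ‖fun g => Z s (J g) - Z s (K g)‖
      ≤ 2 * ∑ i ∈ Finset.Ico l L, link s i + 2 * ((1 / 2) ^ l * √q) + mid s := by
    intro s
    have hnn : 0 ≤ ∑ i ∈ Finset.Ico l L, link s i :=
      Finset.sum_nonneg fun i _ => norm_nonneg _
    refine (pi_norm_le_iff_of_nonneg (add_nonneg (by positivity) (norm_nonneg _))).2 fun g => ?_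
    have h1 := hchain s (J g) (hJ g)
    have h2 := hchain s (K g) (hK g)
    have h3 : dist (Z s (π l (J g))) (Z s (π l (K g))) ≤ mid s := by
      have hp : (π l (J g), π l (K g)) ∈ Mid := by
        refine Finset.mem_filter.2 ⟨Finset.mem_product.2 ⟨hπS l _ (hJ g), hπS l _ (hK g)⟩, ?_⟩
        have e1 := sum_symmDiff_le_of_sum_symmDiff_le hw (π l (J g)) (J g) (π l (K g))
        have e2 := sum_symmDiff_le_of_sum_symmDiff_le hw (J g) (K g) (π l (K g))
        have e3 := hπ l _ (hJ g)
        have e4 := hπ l _ (hK g)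
        have e5 := hJK g
        rw [symmDiff_comm] at e3
        have e6 : (D + 2 * (1 / 2) ^ l * √q) ^ 2
            = D ^ 2 + 4 * ((1 / 4) ^ l * q) + 4 * D * ((1 / 2) ^ l * √q) := by
          rw [← h24]; nth_rewrite 2 [← hqs]; ring
        rw [e6]
        have e7 : 0 ≤ (1 / 4 : ℝ) ^ l * q := by positivity
        have e8 : 0 ≤ 4 * D * ((1 / 2) ^ l * √q) := by positivity
        rw [← hq] at e3 e4
        linarith
      rw [dist_eq_norm]
      exact norm_le_pi_norm (fun p : Mid => Z s p.1.1 - Z s p.1.2) ⟨_, hp⟩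
    change ‖Z s (J g) - Z s (K g)‖ ≤ _
    rw [← dist_eq_norm]
    have h4 := dist_triangle4 (Z s (J g)) (Z s (π l (J g))) (Z s (π l (K g))) (Z s (K g))
    rw [dist_comm (Z s (π l (K g)))] at h4
    linarith
  refine (Finset.sum_le_sum fun s _ => hpoint s).trans ?_
  rw [Finset.sum_add_distrib, Finset.sum_add_distrib, ← Finset.mul_sum, Finset.sum_comm]
  have h5 : ∑ i ∈ Finset.Ico l L, ∑ s, link s i
      ≤ 2 ^ Fintype.card ι * (√q * (8 * C) * ((1 / 2) ^ l * (2 * l + 4))) := by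
    refine (Finset.sum_le_sum fun i _ => hlink i).trans ?_
    rw [← Finset.mul_sum, ← Finset.mul_sum]
    gcongr
    exact sum_Ico_half_pow_le hlL
  have h6 : ∑ _s : Finset ι, 2 * ((1 / 2 : ℝ) ^ l * √q)
      = 2 ^ Fintype.card ι * (2 * ((1 / 2) ^ l * √q)) := by
    rw [Finset.sum_const, Finset.card_univ, Fintype.card_finset, nsmul_eq_mul]; push_cast; rfl
  rw [h6]
  have h7 := add_le_add (add_le_add (mul_le_mul_of_nonneg_left h5 two_pos.le)
    (le_refl (2 ^ Fintype.card ι * (2 * ((1 / 2 : ℝ) ^ l * √q))))) hmid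
  refine h7.trans ?_
  have hl : (0 : ℝ) ≤ l := Nat.cast_nonneg l
  have h8 : 2 * (√q * (8 * C) * ((1 / 2) ^ l * (2 * l + 4))) + 2 * ((1 / 2) ^ l * √q)
      + (D + 2 * (1 / 2) ^ l * √q) * (3 * C * (l + 1))
      ≤ 40 * C * (l + 2) * (1 / 2) ^ l * √q + 3 * C * (l + 1) * D := by
    have h9 : 2 + 6 * (C * (l + 1)) + 32 * (C * (l + 2)) ≤ 40 * (C * (l + 2)) := by nlinarith
    have h10 : 0 ≤ (1 / 2 : ℝ) ^ l * √q := by positivity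
    have := mul_le_mul_of_nonneg_right h9 h10
    linarith
  have := mul_le_mul_of_nonneg_left h8 (by positivity : (0 : ℝ) ≤ 2 ^ Fintype.card ι)
  linarith

end Chaining

/-! ### Symmetrization and asymptotic equicontinuity -/

section Symmetrization

variable {Ω V : Type*} [MeasurableSpace Ω] {P : Measure Ω} [IsProbabilityMeasure P]
  [NormedAddCommGroup V] [NormedSpace ℝ V] [CompleteSpace V] [SecondCountableTopology V]
  [MeasurableSpace V] [BorelSpace V]

lemma integral_norm_le_integral_norm_sub_of_indepFun {Y Z : Ω → V} (hYZ : IndepFun Y Z P)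
    (hY : Integrable Y P) (hZ : Integrable Z P) (hZ0 : ∫ ω, Z ω ∂P = 0) :
    ∫ ω, ‖Y ω‖ ∂P ≤ ∫ ω, ‖Y ω - Z ω‖ ∂P := by
  have hYm := hY.aestronglyMeasurable.aemeasurable
  have hZm := hZ.aestronglyMeasurable.aemeasurable
  have hlaw := (indepFun_iff_map_prod_eq_prod_map_map hYm hZm).1 hYZ
  have : IsProbabilityMeasure (P.map Z) := Measure.isProbabilityMeasure_map hZm
  have : IsProbabilityMeasure (P.map Y) := Measure.isProbabilityMeasure_map hYm
  have hYi : Integrable (fun y : V => y) (P.map Y) :=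
    (integrable_map_measure aestronglyMeasurable_id hYm).2 hY
  have hZi : Integrable (fun z : V => z) (P.map Z) :=
    (integrable_map_measure aestronglyMeasurable_id hZm).2 hZ
  have hZ0' : ∫ z, z ∂(P.map Z) = 0 := by
    exact (integral_map hZm aestronglyMeasurable_id).trans hZ0
  have hint : Integrable (fun p : V × V => ‖p.1 - p.2‖) ((P.map Y).prod (P.map Z)) :=
    ((hYi.comp_fst _).sub (hZi.comp_snd _)).norm
  have e1 : ∫ ω, ‖Y ω - Z ω‖ ∂P = ∫ y, ∫ z, ‖y - z‖ ∂(P.map Z) ∂(P.map Y) := by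
    rw [← integral_prod _ hint, ← hlaw,
      integral_map (hYm.prodMk hZm) (by rw [hlaw]; exact hint.aestronglyMeasurable)]
  rw [e1, ← integral_map (f := fun y : V => ‖y‖) hYm hYi.norm.aestronglyMeasurable]
  refine integral_mono hYi.norm hint.integral_prod_left fun y => ?_
  calc ‖y‖ = ‖∫ z, (y - z) ∂(P.map Z)‖ := by
        rw [integral_sub (integrable_const _) hZi, hZ0']; simp
    _ ≤ ∫ z, ‖y - z‖ ∂(P.map Z) := norm_integral_le_integral_norm _

/-- Symmetrization without an independent copy: the signs may be fixed in advance. Conditioning on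
the summands on one side of the sign pattern removes those on the other side. -/
lemma integral_norm_sum_le_two_mul_integral_norm_signOn {ι : Type*} [Fintype ι] {X : ι → Ω → V}
    (hX : iIndepFun X P) (hi : ∀ j, Integrable (X j) P) (h0 : ∀ j, ∫ ω, X j ω ∂P = 0)
    (s : Finset ι) :
    ∫ ω, ‖∑ j, X j ω‖ ∂P ≤ 2 * ∫ ω, ‖∑ j, signOn s j • X j ω‖ ∂P := by
  classical
  let Y : Ω → V := fun ω => ∑ j ∈ s, X j ω
  let Z : Ω → V := fun ω => ∑ j ∈ sᶜ, X j ω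
  have hY : Integrable Y P := integrable_finsetSum _ fun j _ => hi j
  have hZ : Integrable Z P := integrable_finsetSum _ fun j _ => hi j
  have hY0 : ∫ ω, Y ω ∂P = 0 := by
    simp only [Y]; rw [integral_finsetSum _ fun j _ => hi j]; simp [h0]
  have hZ0 : ∫ ω, Z ω ∂P = 0 := by
    simp only [Z]; rw [integral_finsetSum _ fun j _ => hi j]; simp [h0]
  have hYZ : IndepFun Y Z P := by
    have h := hX.indepFun_finset₀ s sᶜ disjoint_compl_right
      fun j => (hi j).aestronglyMeasurable.aemeasurable
    have h' := h.comp (φ := fun x : s → V => ∑ j, x j)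
      (ψ := fun x : (sᶜ : Finset ι) → V => ∑ j, x j)
      (by fun_prop) (by fun_prop)
    convert h' using 1
    · funext ω; exact (Finset.sum_coe_sort s fun j => X j ω).symm
    · funext ω; exact (Finset.sum_coe_sort sᶜ fun j => X j ω).symm
  have e1 : ∀ ω, ∑ j, X j ω = Y ω + Z ω := fun ω => (Finset.sum_add_sum_compl s _).symm
  have e2 : ∀ ω, ∑ j, signOn s j • X j ω = Y ω - Z ω := by
    intro ω
    rw [← Finset.sum_add_sum_compl s, sub_eq_add_neg]
    congr 1
    · exact Finset.sum_congr rfl fun j hj => by simp [signOn, hj]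
    · simp only [Z]
      rw [← Finset.sum_neg_distrib]
      exact Finset.sum_congr rfl fun j hj => by simp [signOn, Finset.mem_compl.1 hj]
  simp only [e1, e2]
  have h1 := integral_norm_le_integral_norm_sub_of_indepFun hYZ hY hZ hZ0
  have h2 := integral_norm_le_integral_norm_sub_of_indepFun hYZ.symm hZ hY hY0
  simp only [norm_sub_rev (Z _)] at h2
  calc ∫ ω, ‖Y ω + Z ω‖ ∂P ≤ ∫ ω, (‖Y ω‖ + ‖Z ω‖) ∂P :=
        integral_mono (hY.add hZ).norm (hY.norm.add hZ.norm) fun ω => norm_add_le _ _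
    _ = ∫ ω, ‖Y ω‖ ∂P + ∫ ω, ‖Z ω‖ ∂P := integral_add hY.norm hZ.norm
    _ ≤ _ := by linarith

end Symmetrization

lemma integral_sqrt_le {Ω : Type*} [MeasurableSpace Ω] {P : Measure Ω} [IsProbabilityMeasure P]
    {f : Ω → ℝ} (hf0 : ∀ ω, 0 ≤ f ω) (hf : Integrable f P) {a : ℝ} (ha : 0 < a)
    (hfa : ∫ ω, f ω ∂P ≤ a ^ 2) :
    Integrable (fun ω => √(f ω)) P ∧ ∫ ω, √(f ω) ∂P ≤ a := by
  have hg : Integrable (fun ω => (2 * a)⁻¹ * f ω + a / 2) P :=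
    (hf.const_mul _).add (integrable_const _)
  have hle : ∀ ω, √(f ω) ≤ (2 * a)⁻¹ * f ω + a / 2 := by
    intro ω
    have h1 := Real.sq_sqrt (hf0 ω)
    have h2 : (2 * a)⁻¹ * f ω + a / 2 - √(f ω) = (2 * a)⁻¹ * (√(f ω) - a) ^ 2 := by
      rw [← h1]; field_simp; rw [Real.sqrt_sq (Real.sqrt_nonneg _)]; ring
    have : 0 ≤ (2 * a)⁻¹ * (√(f ω) - a) ^ 2 := by positivity
    linarith
  have hint : Integrable (fun ω => √(f ω)) P := by
    refine hg.mono' (Real.continuous_sqrt.comp_aestronglyMeasurable hf.aestronglyMeasurable) ?_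
    exact .of_forall fun ω => by rw [Real.norm_of_nonneg (Real.sqrt_nonneg _)]; exact hle ω
  refine ⟨hint, (integral_mono hint hg hle).trans ?_⟩
  rw [integral_add (hf.const_mul _) (integrable_const _), integral_const_mul]
  simp only [integral_const, probReal_univ, smul_eq_mul, one_mul]
  have : (2 * a)⁻¹ * ∫ ω, f ω ∂P ≤ (2 * a)⁻¹ * a ^ 2 := by gcongr
  have e : (2 * a)⁻¹ * a ^ 2 = a / 2 := by field_simp
  linarith

/-- Independent centred random vectors with unit second moments, whose squared norms contribute at
most `ρ` above the truncation level `c`. -/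
structure TruncatedIncrements {Ω ι E : Type*} [MeasurableSpace Ω] [NormedAddCommGroup E]
    [InnerProductSpace ℝ E] [MeasurableSpace E] (P : Measure Ω) (X : ι → Ω → E) (c ρ : ℝ) :
    Prop where
  indep : iIndepFun X P
  memLp : ∀ j, MemLp (X j) 2 P
  centred : ∀ j, ∫ ω, X j ω ∂P = 0
  normalised : ∀ j, ∫ ω, ‖X j ω‖ ^ 2 ∂P = 1
  tail_le : ∀ j, ∫ ω, {ω | c < ‖X j ω‖ ^ 2}.indicator (fun ω => ‖X j ω‖ ^ 2) ω ∂P ≤ ρ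

lemma TruncatedIncrements.integrable_sq {Ω ι E : Type*} [MeasurableSpace Ω] {P : Measure Ω}
    [NormedAddCommGroup E] [InnerProductSpace ℝ E] [MeasurableSpace E] {X : ι → Ω → E} {c ρ : ℝ}
    (h : TruncatedIncrements P X c ρ) (j : ι) : Integrable (fun ω => ‖X j ω‖ ^ 2) P :=
  (h.memLp j).integrable_norm_pow two_ne_zero

lemma TruncatedIncrements.integrable_tail {Ω ι E : Type*} [MeasurableSpace Ω] {P : Measure Ω}
    [NormedAddCommGroup E] [InnerProductSpace ℝ E] [MeasurableSpace E] {X : ι → Ω → E} {c ρ : ℝ}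
    (h : TruncatedIncrements P X c ρ) (j : ι) :
    Integrable ({ω | c < ‖X j ω‖ ^ 2}.indicator fun ω => ‖X j ω‖ ^ 2) P :=
  (h.integrable_sq j).indicator₀
    (nullMeasurableSet_lt aemeasurable_const (h.integrable_sq j).aestronglyMeasurable.aemeasurable)

section Equicontinuity

variable {Ω ι E : Type*} [MeasurableSpace Ω] {P : Measure Ω} [IsProbabilityMeasure P]
  [Fintype ι] [DecidableEq ι]
  [NormedAddCommGroup E] [InnerProductSpace ℝ E] [CompleteSpace E] [SecondCountableTopology E]
  [MeasurableSpace E] [BorelSpace E]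

/-- A bound for the modulus of continuity of the partial sum process in the counting metric, at
distance `δ`. The chaining starts at level `l`, and `c`, `ρ` are the truncation parameters. -/
noncomputable def sumModulus (v l : ℕ) (c ρ δ : ℝ) : ℝ :=
  2 * (40 * vcConst v * (l + 2) * (1 / 2) ^ l + 3 * vcConst v * (l + 1) * √(c * δ + ρ))

/-- Sums of independent vectors over a family of bounded VC dimension have a modulus of continuity
that depends neither on the dimension of the space nor on the number of summands. -/
theorem TruncatedIncrements.integral_norm_diff_le {X : ι → Ω → E} {c ρ : ℝ}
    (h : TruncatedIncrements P X c ρ) (hc : 0 ≤ c) (hρ : 0 < ρ) [Nonempty ι]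
    {G : Type*} [Fintype G] {T : Finset (Finset ι)} {v : ℕ} (hv : T.vcDim ≤ v)
    (J K : G → Finset ι) (hJ : ∀ g, J g ∈ T) (hK : ∀ g, K g ∈ T) {δ : ℝ} (hδ : 0 ≤ δ)
    (hJK : ∀ g, ((J g ∆ K g).card : ℝ) ≤ δ * Fintype.card ι) (l : ℕ) :
    ∫ ω, ‖fun g => ∑ j ∈ J g, X j ω - ∑ j ∈ K g, X j ω‖ ∂P
      ≤ √(Fintype.card ι) * sumModulus v l c ρ δ := by
  set N : ℝ := (Fintype.card ι : ℝ) with hN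
  have hNpos : 0 < N := by rw [hN]; exact_mod_cast Fintype.card_pos
  set tail : ι → Ω → ℝ := fun j => {ω | c < ‖X j ω‖ ^ 2}.indicator fun ω => ‖X j ω‖ ^ 2
    with htail
  have htail0 : ∀ j ω, 0 ≤ tail j ω := fun j ω =>
    Set.indicator_nonneg (fun _ _ => by positivity) _
  let q : Ω → ℝ := fun ω => ∑ j, ‖X j ω‖ ^ 2
  let D2 : Ω → ℝ := fun ω => N * (c * δ) + ∑ j, tail j ω
  have hq0 : ∀ ω, 0 ≤ q ω := fun ω => Finset.sum_nonneg fun j _ => by positivity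
  have hD0 : ∀ ω, 0 ≤ D2 ω := fun ω =>
    add_nonneg (by positivity) (Finset.sum_nonneg fun j _ => htail0 j ω)
  have hqi : Integrable q P := integrable_finsetSum _ fun j _ => h.integrable_sq j
  have hti : Integrable (fun ω => ∑ j, tail j ω) P :=
    integrable_finsetSum _ fun j _ => h.integrable_tail j
  have hDi : Integrable D2 P := (integrable_const _).add hti
  have hqI : ∫ ω, q ω ∂P ≤ √N ^ 2 := by
    simp only [q]
    rw [integral_finsetSum _ fun j _ => h.integrable_sq j, Real.sq_sqrt hNpos.le]
    simp [h.normalised, hN]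
  have hDI : ∫ ω, D2 ω ∂P ≤ (√N * √(c * δ + ρ)) ^ 2 := by
    simp only [D2]
    rw [integral_add (integrable_const _) hti, integral_finsetSum _ fun j _ => h.integrable_tail j,
      mul_pow, Real.sq_sqrt hNpos.le, Real.sq_sqrt (by positivity)]
    have : ∑ j, ∫ ω, tail j ω ∂P ≤ N * ρ := by
      refine (Finset.sum_le_sum fun j _ => h.tail_le j).trans (le_of_eq ?_)
      simp [hN]
    simp only [integral_const, probReal_univ, smul_eq_mul, one_mul]
    linarith
  obtain ⟨hqs, hqsI⟩ := integral_sqrt_le hq0 hqi (Real.sqrt_pos.2 hNpos) hqI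
  obtain ⟨hDs, hDsI⟩ := integral_sqrt_le hD0 hDi (a := √N * √(c * δ + ρ)) (by positivity) hDI
  -- the sums as a single sum of random vectors in `G → E` with the supremum norm
  let Φ : ι → E → G → E := fun j x g => diffCoeff (J g) (K g) j • x
  have hΦ : ∀ j, Measurable (Φ j) := fun j => by fun_prop
  let W : ι → Ω → G → E := fun j ω => Φ j (X j ω)
  have hXi : ∀ j, Integrable (X j) P := fun j => (h.memLp j).integrable (by norm_num)
  have hWind : iIndepFun W P := h.indep.comp Φ hΦ
  have hWi : ∀ j, Integrable (W j) P := fun j =>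
    Integrable.of_eval fun g => (hXi j).smul (diffCoeff (J g) (K g) j)
  have hW0 : ∀ j, ∫ ω, W j ω ∂P = 0 := by
    intro j
    funext g
    refine (eval_integral (f := W j)
      (fun g => (hXi j).smul (diffCoeff (J g) (K g) j)) g).trans ?_
    simp only [W, Φ]
    rw [integral_smul, h.centred, smul_zero, Pi.zero_apply]
  have e1 : ∀ ω, (fun g => ∑ j ∈ J g, X j ω - ∑ j ∈ K g, X j ω) = ∑ j, W j ω := by
    intro ω; funext g
    rw [Finset.sum_apply, ← sum_diffCoeff_smul]
  have e2 : ∀ (s : Finset ι) ω, ∑ j, signOn s j • W j ω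
      = fun g => ∑ j ∈ J g, signOn s j • X j ω - ∑ j ∈ K g, signOn s j • X j ω := by
    intro s ω; funext g
    rw [Finset.sum_apply, ← sum_diffCoeff_smul]
    exact Finset.sum_congr rfl fun j _ => smul_comm _ _ _
  have hsum : ∀ ω, ∑ s : Finset ι, ‖∑ j, signOn s j • W j ω‖
      ≤ 2 ^ Fintype.card ι * (40 * vcConst v * (l + 2) * (1 / 2) ^ l * √(q ω)
        + 3 * vcConst v * (l + 1) * √(D2 ω)) := by
    intro ω
    simp only [e2]
    refine sum_norm_signOn_chaining (fun j => X j ω) hv J K hJ hK (Real.sqrt_nonneg _)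
      (fun g => ?_) l
    rw [Real.sq_sqrt (hD0 ω)]
    calc ∑ j ∈ J g ∆ K g, ‖X j ω‖ ^ 2 ≤ ∑ j ∈ J g ∆ K g, (c + tail j ω) := by
          refine Finset.sum_le_sum fun j _ => ?_
          by_cases hj : c < ‖X j ω‖ ^ 2
          · have : tail j ω = ‖X j ω‖ ^ 2 :=
              Set.indicator_of_mem (s := {ω | c < ‖X j ω‖ ^ 2}) hj _
            linarith
          · linarith [htail0 j ω, not_lt.1 hj]
      _ = c * (J g ∆ K g).card + ∑ j ∈ J g ∆ K g, tail j ω := by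
          rw [Finset.sum_add_distrib, Finset.sum_const, nsmul_eq_mul]; ring
      _ ≤ c * (δ * N) + ∑ j, tail j ω := by
          gcongr
          · exact hJK g
          · exact fun j _ _ => htail0 j ω
          · exact Finset.subset_univ _
      _ = D2 ω := by simp only [D2]; ring
  have hsymm := fun s => integral_norm_sum_le_two_mul_integral_norm_signOn hWind hWi hW0 s
  simp only [e1]
  have hsi : ∀ s : Finset ι, Integrable (fun ω => ‖∑ j, signOn s j • W j ω‖) P := fun s =>
    (integrable_finsetSum _ fun j _ => (hWi j).smul (signOn s j)).norm
  have h1 : (2 : ℝ) ^ Fintype.card ι * ∫ ω, ‖∑ j, W j ω‖ ∂P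
      ≤ 2 * ∫ ω, ∑ s : Finset ι, ‖∑ j, signOn s j • W j ω‖ ∂P := by
    rw [integral_finsetSum _ fun s _ => hsi s, Finset.mul_sum]
    refine le_trans (le_of_eq ?_) (Finset.sum_le_sum fun s _ => hsymm s)
    rw [Finset.sum_const, Finset.card_univ, Fintype.card_finset, nsmul_eq_mul]; push_cast; rfl
  have hbi : Integrable (fun ω => (2 : ℝ) ^ Fintype.card ι *
      (40 * vcConst v * (l + 2) * (1 / 2) ^ l * √(q ω) + 3 * vcConst v * (l + 1) * √(D2 ω))) P :=
    ((hqs.const_mul _).add (hDs.const_mul _)).const_mul _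
  have h2 := integral_mono (integrable_finsetSum _ fun s _ => hsi s) hbi hsum
  rw [integral_const_mul, integral_add (hqs.const_mul _) (hDs.const_mul _), integral_const_mul,
    integral_const_mul] at h2
  have hC := vcConst_ge v
  have h3 : 40 * vcConst v * (l + 2) * (1 / 2) ^ l * ∫ ω, √(q ω) ∂P
      + 3 * vcConst v * (l + 1) * ∫ ω, √(D2 ω) ∂P
      ≤ 40 * vcConst v * (l + 2) * (1 / 2) ^ l * √N
        + 3 * vcConst v * (l + 1) * (√N * √(c * δ + ρ)) := by
    gcongr
  have h2p : (0 : ℝ) < 2 ^ Fintype.card ι := by positivity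
  have h4 := h1.trans (mul_le_mul_of_nonneg_left
    (h2.trans (mul_le_mul_of_nonneg_left h3 h2p.le)) two_pos.le)
  refine le_of_mul_le_mul_left (h4.trans (le_of_eq ?_)) h2p
  rw [sumModulus]; ring

end Equicontinuity

section Equicontinuity

variable {Ω ι E : Type*} [MeasurableSpace Ω] {P : Measure Ω} [IsProbabilityMeasure P]
  [Fintype ι] [DecidableEq ι]
  [NormedAddCommGroup E] [InnerProductSpace ℝ E] [CompleteSpace E] [SecondCountableTopology E]
  [MeasurableSpace E] [BorelSpace E]

lemma TruncatedIncrements.measure_exists_norm_diff_le {X : ι → Ω → E} {c ρ : ℝ}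
    (h : TruncatedIncrements P X c ρ) (hc : 0 ≤ c) (hρ : 0 < ρ) [Nonempty ι]
    {T : Finset (Finset ι)} {v : ℕ} (hv : T.vcDim ≤ v) {δ : ℝ} (hδ : 0 ≤ δ) (l : ℕ)
    {η : ℝ} (hη : 0 < η) :
    P {ω | ∃ J ∈ T, ∃ K ∈ T, ((J ∆ K).card : ℝ) ≤ δ * Fintype.card ι ∧
      η * √(Fintype.card ι) < ‖∑ j ∈ J, X j ω - ∑ j ∈ K, X j ω‖}
      ≤ ENNReal.ofReal (sumModulus v l c ρ δ / η) := by
  let G : Finset (Finset ι × Finset ι) :=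
    (T ×ˢ T).filter fun p => ((p.1 ∆ p.2).card : ℝ) ≤ δ * Fintype.card ι
  have hG : ∀ g : G, g.1.1 ∈ T ∧ g.1.2 ∈ T := fun g =>
    Finset.mem_product.1 (Finset.mem_filter.1 g.2).1
  have hN : 0 < √(Fintype.card ι : ℝ) := Real.sqrt_pos.2 (by exact_mod_cast Fintype.card_pos)
  have hE := h.integral_norm_diff_le hc hρ hv (fun g : G => g.1.1) (fun g => g.1.2)
    (fun g => (hG g).1) (fun g => (hG g).2) hδ (fun g => (Finset.mem_filter.1 g.2).2) l
  set F : Ω → ℝ := fun ω => ‖fun g : G => ∑ j ∈ g.1.1, X j ω - ∑ j ∈ g.1.2, X j ω‖ with hF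
  have hXi : ∀ j, Integrable (X j) P := fun j => (h.memLp j).integrable (by norm_num)
  have hFi : Integrable F P := by
    refine Integrable.norm (Integrable.of_eval fun g => ?_)
    exact (integrable_finsetSum _ fun j _ => hXi j).sub (integrable_finsetSum _ fun j _ => hXi j)
  have hM := mul_meas_ge_le_integral_of_nonneg (μ := P) (f := F)
    (.of_forall fun ω => norm_nonneg _) hFi (η * √(Fintype.card ι))
  have hsub : {ω | ∃ J ∈ T, ∃ K ∈ T, ((J ∆ K).card : ℝ) ≤ δ * Fintype.card ι ∧
      η * √(Fintype.card ι) < ‖∑ j ∈ J, X j ω - ∑ j ∈ K, X j ω‖}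
      ⊆ {ω | η * √(Fintype.card ι) ≤ F ω} := by
    rintro ω ⟨J, hJ, K, hK, hJK, hlt⟩
    have hp : (J, K) ∈ G := Finset.mem_filter.2 ⟨Finset.mem_product.2 ⟨hJ, hK⟩, hJK⟩
    exact hlt.le.trans (norm_le_pi_norm
      (fun g : G => ∑ j ∈ g.1.1, X j ω - ∑ j ∈ g.1.2, X j ω) ⟨_, hp⟩)
  refine (measure_mono hsub).trans ?_
  rw [← ofReal_measureReal]
  refine ENNReal.ofReal_le_ofReal ?_
  rw [le_div_iff₀ hη]
  have h1 := hM.trans hE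
  refine le_of_mul_le_mul_left ?_ hN
  linarith

end Equicontinuity

/-! ### Squared norms of sums with uncorrelated, negligible components -/

lemma integral_inner_eq_zero_of_indepFun {Ω : Type*} [MeasurableSpace Ω] {P : Measure Ω}
    {d : ℕ} {V W : Ω → EuclideanSpace ℝ (Fin d)}
    (hVW : IndepFun V W P) (hV : Integrable V P) (hW : Integrable W P)
    (hW0 : ∫ ω, W ω ∂P = 0) : ∫ ω, inner ℝ (V ω) (W ω) ∂P = 0 := by
  have hb : ∀ b : Fin d, Measurable fun x : EuclideanSpace ℝ (Fin d) => x b := fun b => by fun_prop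
  have hVb : ∀ b, Integrable (fun ω => V ω b) P := fun b =>
    (EuclideanSpace.proj b : EuclideanSpace ℝ (Fin d) →L[ℝ] ℝ).integrable_comp hV
  have hWb : ∀ b, Integrable (fun ω => W ω b) P := fun b =>
    (EuclideanSpace.proj b : EuclideanSpace ℝ (Fin d) →L[ℝ] ℝ).integrable_comp hW
  have hWb0 : ∀ b, ∫ ω, W ω b ∂P = 0 := fun b => by
    have := (EuclideanSpace.proj b : EuclideanSpace ℝ (Fin d) →L[ℝ] ℝ).integral_comp_comm hW
    simpa [hW0] using this
  have hind : ∀ b, IndepFun (fun ω => V ω b) (fun ω => W ω b) P := fun b =>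
    hVW.comp (hb b) (hb b)
  have e : ∀ ω, inner ℝ (V ω) (W ω) = ∑ b, V ω b * W ω b := fun ω => by
    rw [PiLp.inner_apply]; exact Finset.sum_congr rfl fun b _ => by simp [mul_comm]
  simp only [e]
  have hi : ∀ b, Integrable (fun ω => V ω b * W ω b) P := fun b =>
    (hind b).integrable_mul (hVb b) (hWb b)
  rw [integral_finsetSum _ fun b _ => hi b]
  refine Finset.sum_eq_zero fun b _ => ?_
  rw [(hind b).integral_fun_mul_eq_mul_integral (hVb b).aestronglyMeasurable
    (hWb b).aestronglyMeasurable, hWb0, mul_zero]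

/-- If the components of `W` are uncorrelated with variances at most `κ`, then the covariance
operator of `W` has norm at most `κ`. -/
lemma integral_inner_sq_le_of_indepFun {Ω : Type*} [MeasurableSpace Ω] {P : Measure Ω}
    {d : ℕ} {S W : Ω → EuclideanSpace ℝ (Fin d)} {κ : ℝ}
    (hSW : IndepFun S W P) (hS : MemLp S 2 P) (hW : MemLp W 2 P)
    (hunc : ∀ a a' : Fin d, a ≠ a' → ∫ ω, W ω a * W ω a' ∂P = 0)
    (hκ : ∀ a : Fin d, ∫ ω, (W ω a) ^ 2 ∂P ≤ κ) :
    Integrable (fun ω => inner ℝ (S ω) (W ω) ^ 2) P ∧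
      ∫ ω, inner ℝ (S ω) (W ω) ^ 2 ∂P ≤ κ * ∫ ω, ‖S ω‖ ^ 2 ∂P := by
  have hSb : ∀ b, MemLp (fun ω => S ω b) 2 P := fun b =>
    (EuclideanSpace.proj b : EuclideanSpace ℝ (Fin d) →L[ℝ] ℝ).comp_memLp' hS
  have hWb : ∀ b, MemLp (fun ω => W ω b) 2 P := fun b =>
    (EuclideanSpace.proj b : EuclideanSpace ℝ (Fin d) →L[ℝ] ℝ).comp_memLp' hW
  have hSS : ∀ b b', Integrable (fun ω => S ω b * S ω b') P := fun b b' =>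
    (hSb b).integrable_mul (hSb b')
  have hWW : ∀ b b', Integrable (fun ω => W ω b * W ω b') P := fun b b' =>
    (hWb b).integrable_mul (hWb b')
  have hbb : ∀ b b' : Fin d, Measurable fun x : EuclideanSpace ℝ (Fin d) => x b * x b' :=
    fun b b' => by fun_prop
  have hind : ∀ b b', IndepFun (fun ω => S ω b * S ω b') (fun ω => W ω b * W ω b') P :=
    fun b b' => hSW.comp (hbb b b') (hbb b b')
  have e : ∀ ω, inner ℝ (S ω) (W ω) ^ 2
      = ∑ b, ∑ b', (S ω b * S ω b') * (W ω b * W ω b') := fun ω => by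
    have : inner ℝ (S ω) (W ω) = ∑ b, S ω b * W ω b := by
      rw [PiLp.inner_apply]; exact Finset.sum_congr rfl fun b _ => by simp [mul_comm]
    rw [this, sq, Finset.sum_mul_sum]
    exact Finset.sum_congr rfl fun b _ => Finset.sum_congr rfl fun b' _ => by ring
  have hi : ∀ b b', Integrable (fun ω => (S ω b * S ω b') * (W ω b * W ω b')) P :=
    fun b b' => (hind b b').integrable_mul (hSS b b') (hWW b b')
  have hii : ∀ b, Integrable (fun ω => ∑ b', (S ω b * S ω b') * (W ω b * W ω b')) P :=
    fun b => integrable_finsetSum _ fun b' _ => hi b b'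
  simp only [e]
  refine ⟨integrable_finsetSum _ fun b _ => hii b, ?_⟩
  rw [integral_finsetSum _ fun b _ => hii b]
  have e2 : ∀ ω, ‖S ω‖ ^ 2 = ∑ b, S ω b * S ω b := fun ω => by
    rw [EuclideanSpace.real_norm_sq_eq]; exact Finset.sum_congr rfl fun b _ => sq _
  simp only [e2]
  rw [integral_finsetSum _ fun b _ => hSS b b, Finset.mul_sum]
  refine Finset.sum_le_sum fun b _ => ?_
  rw [integral_finsetSum _ fun b' _ => hi b b', Finset.sum_eq_single b]
  · rw [(hind b b).integral_fun_mul_eq_mul_integral (hSS b b).aestronglyMeasurable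
      (hWW b b).aestronglyMeasurable, mul_comm]
    refine mul_le_mul_of_nonneg_right ?_ (integral_nonneg fun ω => mul_self_nonneg _)
    simpa only [sq] using hκ b
  · intro b' _ hb
    rw [(hind b b').integral_fun_mul_eq_mul_integral (hSS b b').aestronglyMeasurable
      (hWW b b').aestronglyMeasurable, hunc b b' hb.symm, mul_zero]
  · simp

section Quadratic

variable {Ω : Type*} [MeasurableSpace Ω] {P : Measure Ω} [IsProbabilityMeasure P]

lemma integral_abs_sub_le_sqrt_variance {Z : Ω → ℝ} (hZ : MemLp Z 2 P) {a : ℝ} (ha : 0 < a)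
    (hvar : Var[Z; P] ≤ a ^ 2) : ∫ ω, |Z ω - P[Z]| ∂P ≤ a := by
  have hsq : Integrable (fun ω => (Z ω - P[Z]) ^ 2) P :=
    (hZ.sub (memLp_const _)).integrable_sq
  rw [variance_eq_integral hZ.aestronglyMeasurable.aemeasurable] at hvar
  have := (integral_sqrt_le (fun ω => sq_nonneg _) hsq ha hvar).2
  simpa only [Real.sqrt_sq_eq_abs] using this

/-- The law of large numbers for the squared norms, by truncation. -/
lemma TruncatedIncrements.integral_abs_sum_sq_sub_card_le {ι E : Type*} [Fintype ι] [Nonempty ι]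
    [NormedAddCommGroup E] [InnerProductSpace ℝ E] [MeasurableSpace E] [BorelSpace E]
    {X : ι → Ω → E} {c ρ : ℝ} (h : TruncatedIncrements P X c ρ) (hc : 0 < c) (F : Finset ι) :
    ∫ ω, |∑ j ∈ F, ‖X j ω‖ ^ 2 - F.card| ∂P
      ≤ √(Fintype.card ι * c) + 2 * ρ * Fintype.card ι := by
  set N : ℝ := (Fintype.card ι : ℝ) with hN
  have hNpos : 0 < N := by rw [hN]; exact_mod_cast Fintype.card_pos
  have hFN : (F.card : ℝ) ≤ N := by rw [hN]; exact_mod_cast F.card_le_univ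
  let φ : E → ℝ := fun x => {x : E | ‖x‖ ^ 2 ≤ c}.indicator (fun x => ‖x‖ ^ 2) x
  let ψ : E → ℝ := fun x => {x : E | c < ‖x‖ ^ 2}.indicator (fun x => ‖x‖ ^ 2) x
  have hsplit : ∀ x, ‖x‖ ^ 2 = φ x + ψ x := by
    intro x
    by_cases hx : c < ‖x‖ ^ 2
    · simp [φ, ψ, hx]
    · simp [φ, ψ, hx, not_lt.1 hx]
  have hφm : Measurable φ :=
    (measurable_norm.pow_const 2).indicator (measurableSet_le (by fun_prop) measurable_const)
  have hφ0 : ∀ x, 0 ≤ φ x := fun x => Set.indicator_nonneg (fun _ _ => by positivity) _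
  have hψ0 : ∀ x, 0 ≤ ψ x := fun x => Set.indicator_nonneg (fun _ _ => by positivity) _
  have hφc : ∀ x, φ x ≤ c := fun x => Set.indicator_apply_le' (fun hx => hx) fun _ => hc.le
  have hψi : ∀ j, Integrable (fun ω => ψ (X j ω)) P := fun j => h.integrable_tail j
  have hψρ : ∀ j, ∫ ω, ψ (X j ω) ∂P ≤ ρ := fun j => h.tail_le j
  have hXm : ∀ j, AEMeasurable (X j) P := fun j =>
    (h.memLp j).aestronglyMeasurable.aemeasurable
  have hφL : ∀ j, MemLp (fun ω => φ (X j ω)) 2 P := fun j =>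
    MemLp.of_bound (hφm.comp_aemeasurable (hXm j)).aestronglyMeasurable c
      (.of_forall fun ω => by rw [Real.norm_of_nonneg (hφ0 _)]; exact hφc _)
  have hφi : ∀ j, Integrable (fun ω => φ (X j ω)) P := fun j => (hφL j).integrable (by norm_num)
  have hE : ∀ j, ∫ ω, φ (X j ω) ∂P + ∫ ω, ψ (X j ω) ∂P = 1 := by
    intro j
    rw [← integral_add (hφi j) (hψi j), ← h.normalised j]
    simp only [hsplit]
  have hψE0 : ∀ j, 0 ≤ ∫ ω, ψ (X j ω) ∂P := fun j => integral_nonneg fun ω => hψ0 _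
  let Z : Ω → ℝ := ∑ j ∈ F, fun ω => φ (X j ω)
  have hZL : MemLp Z 2 P := memLp_finsetSum' _ fun j _ => hφL j
  have hvarj : ∀ j, Var[fun ω => φ (X j ω); P] ≤ c := by
    intro j
    refine (variance_le_expectation_sq (hφL j).aestronglyMeasurable).trans ?_
    calc ∫ ω, ((fun ω => φ (X j ω)) ^ 2) ω ∂P ≤ ∫ ω, c * φ (X j ω) ∂P := by
          refine integral_mono (hφL j).integrable_sq ((hφi j).const_mul c) fun ω => ?_
          simp only [Pi.pow_apply, sq]
          exact mul_le_mul_of_nonneg_right (hφc _) (hφ0 _)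
      _ ≤ c := by
          rw [integral_const_mul]
          nlinarith [hE j, hψE0 j]
  have hvar : Var[Z; P] ≤ √(N * c) ^ 2 := by
    rw [Real.sq_sqrt (by positivity)]
    have hind : iIndepFun (fun j ω => φ (X j ω)) P := h.indep.comp (fun _ => φ) fun _ => hφm
    rw [IndepFun.variance_sum (fun j _ => hφL j) fun i _ j _ hij => hind.indepFun hij]
    calc ∑ j ∈ F, Var[fun ω => φ (X j ω); P] ≤ ∑ j ∈ F, c := Finset.sum_le_sum fun j _ => hvarj j
      _ = F.card * c := by rw [Finset.sum_const, nsmul_eq_mul]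
      _ ≤ N * c := by gcongr
  have h1 := integral_abs_sub_le_sqrt_variance hZL (Real.sqrt_pos.2 (by positivity)) hvar
  have hZE : P[Z] = ∑ j ∈ F, ∫ ω, φ (X j ω) ∂P := by
    simp only [Z, Finset.sum_apply]
    exact integral_finsetSum _ fun j _ => hφi j
  have hψs : Integrable (fun ω => ∑ j ∈ F, ψ (X j ω)) P := integrable_finsetSum _ fun j _ => hψi j
  have hψsum : ∑ j ∈ F, ∫ ω, ψ (X j ω) ∂P ≤ ρ * N := by
    have hρ0 : 0 ≤ ρ := (hψE0 (Classical.arbitrary ι)).trans (hψρ _)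
    calc ∑ j ∈ F, ∫ ω, ψ (X j ω) ∂P ≤ ∑ j ∈ F, ρ := Finset.sum_le_sum fun j _ => hψρ j
      _ = F.card * ρ := by rw [Finset.sum_const, nsmul_eq_mul]
      _ ≤ ρ * N := by rw [mul_comm]; gcongr
  have hZi : Integrable (fun ω => |Z ω - P[Z]|) P :=
    ((hZL.integrable (by norm_num)).sub (integrable_const _)).abs
  have hlhs : ∀ ω, |∑ j ∈ F, ‖X j ω‖ ^ 2 - F.card|
      ≤ |Z ω - P[Z]| + (∑ j ∈ F, ψ (X j ω) + ∑ j ∈ F, ∫ ω, ψ (X j ω) ∂P) := by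
    intro ω
    have e : ∑ j ∈ F, ‖X j ω‖ ^ 2 - (F.card : ℝ)
        = (Z ω - P[Z]) + (∑ j ∈ F, ψ (X j ω) - ∑ j ∈ F, ∫ ω, ψ (X j ω) ∂P) := by
      have : (F.card : ℝ) = ∑ j ∈ F, (∫ ω, φ (X j ω) ∂P + ∫ ω, ψ (X j ω) ∂P) := by
        simp [hE]
      rw [this, hZE, Finset.sum_add_distrib]
      simp only [hsplit, Z, Finset.sum_apply, Finset.sum_add_distrib]
      ring
    rw [e]
    refine (abs_add_le _ _).trans (add_le_add_right ?_ _)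
    refine (abs_sub _ _).trans (le_of_eq ?_)
    rw [abs_of_nonneg (Finset.sum_nonneg fun j _ => hψ0 _),
      abs_of_nonneg (Finset.sum_nonneg fun j _ => hψE0 j)]
  have hXi : Integrable (fun ω => |∑ j ∈ F, ‖X j ω‖ ^ 2 - F.card|) P :=
    ((integrable_finsetSum _ fun j _ => h.integrable_sq j).sub (integrable_const _)).abs
  have hψc : Integrable (fun ω => ∑ j ∈ F, ψ (X j ω) + ∑ j ∈ F, ∫ ω, ψ (X j ω) ∂P) P :=
    hψs.add (integrable_const _)
  refine (integral_mono hXi (hZi.add hψc) hlhs).trans ?_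
  rw [integral_add' hZi hψc, integral_add hψs (integrable_const _),
    integral_finsetSum _ fun j _ => hψi j]
  simp only [integral_const, probReal_univ, smul_eq_mul, one_mul]
  linarith

variable {d : ℕ}

/-- The off-diagonal part of `‖∑ W j‖ ^ 2` has a small second moment if the components of the
`W j` are uncorrelated and negligible: it is a sum of martingale differences. -/
lemma integral_offDiag_sq_le {ι : Type*} {W : ι → Ω → EuclideanSpace ℝ (Fin d)} {κ : ℝ}
    (hκ0 : 0 ≤ κ) (hW : iIndepFun W P) (hL : ∀ j, MemLp (W j) 2 P) (h0 : ∀ j, ∫ ω, W j ω ∂P = 0)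
    (h1 : ∀ j, ∫ ω, ‖W j ω‖ ^ 2 ∂P ≤ 1)
    (hunc : ∀ j, ∀ a a' : Fin d, a ≠ a' → ∫ ω, W j ω a * W j ω a' ∂P = 0)
    (hκ : ∀ j, ∀ a : Fin d, ∫ ω, (W j ω a) ^ 2 ∂P ≤ κ) (F : Finset ι) :
    MemLp (fun ω => ‖∑ j ∈ F, W j ω‖ ^ 2 - ∑ j ∈ F, ‖W j ω‖ ^ 2) 2 P ∧
      ∫ ω, (‖∑ j ∈ F, W j ω‖ ^ 2 - ∑ j ∈ F, ‖W j ω‖ ^ 2) ^ 2 ∂P ≤ 4 * κ * F.card ^ 2 ∧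
      ∫ ω, ‖∑ j ∈ F, W j ω‖ ^ 2 ∂P ≤ F.card := by
  classical
  induction F using Finset.induction_on with
  | empty => simp
  | insert l F hl ih =>
    obtain ⟨hQL, hQ2, hS2⟩ := ih
    set S : Ω → EuclideanSpace ℝ (Fin d) := fun ω => ∑ j ∈ F, W j ω with hS
    set Q : Ω → ℝ := fun ω => ‖S ω‖ ^ 2 - ∑ j ∈ F, ‖W j ω‖ ^ 2 with hQ
    have hSL : MemLp S 2 P := memLp_finsetSum _ fun j _ => hL j
    have hpair := hW.indepFun_finset₀ F {l} (by simpa using hl)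
      fun j => (hL j).aestronglyMeasurable.aemeasurable
    have hev : Measurable fun x : ({l} : Finset ι) → EuclideanSpace ℝ (Fin d) =>
        x ⟨l, Finset.mem_singleton_self l⟩ := measurable_pi_apply _
    have hSW : IndepFun S (W l) P := by
      have h := hpair.comp (φ := fun x : F → EuclideanSpace ℝ (Fin d) => ∑ j, x j)
        (by fun_prop) hev
      convert h using 1
      swap
      · rfl
      funext ω; exact (Finset.sum_coe_sort F fun j => W j ω).symm
    have hQSW : IndepFun (fun ω => Q ω • S ω) (W l) P := by
      have h := hpair.comp
        (φ := fun x : F → EuclideanSpace ℝ (Fin d) => (‖∑ j, x j‖ ^ 2 - ∑ j, ‖x j‖ ^ 2) • ∑ j, x j)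
        (by fun_prop) hev
      convert h using 1
      swap
      · rfl
      funext ω
      simp only [Function.comp_def, Q, S]
      rw [Finset.sum_coe_sort F fun j => W j ω, Finset.sum_coe_sort F fun j => ‖W j ω‖ ^ 2]
    have hWi : Integrable (W l) P := (hL l).integrable (by norm_num)
    have hSi : Integrable S P := hSL.integrable (by norm_num)
    have hQSi : Integrable (fun ω => Q ω • S ω) P := memLp_one_iff_integrable.1 (hSL.smul hQL)
    have hI2 := integral_inner_sq_le_of_indepFun hSW hSL (hL l) (hunc l) (hκ l)
    have hI1 := integral_inner_eq_zero_of_indepFun hSW hSi hWi (h0 l)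
    have hQI := integral_inner_eq_zero_of_indepFun hQSW hQSi hWi (h0 l)
    have hIm : AEStronglyMeasurable (fun ω => inner ℝ (S ω) (W l ω)) P :=
      hSL.aestronglyMeasurable.inner (hL l).aestronglyMeasurable
    have hIL : MemLp (fun ω => inner ℝ (S ω) (W l ω)) 2 P :=
      (memLp_two_iff_integrable_sq hIm).2 hI2.1
    have hIi : Integrable (fun ω => inner ℝ (S ω) (W l ω)) P := hIL.integrable (by norm_num)
    have eS : ∀ ω, ∑ j ∈ insert l F, W j ω = S ω + W l ω := fun ω => by
      rw [Finset.sum_insert hl, add_comm]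
    have eQ : ∀ ω, ‖∑ j ∈ insert l F, W j ω‖ ^ 2 - ∑ j ∈ insert l F, ‖W j ω‖ ^ 2
        = Q ω + 2 * inner ℝ (S ω) (W l ω) := fun ω => by
      rw [eS, norm_add_sq_real, Finset.sum_insert hl, hQ]; ring
    simp only [eQ]
    simp only [eS]
    have hS2i : Integrable (fun ω => ‖S ω‖ ^ 2) P := hSL.integrable_norm_pow two_ne_zero
    have hW2i : Integrable (fun ω => ‖W l ω‖ ^ 2) P := (hL l).integrable_norm_pow two_ne_zero
    rw [Finset.card_insert_of_notMem hl]
    push_cast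
    refine ⟨hQL.add (hIL.const_mul 2), ?_, ?_⟩
    · have e : ∀ ω, (Q ω + 2 * inner ℝ (S ω) (W l ω)) ^ 2 = Q ω ^ 2
          + (4 * inner ℝ (Q ω • S ω) (W l ω) + 4 * inner ℝ (S ω) (W l ω) ^ 2) := fun ω => by
        rw [real_inner_smul_left]; ring
      simp only [e]
      have hQIi : Integrable (fun ω => inner ℝ (Q ω • S ω) (W l ω)) P := by
        simp only [real_inner_smul_left]
        exact hQL.integrable_mul hIL
      have hI12 : Integrable (fun ω => 4 * inner ℝ (Q ω • S ω) (W l ω)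
          + 4 * inner ℝ (S ω) (W l ω) ^ 2) P := (hQIi.const_mul 4).add (hI2.1.const_mul 4)
      rw [integral_add hQL.integrable_sq hI12,
        integral_add (hQIi.const_mul 4) (hI2.1.const_mul 4), integral_const_mul,
        integral_const_mul, hQI]
      have h3 : κ * ∫ ω, ‖S ω‖ ^ 2 ∂P ≤ κ * F.card := by gcongr
      have h4 : 0 ≤ κ * F.card := by positivity
      nlinarith [hI2.2]
    · simp only [norm_add_sq_real]
      have hSI : Integrable (fun ω => ‖S ω‖ ^ 2 + 2 * inner ℝ (S ω) (W l ω)) P :=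
        hS2i.add (hIi.const_mul 2)
      rw [integral_add hSI hW2i, integral_add hS2i (hIi.const_mul 2),
        integral_const_mul, hI1]
      linarith [h1 l]

/-- The squared distance between two partial sums is close to the number of summands that
distinguish them. -/
theorem TruncatedIncrements.measure_norm_diff_sq_le {ι : Type*} [Fintype ι] [DecidableEq ι]
    [Nonempty ι] {X : ι → Ω → EuclideanSpace ℝ (Fin d)} {c ρ κ : ℝ}
    (h : TruncatedIncrements P X c ρ) (hc : 0 < c) (hκ0 : 0 < κ)
    (hunc : ∀ j, ∀ a a' : Fin d, a ≠ a' → ∫ ω, X j ω a * X j ω a' ∂P = 0)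
    (hκ : ∀ j, ∀ a : Fin d, ∫ ω, (X j ω a) ^ 2 ∂P ≤ κ) (J K : Finset ι) {η : ℝ} (hη : 0 < η) :
    P {ω | η * Fintype.card ι
        ≤ |‖∑ j ∈ J, X j ω - ∑ j ∈ K, X j ω‖ ^ 2 - (J ∆ K).card|}
      ≤ ENNReal.ofReal ((2 * √κ + √(c / Fintype.card ι) + 2 * ρ) / η) := by
  set N : ℝ := (Fintype.card ι : ℝ) with hN
  have hNpos : 0 < N := by rw [hN]; exact_mod_cast Fintype.card_pos
  let W : ι → Ω → EuclideanSpace ℝ (Fin d) := fun j ω => diffCoeff J K j • X j ω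
  have ha : ∀ j, diffCoeff J K j ^ 2 ≤ 1 := fun j => by rw [diffCoeff_sq]; split_ifs <;> norm_num
  have ha0 : ∀ j, 0 ≤ diffCoeff J K j ^ 2 := fun j => sq_nonneg _
  have hW2 : ∀ j ω, ‖W j ω‖ ^ 2 = diffCoeff J K j ^ 2 * ‖X j ω‖ ^ 2 := fun j ω => by
    simp only [W]; rw [norm_smul, mul_pow, Real.norm_eq_abs, sq_abs]
  obtain ⟨hQL, hQ2, -⟩ := integral_offDiag_sq_le (P := P) (W := W) hκ0.le
    (h.indep.comp (fun j x => diffCoeff J K j • x) fun j => by fun_prop)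
    (fun j => (h.memLp j).const_smul (diffCoeff J K j))
    (fun j => by simp only [W]; rw [integral_smul, h.centred, smul_zero])
    (fun j => by simp only [hW2]; rw [integral_const_mul, h.normalised, mul_one]; exact ha j)
    (fun j a a' haa => by
      have : ∀ ω, W j ω a * W j ω a' = diffCoeff J K j ^ 2 * (X j ω a * X j ω a') := fun ω => by
        simp only [W, PiLp.smul_apply, smul_eq_mul]; ring
      simp only [this]; rw [integral_const_mul, hunc j a a' haa, mul_zero])
    (fun j a => by
      have : ∀ ω, W j ω a ^ 2 = diffCoeff J K j ^ 2 * X j ω a ^ 2 := fun ω => by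
        simp only [W, PiLp.smul_apply, smul_eq_mul]; ring
      simp only [this]; rw [integral_const_mul]
      have h1 : 0 ≤ ∫ ω, X j ω a ^ 2 ∂P := integral_nonneg fun ω => sq_nonneg _
      calc _ ≤ 1 * ∫ ω, X j ω a ^ 2 ∂P := by gcongr; exact ha j
        _ ≤ κ := by rw [one_mul]; exact hκ j a)
    Finset.univ
  have eW : ∀ ω, ∑ j, W j ω = ∑ j ∈ J, X j ω - ∑ j ∈ K, X j ω := fun ω => sum_diffCoeff_smul _ _ _
  have eW2 : ∀ ω, ∑ j, ‖W j ω‖ ^ 2 = ∑ j ∈ J ∆ K, ‖X j ω‖ ^ 2 := fun ω => by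
    simp only [hW2]; exact sum_diffCoeff_sq_mul _ _ _
  simp only [eW, eW2] at hQL hQ2
  rw [Finset.card_univ, ← hN] at hQ2
  have hoff := (integral_sqrt_le (fun ω => sq_nonneg _) hQL.integrable_sq (a := 2 * √κ * N)
    (by positivity) (hQ2.trans (le_of_eq (by rw [mul_pow, mul_pow, Real.sq_sqrt hκ0.le]; ring)))).2
  simp only [Real.sqrt_sq_eq_abs] at hoff
  have hdiag := h.integral_abs_sum_sq_sub_card_le hc (J ∆ K)
  have hdi : Integrable (fun ω => |∑ j ∈ J ∆ K, ‖X j ω‖ ^ 2 - (J ∆ K).card|) P :=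
    ((integrable_finsetSum _ fun j _ => h.integrable_sq j).sub (integrable_const _)).abs
  have hQi := (hQL.integrable (by norm_num : (1 : ℝ≥0∞) ≤ 2)).abs
  have hM := mul_meas_ge_le_integral_of_nonneg (μ := P)
    (.of_forall fun ω => add_nonneg (abs_nonneg _) (abs_nonneg _)) (hQi.add hdi) (η * N)
  have hsub : {ω | η * N ≤ |‖∑ j ∈ J, X j ω - ∑ j ∈ K, X j ω‖ ^ 2 - (J ∆ K).card|}
      ⊆ {ω | η * N ≤ |‖∑ j ∈ J, X j ω - ∑ j ∈ K, X j ω‖ ^ 2 - ∑ j ∈ J ∆ K, ‖X j ω‖ ^ 2|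
        + |∑ j ∈ J ∆ K, ‖X j ω‖ ^ 2 - (J ∆ K).card|} := fun ω hω =>
    le_trans (Set.mem_ofPred.1 hω) (abs_sub_le _ _ _)
  refine (measure_mono hsub).trans ?_
  rw [← ofReal_measureReal]
  refine ENNReal.ofReal_le_ofReal ?_
  rw [integral_add hQi hdi] at hM
  rw [le_div_iff₀ hη]
  refine le_of_mul_le_mul_left ?_ hNpos
  have e : √(N * c) = N * √(c / N) := by
    rw [show N * c = N ^ 2 * (c / N) by field_simp, Real.sqrt_mul (by positivity),
      Real.sqrt_sq hNpos.le]
  rw [e] at hdiag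
  have h5 := hM.trans (add_le_add hoff hdiag)
  have h6 : P.real {ω | η * N ≤ |‖∑ j ∈ J, X j ω - ∑ j ∈ K, X j ω‖ ^ 2 - ∑ j ∈ J ∆ K, ‖X j ω‖ ^ 2|
        + |∑ j ∈ J ∆ K, ‖X j ω‖ ^ 2 - (J ∆ K).card|} * (η * N)
      ≤ 2 * √κ * N + (N * √(c / N) + 2 * ρ * N) := by
    rw [mul_comm]; exact h5
  linarith

end Quadratic

/-! ### Gromov-Hausdorff distance and finite nets -/

/-- Two metric spaces that have finite nets with almost the same distances are close: they can be
glued along the nets. -/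
lemma ghEDist_le_of_nets {X Y κ : Type*} [MetricSpace X] [MetricSpace Y] [Nonempty κ]
    (x : κ → X) (y : κ → Y) {η : ℝ} (hη : 0 < η) (hx : ∀ p, ∃ i, dist p (x i) ≤ η)
    (hy : ∀ p, ∃ i, dist p (y i) ≤ η)
    (hxy : ∀ i j, |dist (x i) (x j) - dist (y i) (y j)| ≤ 2 * η) :
    ghEDist X Y ≤ ENNReal.ofReal (2 * η) := by
  let m : MetricSpace (X ⊕ Y) := Metric.glueMetricApprox x y η hη hxy
  have hl : Isometry (Sum.inl : X → X ⊕ Y) := Isometry.of_dist_eq fun _ _ => rfl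
  have hr : Isometry (Sum.inr : Y → X ⊕ Y) := Isometry.of_dist_eq fun _ _ => rfl
  have hglue : ∀ i, dist (Sum.inl (x i) : X ⊕ Y) (Sum.inr (y i)) = η :=
    fun i => Metric.glueDist_glued_points x y η i
  have hle : ghEDist X Y ≤ Metric.hausdorffEDist (range (Sum.inl : X → X ⊕ Y))
      (range (Sum.inr : Y → X ⊕ Y)) :=
    iInf_le_of_le (X ⊕ Y) <| iInf_le_of_le m <| iInf_le_of_le (Sum.inl : X → X ⊕ Y) <|
      iInf_le_of_le (Sum.inr : Y → X ⊕ Y) <| iInf_le_of_le hl <| iInf_le_of_le hr le_rfl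
  refine hle.trans ?_
  refine Metric.hausdorffEDist_le_of_mem_edist ?_ ?_
  · rintro _ ⟨p, rfl⟩
    obtain ⟨i, hi⟩ := hx p
    refine ⟨_, mem_range_self (y i), ?_⟩
    rw [edist_dist]
    refine ENNReal.ofReal_le_ofReal ((dist_triangle _ (Sum.inl (x i)) _).trans ?_)
    rw [hglue, hl.dist_eq]; linarith
  · rintro _ ⟨p, rfl⟩
    obtain ⟨i, hi⟩ := hy p
    refine ⟨_, mem_range_self (x i), ?_⟩
    rw [edist_dist]
    refine ENNReal.ofReal_le_ofReal ((dist_triangle _ (Sum.inr (y i)) _).trans ?_)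
    rw [dist_comm (Sum.inr (y i)), hglue, hr.dist_eq]; linarith

/-! ### The increments of a single dimension -/

section Increments

variable {Ω : Type*} [MeasurableSpace Ω] {P : Measure Ω}
  {ξ : (d : ℕ) → Ω → EuclideanSpace ℝ (Fin d)}

lemma IncrementConditions.integrable_sq (hξ : IncrementConditions P ξ) {d : ℕ} (hd : 1 ≤ d) :
    Integrable (fun ω => ‖ξ d ω‖ ^ 2) P := by
  by_contra h
  have := hξ.normalised d hd
  rw [integral_undef h] at this
  exact zero_ne_one this

lemma IncrementConditions.exists_truncation (hξ : IncrementConditions P ξ) {ι : ℕ → Type*}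
    {X : (d : ℕ) → ι d → Ω → EuclideanSpace ℝ (Fin d)} (hX : IsIncrementArray P ξ X)
    {ρ : ℝ} (hρ : 0 < ρ) : ∃ c : ℝ, 0 < c ∧ ∀ d, 1 ≤ d → TruncatedIncrements P (X d) c ρ := by
  have hev := ENNReal.tendsto_nhds_zero.1 hξ.uniformlyIntegrable (ENNReal.ofReal ρ)
    (ENNReal.ofReal_pos.2 hρ)
  obtain ⟨c, hc, hc0⟩ := (hev.and (eventually_gt_atTop 0)).exists
  refine ⟨c, hc0, fun d hd => ?_⟩
  have hid := hX.identDistrib d hd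
  have hsq : Measurable fun x : EuclideanSpace ℝ (Fin d) => ‖x‖ ^ 2 := by fun_prop
  have hξsq := hξ.integrable_sq hd
  have hξL : MemLp (ξ d) 2 P :=
    (memLp_two_iff_integrable_sq_norm (hξ.aemeasurable d).aestronglyMeasurable).2 hξsq
  let ψ : EuclideanSpace ℝ (Fin d) → ℝ :=
    fun x => {x : EuclideanSpace ℝ (Fin d) | c < ‖x‖ ^ 2}.indicator (fun x => ‖x‖ ^ 2) x
  have hψ : Measurable ψ := hsq.indicator (measurableSet_lt measurable_const hsq)
  refine ⟨hX.indep d hd, fun j => (hid j).memLp_iff.2 hξL, fun j => ?_, fun j => ?_, fun j => ?_⟩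
  · rw [(hid j).integral_eq, hξ.centred d hd]
  · have := ((hid j).comp hsq).integral_eq
    exact this.trans (hξ.normalised d hd)
  · have h1 : ∫ ω, ψ (X d j ω) ∂P = ∫ ω, ψ (ξ d ω) ∂P := ((hid j).comp hψ).integral_eq
    refine h1.trans_le ?_
    have hnull : NullMeasurableSet {ω | c < ‖ξ d ω‖ ^ 2} P :=
      nullMeasurableSet_lt aemeasurable_const hξsq.aestronglyMeasurable.aemeasurable
    have hψi : Integrable (fun ω => ψ (ξ d ω)) P := hξsq.indicator₀ hnull
    have h2 : ENNReal.ofReal (∫ ω, ψ (ξ d ω) ∂P) ≤ ENNReal.ofReal ρ := by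
      rw [ofReal_integral_eq_lintegral_ofReal hψi
        (.of_forall fun ω => Set.indicator_nonneg (fun _ _ => by positivity) _)]
      refine le_trans (le_of_eq ?_)
        ((le_iSup (fun d => ∫⁻ ω in {ω | c < ‖ξ d ω‖ ^ 2}, ENNReal.ofReal (‖ξ d ω‖ ^ 2) ∂P) d).trans
          hc)
      rw [← lintegral_indicator₀ hnull]
      refine lintegral_congr fun ω => ?_
      by_cases h : c < ‖ξ d ω‖ ^ 2 <;> simp [ψ, h]
    exact (ENNReal.ofReal_le_ofReal_iff hρ.le).1 h2

lemma IncrementConditions.integral_mul_eq_zero (hξ : IncrementConditions P ξ) {ι : ℕ → Type*}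
    {X : (d : ℕ) → ι d → Ω → EuclideanSpace ℝ (Fin d)} (hX : IsIncrementArray P ξ X)
    {d : ℕ} (hd : 1 ≤ d) (j : ι d) (a a' : Fin d) (haa : a ≠ a') :
    ∫ ω, X d j ω a * X d j ω a' ∂P = 0 := by
  have hm : Measurable fun x : EuclideanSpace ℝ (Fin d) => x a * x a' := by fun_prop
  exact ((hX.identDistrib d hd j).comp hm).integral_eq.trans (hξ.uncorrelated d hd a a' haa)

lemma IncrementConditions.eventually_integral_sq_le (hξ : IncrementConditions P ξ) {ι : ℕ → Type*}
    {X : (d : ℕ) → ι d → Ω → EuclideanSpace ℝ (Fin d)} (hX : IsIncrementArray P ξ X)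
    {κ : ℝ} (hκ : 0 < κ) :
    ∀ᶠ d in atTop, ∀ (j : ι d) (a : Fin d), ∫ ω, (X d j ω a) ^ 2 ∂P ≤ κ := by
  filter_upwards [hξ.negligible.eventually_le_const hκ, eventually_ge_atTop 1] with d hd hd1 j a
  have hm : Measurable fun x : EuclideanSpace ℝ (Fin d) => x a ^ 2 := by fun_prop
  exact ((hX.identDistrib d hd1 j).comp hm).integral_eq.trans_le
    ((le_ciSup (f := fun a => ∫ ω, (ξ d ω a) ^ 2 ∂P) (Set.finite_range _).bddAbove a).trans hd)

end Increments

/-- The random element `R` of a finite set is independent of `Z`. Only null measurability of `R` is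
asked for, since the traces of a measurable class on a random sample need not be measurable. -/
structure IndepOfFinite {Ω β κ : Type*} [MeasurableSpace Ω] [MeasurableSpace β] (P : Measure Ω)
    (Z : Ω → β) (R : Ω → κ) : Prop where
  nullMeasurableSet : ∀ r, NullMeasurableSet {ω | R ω = r} P
  measure_inter : ∀ r B, MeasurableSet B →
    P (Z ⁻¹' B ∩ {ω | R ω = r}) = P (Z ⁻¹' B) * P {ω | R ω = r}

lemma IndepOfFinite.measure_mem_le {Ω β κ : Type*} [MeasurableSpace Ω] [MeasurableSpace β]
    {P : Measure Ω} [IsProbabilityMeasure P] [Finite κ] {Z : Ω → β} {R : Ω → κ}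
    (h : IndepOfFinite P Z R) {B : κ → Set β} (hB : ∀ r, MeasurableSet (B r)) {q : ℝ≥0∞}
    (hq : ∀ r, P (Z ⁻¹' B r) ≤ q) : P {ω | Z ω ∈ B (R ω)} ≤ q := by
  have := Fintype.ofFinite κ
  calc P {ω | Z ω ∈ B (R ω)} ≤ P (⋃ r, Z ⁻¹' B r ∩ {ω | R ω = r}) := by
        refine measure_mono fun ω hω => Set.mem_iUnion.2 ⟨R ω, hω, rfl⟩
    _ ≤ ∑ r, P (Z ⁻¹' B r ∩ {ω | R ω = r}) := measure_iUnion_fintype_le _ _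
    _ = ∑ r, P (Z ⁻¹' B r) * P {ω | R ω = r} :=
        Finset.sum_congr rfl fun r _ => h.measure_inter r _ (hB r)
    _ ≤ ∑ r, q * P {ω | R ω = r} := Finset.sum_le_sum fun r _ => mul_le_mul_left (hq r) _
    _ = q * P (⋃ r, {ω | R ω = r}) := by
        rw [← Finset.mul_sum, measure_iUnion₀ _ h.nullMeasurableSet, tsum_fintype]
        intro r r' hrr
        exact (Set.disjoint_left.2 fun ω h1 h2 => hrr (h1.symm.trans h2)).aedisjoint
    _ ≤ q := mul_le_of_le_one_right' prob_le_one

/-- The level `l` and the tail bound `ρ` are chosen first; the truncation level `c` depends on `ρ`,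
and the distance `δ` on all of them. -/
lemma exists_sumModulus_le (v : ℕ) {ε η : ℝ} (hε : 0 < ε) (hη : 0 < η) :
    ∃ (l : ℕ) (ρ : ℝ), 0 < ρ ∧ ∀ c, 0 < c → ∃ δ, 0 < δ ∧ δ ≤ η ∧ sumModulus v l c ρ δ ≤ ε := by
  have hlim : Tendsto (fun l : ℕ => 2 * (40 * vcConst v * ((l : ℝ) * (1 / 2) ^ l
      + 2 * (1 / 2) ^ l))) atTop (𝓝 (2 * (40 * vcConst v * (0 + 2 * 0)))) :=
    ((((tendsto_self_mul_const_pow_of_lt_one (by norm_num) (by norm_num)).add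
      ((tendsto_pow_atTop_nhds_zero_of_lt_one (by norm_num) (by norm_num)).const_mul 2)).const_mul
        _).const_mul _)
  simp only [mul_zero, add_zero] at hlim
  obtain ⟨l, hl⟩ := (hlim.eventually_le_const (half_pos hε)).exists
  have hC := vcConst_ge v
  set B := 2 * (3 * vcConst v * ((l : ℝ) + 1)) with hB
  have hBpos : 0 < B := by positivity
  refine ⟨l, (ε / (2 * B)) ^ 2 / 2, by positivity, fun c hc =>
    ⟨min η ((ε / (2 * B)) ^ 2 / (2 * c)), lt_min hη (by positivity), min_le_left _ _, ?_⟩⟩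
  have h1 : c * min η ((ε / (2 * B)) ^ 2 / (2 * c)) ≤ (ε / (2 * B)) ^ 2 / 2 := by
    calc _ ≤ c * ((ε / (2 * B)) ^ 2 / (2 * c)) := by gcongr; exact min_le_right _ _
      _ = _ := by field_simp
  have h2 : √(c * min η ((ε / (2 * B)) ^ 2 / (2 * c)) + (ε / (2 * B)) ^ 2 / 2) ≤ ε / (2 * B) := by
    refine Real.sqrt_le_iff.2 ⟨by positivity, by linarith⟩
  have h3 := mul_le_mul_of_nonneg_left h2 hBpos.le
  have h4 : B * (ε / (2 * B)) = ε / 2 := by field_simp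
  rw [h4, hB] at h3
  rw [sumModulus]
  linarith

/-! ### Convergence of sums over random index sets -/

section Convergence

variable {Ω : Type*} [MeasurableSpace Ω] {P : Measure Ω} [IsProbabilityMeasure P]
  {ξ : (d : ℕ) → Ω → EuclideanSpace ℝ (Fin d)}
  {ι : ℕ → Type*} [∀ d, Fintype (ι d)] [∀ d, DecidableEq (ι d)]
  {X : (d : ℕ) → ι d → Ω → EuclideanSpace ℝ (Fin d)}

lemma tendsto_measure_norm_diff_sq (hξ : IncrementConditions P ξ) (hX : IsIncrementArray P ξ X)
    (hcard : Tendsto (fun d => Fintype.card (ι d)) atTop atTop)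
    (J K : (d : ℕ) → Ω → Finset (ι d))
    (hJK : ∀ d, 1 ≤ d → IndepOfFinite P (fun ω j => X d j ω) fun ω => (J d ω, K d ω))
    {θ : ℝ} (hθ : 0 < θ) :
    Tendsto (fun d => P {ω | θ * Fintype.card (ι d)
      ≤ |‖∑ j ∈ J d ω, X d j ω - ∑ j ∈ K d ω, X d j ω‖ ^ 2 - (J d ω ∆ K d ω).card|})
      atTop (𝓝 0) := by
  rw [ENNReal.tendsto_nhds_zero]
  intro ε hε
  obtain ⟨τ, hτ0, hτε⟩ : ∃ τ : ℝ, 0 < τ ∧ ENNReal.ofReal τ < ε := by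
    obtain ⟨τ, hτ0, hτ⟩ := ENNReal.lt_iff_exists_nnreal_btwn.1 hε
    exact ⟨τ, by exact_mod_cast hτ0, by simpa using hτ⟩
  set σ := τ * θ / 5 with hσ
  have hσ0 : 0 < σ := by positivity
  obtain ⟨c, hc0, hc⟩ := hξ.exists_truncation hX hσ0
  have hcN : ∀ᶠ d in atTop, c / σ ^ 2 ≤ Fintype.card (ι d) :=
    (tendsto_natCast_atTop_atTop.comp hcard).eventually_ge_atTop _
  filter_upwards [hξ.eventually_integral_sq_le hX (κ := σ ^ 2) (by positivity), hcN,
    eventually_ge_atTop 1, hcard.eventually_ge_atTop 1] with d hκ hN hd hcd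
  have : Nonempty (ι d) := Fintype.card_pos_iff.1 hcd
  have hNpos : (0 : ℝ) < Fintype.card (ι d) := by exact_mod_cast hcd
  let B : Finset (ι d) × Finset (ι d) → Set (ι d → EuclideanSpace ℝ (Fin d)) := fun r =>
    {x | θ * Fintype.card (ι d) ≤ |‖∑ j ∈ r.1, x j - ∑ j ∈ r.2, x j‖ ^ 2 - (r.1 ∆ r.2).card|}
  have hB : ∀ r, MeasurableSet (B r) := fun r =>
    measurableSet_le measurable_const (by fun_prop)
  refine ((hJK d hd).measure_mem_le hB fun r => ?_).trans hτε.le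
  refine ((hc d hd).measure_norm_diff_sq_le hc0 (κ := σ ^ 2) (by positivity)
    (fun j a a' haa => hξ.integral_mul_eq_zero hX hd j a a' haa) hκ r.1 r.2 hθ).trans
    (ENNReal.ofReal_le_ofReal ?_)
  rw [Real.sqrt_sq hσ0.le, div_le_iff₀ hθ]
  have h1 : √(c / Fintype.card (ι d)) ≤ σ := by
    refine Real.sqrt_le_iff.2 ⟨hσ0.le, ?_⟩
    rw [div_le_iff₀ (by positivity)] at hN ⊢
    linarith
  linarith

/-- Convergence of the range of sums over the index sets `J d A ω`, `A : 𝒜`, to the metric space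
`Y`, in which `y A` corresponds to `A`. The index sets are independent of the increments and belong
to a family `T d ω` of bounded VC dimension; in the limit, the proportion of indices that
distinguish `A` from `B` is the squared distance of `y A` and `y B`; and finitely many of the
`A : 𝒜` form a net, both in `Y` and, with high probability, in the counting metric. Distances in
the net converge by the law of large numbers, and the rest is controlled by equicontinuity. -/
theorem ghTendstoInProbability_range_of_net
    (hξ : IncrementConditions P ξ) (hX : IsIncrementArray P ξ X)
    (hcard : Tendsto (fun d => Fintype.card (ι d)) atTop atTop)
    {s : ℕ → ℝ} (hs0 : ∀ d, 0 ≤ s d)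
    (hs : Tendsto (fun d => s d ^ 2 * Fintype.card (ι d)) atTop (𝓝 1))
    {𝒜 : Type*} [Nonempty 𝒜] (J : (d : ℕ) → 𝒜 → Ω → Finset (ι d))
    {Y : Type*} [MetricSpace Y] (y : 𝒜 → Y) {v : ℕ}
    (T : (d : ℕ) → Ω → Finset (Finset (ι d))) (hJT : ∀ d A ω, J d A ω ∈ T d ω)
    (hv : ∀ d ω, (T d ω).vcDim ≤ v)
    (hT : ∀ d, 1 ≤ d → IndepOfFinite P (fun ω j => X d j ω) (T d))
    (hJ : ∀ d, 1 ≤ d → ∀ A B, IndepOfFinite P (fun ω j => X d j ω) fun ω => (J d A ω, J d B ω))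
    (hlim : ∀ A B, ∀ ε : ℝ, 0 < ε → Tendsto (fun d => P {ω | ε <
      |((J d A ω ∆ J d B ω).card : ℝ) / Fintype.card (ι d) - dist (y A) (y B) ^ 2|}) atTop (𝓝 0))
    (hnet : ∀ δ : ℝ, 0 < δ → ∃ F : Finset 𝒜, (∀ z, ∃ A ∈ F, dist z (y A) ≤ δ) ∧
      Tendsto (fun d => P {ω | ∃ A, ∀ B ∈ F, δ * Fintype.card (ι d) < (J d A ω ∆ J d B ω).card})
        atTop (𝓝 0)) :
    GHTendstoInProbability P (fun d ω => range fun A => s d • ∑ j ∈ J d A ω, X d j ω) Y := by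
  intro ε hε
  rw [ENNReal.tendsto_nhds_zero]
  intro ζ hζ
  obtain ⟨τ, hτ0, hτζ⟩ : ∃ τ : ℝ, 0 < τ ∧ ENNReal.ofReal τ < ζ := by
    obtain ⟨τ, hτ0, hτ⟩ := ENNReal.lt_iff_exists_nnreal_btwn.1 hζ
    exact ⟨τ, by exact_mod_cast hτ0, by simpa using hτ⟩
  obtain ⟨η, hη0, hηε⟩ : ∃ η : ℝ, 0 < η ∧ ENNReal.ofReal (2 * (2 * η)) < ε := by
    obtain ⟨e, he0, he⟩ := ENNReal.lt_iff_exists_nnreal_btwn.1 hε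
    refine ⟨e / 4, by have : (0 : ℝ) < e := by exact_mod_cast he0
                      positivity, ?_⟩
    have : 2 * (2 * ((e : ℝ) / 4)) = e := by ring
    rw [this]; simpa using he
  obtain ⟨l, ρ, hρ, hmod⟩ := exists_sumModulus_le v (mul_pos hτ0 hη0) hη0
  obtain ⟨c, hc0, hc⟩ := hξ.exists_truncation hX hρ
  obtain ⟨δ, hδ0, hδη, hδmod⟩ := hmod c hc0
  obtain ⟨F, hFY, hFJ⟩ := hnet δ hδ0
  set θ := η ^ 2 / 6 with hθ
  have hθ0 : 0 < θ := by positivity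
  let S : (d : ℕ) → 𝒜 → Ω → EuclideanSpace ℝ (Fin d) := fun d A ω => ∑ j ∈ J d A ω, X d j ω
  let N : ℕ → ℝ := fun d => Fintype.card (ι d)
  let E1 : (d : ℕ) → Set Ω := fun d =>
    {ω | ∃ A, ∀ B ∈ F, δ * N d < (J d A ω ∆ J d B ω).card}
  let E2 : (d : ℕ) → Set Ω := fun d => {ω | ∃ J ∈ T d ω, ∃ K ∈ T d ω,
    ((J ∆ K).card : ℝ) ≤ δ * N d ∧ η * √(N d) < ‖∑ j ∈ J, X d j ω - ∑ j ∈ K, X d j ω‖}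
  let E3 : (d : ℕ) → 𝒜 × 𝒜 → Set Ω := fun d p =>
    {ω | θ * N d ≤ |‖S d p.1 ω - S d p.2 ω‖ ^ 2 - (J d p.1 ω ∆ J d p.2 ω).card|}
  let E4 : (d : ℕ) → 𝒜 × 𝒜 → Set Ω := fun d p =>
    {ω | θ < |((J d p.1 ω ∆ J d p.2 ω).card : ℝ) / N d - dist (y p.1) (y p.2) ^ 2|}
  have hE1 : Tendsto (fun d => P (E1 d)) atTop (𝓝 0) := hFJ
  have hE34 : Tendsto (fun d => ∑ p ∈ F ×ˢ F, (P (E3 d p) + P (E4 d p))) atTop (𝓝 0) := by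
    rw [← Finset.sum_const_zero (s := F ×ˢ F)]
    refine tendsto_finsetSum _ fun p _ => ?_
    rw [← add_zero (0 : ℝ≥0∞)]
    exact (tendsto_measure_norm_diff_sq hξ hX hcard (fun d => J d p.1) (fun d => J d p.2)
      (fun d hd => hJ d hd p.1 p.2) hθ0).add (hlim p.1 p.2 θ hθ0)
  have hE2 : ∀ᶠ d in atTop, P (E2 d) ≤ ENNReal.ofReal τ := by
    filter_upwards [eventually_ge_atTop 1, hcard.eventually_ge_atTop 1] with d hd hcd
    have : Nonempty (ι d) := Fintype.card_pos_iff.1 hcd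
    let B : Finset (Finset (ι d)) → Set (ι d → EuclideanSpace ℝ (Fin d)) := fun r =>
      {x | r.vcDim ≤ v ∧ ∃ J ∈ r, ∃ K ∈ r,
        ((J ∆ K).card : ℝ) ≤ δ * N d ∧ η * √(N d) < ‖∑ j ∈ J, x j - ∑ j ∈ K, x j‖}
    have hB : ∀ r, MeasurableSet (B r) := by
      intro r
      by_cases hr : r.vcDim ≤ v
      · have : B r = ⋃ J ∈ r, ⋃ K ∈ r, ⋃ (_ : ((J ∆ K).card : ℝ) ≤ δ * N d),
            {x | η * √(N d) < ‖∑ j ∈ J, x j - ∑ j ∈ K, x j‖} := by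
          ext x
          simp only [B, hr, true_and, Set.mem_ofPred_eq, Set.mem_iUnion, exists_prop]
        rw [this]
        refine Finset.measurableSet_biUnion _ fun J _ => Finset.measurableSet_biUnion _ fun K _ =>
          MeasurableSet.iUnion fun _ => measurableSet_lt measurable_const (by fun_prop)
      · have : B r = ∅ := by ext x; simp [B, hr]
        rw [this]; exact MeasurableSet.empty
    have hle : ∀ r, P ((fun ω j => X d j ω) ⁻¹' B r) ≤ ENNReal.ofReal τ := by
      intro r
      by_cases hr : r.vcDim ≤ v
      · refine (measure_mono fun ω hω => hω.2).trans
          (((hc d hd).measure_exists_norm_diff_le hc0.le hρ hr hδ0.le l hη0).trans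
            (ENNReal.ofReal_le_ofReal ?_))
        rw [div_le_iff₀ hη0]; exact hδmod
      · have : B r = ∅ := by ext x; simp [B, hr]
        rw [this]; simp
    have hsub : E2 d ⊆ {ω | (fun j => X d j ω) ∈ B (T d ω)} := fun ω hω => ⟨hv d ω, hω⟩
    exact (measure_mono hsub).trans ((hT d hd).measure_mem_le hB hle)
  have hFne : F.Nonempty := by
    obtain ⟨A, hA, -⟩ := hFY (y (Classical.arbitrary 𝒜))
    exact ⟨A, hA⟩
  have : Nonempty F := hFne.to_subtype
  have hsub : ∀ᶠ d in atTop,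
      {ω | ε ≤ ghEDist (range fun A => s d • ∑ j ∈ J d A ω, X d j ω) Y}
        ⊆ E1 d ∪ E2 d ∪ ⋃ p ∈ F ×ˢ F, (E3 d p ∪ E4 d p) := by
    have hs1 := hs.eventually (Metric.ball_mem_nhds 1 (lt_min hθ0 one_pos))
    filter_upwards [hs1, hcard.eventually_ge_atTop 1] with d hsd hcd ω hω
    by_contra hgood
    simp only [Set.mem_union, Set.mem_iUnion, not_or, not_exists] at hgood
    obtain ⟨⟨h1, h2⟩, h34⟩ := hgood
    have hN0 : 0 < N d := Nat.cast_pos.2 hcd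
    rw [Real.dist_eq, lt_min_iff] at hsd
    obtain ⟨hsθ, hs_one⟩ := hsd
    have hsN4 : s d ^ 2 * N d ≤ 4 := by
      have := (abs_lt.1 hs_one).2
      simp only [N]; linarith
    have hsN : s d * √(N d) ≤ 2 := by
      refine (pow_le_pow_iff_left₀ (mul_nonneg (hs0 d) (Real.sqrt_nonneg _)) (by norm_num)
        two_ne_zero).1 ?_
      rw [mul_pow, Real.sq_sqrt hN0.le]; linarith
    let k : F → range (fun A => s d • ∑ j ∈ J d A ω, X d j ω) := fun A => ⟨_, ⟨A.1, rfl⟩⟩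
    have hbound := ghEDist_le_of_nets k (fun A : F => y A.1) (η := 2 * η) (by positivity) ?_ ?_ ?_
    · exact absurd (hω.trans hbound) (not_le.2 hηε)
    · rintro ⟨_, A, rfl⟩
      simp only [E1, Set.mem_ofPred_eq, not_exists, not_forall, not_lt] at h1
      obtain ⟨B, hBF, hAB⟩ := h1 A
      refine ⟨⟨B, hBF⟩, ?_⟩
      have h3 : ‖S d A ω - S d B ω‖ ≤ η * √(N d) := by
        by_contra hlt
        exact h2 ⟨_, hJT d A ω, _, hJT d B ω, hAB, not_le.1 hlt⟩
      rw [Subtype.dist_eq, dist_eq_norm]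
      change ‖s d • S d A ω - s d • S d B ω‖ ≤ _
      rw [← smul_sub, norm_smul, Real.norm_of_nonneg (hs0 d)]
      calc s d * ‖S d A ω - S d B ω‖ ≤ s d * (η * √(N d)) :=
            mul_le_mul_of_nonneg_left h3 (hs0 d)
        _ = s d * √(N d) * η := by ring
        _ ≤ 2 * η := by gcongr
    · intro z
      obtain ⟨A, hA, hzA⟩ := hFY z
      exact ⟨⟨A, hA⟩, by linarith⟩
    · intro A B
      have hp := h34 (A.1, B.1) (Finset.mem_product.2 ⟨A.2, B.2⟩)
      simp only [E3, E4, Set.mem_ofPred_eq, not_le, not_lt] at hp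
      obtain ⟨h3, h4⟩ := hp
      have hdist : dist (k A) (k B) = s d * ‖S d A.1 ω - S d B.1 ω‖ := by
        rw [Subtype.dist_eq, dist_eq_norm]
        change ‖s d • S d A.1 ω - s d • S d B.1 ω‖ = _
        rw [← smul_sub, norm_smul, Real.norm_of_nonneg (hs0 d)]
      rw [hdist]
      set a := s d * ‖S d A.1 ω - S d B.1 ω‖ with ha
      set b := dist (y A.1) (y B.1) with hb
      set m : ℝ := ((J d A.1 ω ∆ J d B.1 ω).card : ℝ) with hm
      have ha0 : 0 ≤ a := mul_nonneg (hs0 d) (norm_nonneg _)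
      have hb0 : 0 ≤ b := dist_nonneg
      have hm1 : m / N d ≤ 1 := by
        rw [div_le_one hN0]; simp only [hm, N]; exact_mod_cast Finset.card_le_univ _
      have hm0 : 0 ≤ m / N d := div_nonneg (Nat.cast_nonneg _) hN0.le
      have e1 : a ^ 2 - b ^ 2 = s d ^ 2 * (‖S d A.1 ω - S d B.1 ω‖ ^ 2 - m)
          + (s d ^ 2 * N d - 1) * (m / N d) + (m / N d - b ^ 2) := by
        rw [ha]; field_simp; ring
      have h5 : |a ^ 2 - b ^ 2| ≤ η ^ 2 := by
        rw [e1]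
        refine (abs_add_three _ _ _).trans ?_
        have h6 : |s d ^ 2 * (‖S d A.1 ω - S d B.1 ω‖ ^ 2 - m)| ≤ 4 * θ := by
          rw [abs_mul, abs_of_nonneg (sq_nonneg _)]
          calc _ ≤ s d ^ 2 * (θ * N d) := by gcongr
            _ = s d ^ 2 * N d * θ := by ring
            _ ≤ 4 * θ := by gcongr
        have h7 : |(s d ^ 2 * N d - 1) * (m / N d)| ≤ θ := by
          rw [abs_mul, abs_of_nonneg hm0]
          calc _ ≤ θ * 1 := mul_le_mul hsθ.le hm1 hm0 hθ0.le
            _ = θ := mul_one _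
        linarith
      have h8 : |a - b| ≤ η := by
        refine (pow_le_pow_iff_left₀ (abs_nonneg _) hη0.le two_ne_zero).1 (le_trans ?_ h5)
        have e2 : a ^ 2 - b ^ 2 = (a - b) * (a + b) := by ring
        rw [e2, abs_mul, sq]
        refine mul_le_mul_of_nonneg_left ?_ (abs_nonneg _)
        rw [abs_of_nonneg (add_nonneg ha0 hb0)]
        exact abs_le.2 ⟨by linarith, by linarith⟩
      linarith
  have hfinal : Tendsto (fun d => P (E1 d) + ENNReal.ofReal τ
      + ∑ p ∈ F ×ˢ F, (P (E3 d p) + P (E4 d p))) atTop (𝓝 (0 + ENNReal.ofReal τ + 0)) :=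
    (hE1.add tendsto_const_nhds).add hE34
  rw [zero_add, add_zero] at hfinal
  filter_upwards [hsub, hE2, hfinal.eventually_le_const hτζ] with d h1 h2 h3
  refine (measure_mono h1).trans (le_trans ?_ h3)
  refine (measure_union_le _ _).trans (add_le_add ((measure_union_le _ _).trans
    (add_le_add le_rfl h2)) ?_)
  exact (measure_biUnion_finset_le _ _).trans
    (Finset.sum_le_sum fun p _ => measure_union_le _ _)

end Convergence

/-! ### Traces of a class of sets on a sample -/

/-- Among all `K`, the maximum of `||J ∩ K| - |K \ J| / (k + 1)|` is attained at `K = J` only. -/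
lemma abs_card_inter_sub_le {k : ℕ} {J K : Finset (Fin k)} (hJ : J.Nonempty) (hKJ : K ≠ J) :
    |((J ∩ K).card : ℝ) - (1 / (k + 1)) * (K \ J).card| ≤ J.card - 1 / (k + 1) := by
  have hk0 : (0 : ℝ) ≤ k := Nat.cast_nonneg k
  have hk : (0 : ℝ) < 1 / (k + 1) := by positivity
  have hJ1 : (1 : ℝ) ≤ J.card := by exact_mod_cast hJ.card_pos
  have hinter : ((J ∩ K).card : ℝ) ≤ J.card := by
    exact_mod_cast Finset.card_le_card Finset.inter_subset_left
  have hcard : ((K \ J).card : ℝ) ≤ k :=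
    Nat.cast_le.2 ((Finset.card_le_univ _).trans_eq (Fintype.card_fin k))
  have hdiff : (1 / (k + 1) : ℝ) * (K \ J).card ≤ 1 - 1 / (k + 1) := by
    calc (1 / (k + 1) : ℝ) * (K \ J).card ≤ 1 / (k + 1) * k := by gcongr
      _ = 1 - 1 / (k + 1) := by field_simp; ring
  have hi0 : (0 : ℝ) ≤ (J ∩ K).card := Nat.cast_nonneg _
  refine abs_le.2 ⟨by linarith, ?_⟩
  by_cases hsub : J ⊆ K
  · have hne : (K \ J).Nonempty := by
      rw [Finset.sdiff_nonempty]
      exact fun h => hKJ (Finset.Subset.antisymm h hsub)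
    have h1 : (1 : ℝ) ≤ (K \ J).card := by exact_mod_cast hne.card_pos
    have := mul_le_mul_of_nonneg_left h1 hk.le
    linarith
  · have h1 : (J ∩ K).card < J.card :=
      Finset.card_lt_card
        ⟨Finset.inter_subset_left, fun h => hsub (h.trans Finset.inter_subset_right)⟩
    have h2 : ((J ∩ K).card : ℝ) + 1 ≤ J.card := by exact_mod_cast h1
    have h3 : (1 / (k + 1) : ℝ) ≤ 1 := by
      rw [div_le_one (by positivity)]; linarith
    have h4 : 0 ≤ (1 / (k + 1) : ℝ) * (K \ J).card := by positivity
    linarith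

section Traces

variable {𝕏 κ : Type*} [Fintype κ]

/-- The indices of the sample points that lie in `A`. -/
noncomputable def traceOf (A : Set 𝕏) (x : κ → 𝕏) : Finset κ := by
  classical exact Finset.univ.filter fun j => x j ∈ A

@[simp] lemma mem_traceOf {A : Set 𝕏} {x : κ → 𝕏} {j : κ} : j ∈ traceOf A x ↔ x j ∈ A := by
  simp [traceOf]

/-- The traces of the members of `𝓜` on a sample. The empty trace is always included: the suprema in
`IsMeasurableClass` do not detect it. -/
noncomputable def traces (𝓜 : Set (Set 𝕏)) (x : κ → 𝕏) : Finset (Finset κ) := by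
  classical exact Finset.univ.filter fun J => J = ∅ ∨ ∃ A ∈ 𝓜, traceOf A x = J

lemma mem_traces {𝓜 : Set (Set 𝕏)} {x : κ → 𝕏} {J : Finset κ} :
    J ∈ traces 𝓜 x ↔ J = ∅ ∨ ∃ A ∈ 𝓜, traceOf A x = J := by
  simp [traces]

lemma traceOf_mem_traces {𝓜 : Set (Set 𝕏)} (x : κ → 𝕏) {A : Set 𝕏} (hA : A ∈ 𝓜) :
    traceOf A x ∈ traces 𝓜 x := mem_traces.2 (Or.inr ⟨A, hA, rfl⟩)

lemma vcDim_traces_le [DecidableEq κ] {𝓜 : Set (Set 𝕏)} {k : ℕ}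
    (hk : ∀ I : Finset 𝕏, I.card = k + 1 → ¬ ShattersFinset 𝓜 I) (x : κ → 𝕏) :
    (traces 𝓜 x).vcDim ≤ k + 1 := by
  classical
  refine Finset.sup_le fun s hs => ?_
  rw [Finset.mem_shatterer] at hs
  by_contra! hcard
  obtain ⟨s', hs's, hs'card⟩ := Finset.exists_subset_card_eq (s := s) (n := k + 2) (by omega)
  have hs' := hs.mono_right hs's
  obtain ⟨p, hp⟩ : s'.Nonempty := Finset.card_pos.1 (by omega)
  -- Requiring the trace to contain `p` excludes the empty trace.
  have hmem : ∀ t ⊆ s', p ∈ t → ∃ A ∈ 𝓜, ∀ i ∈ s', x i ∈ A ↔ i ∈ t := by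
    intro t ht hpt
    obtain ⟨u, hu, hut⟩ := hs' ht
    rcases mem_traces.1 hu with rfl | ⟨A, hA, rfl⟩
    · rw [Finset.inter_empty] at hut; rw [← hut] at hpt; simp at hpt
    · refine ⟨A, hA, fun i hi => ?_⟩
      rw [← hut]; simp [hi]
  have hinj : Set.InjOn x (s'.erase p) := by
    intro a ha b hb hab
    have ha' := Finset.mem_coe.1 ha
    have hb' := Finset.mem_coe.1 hb
    rw [Finset.mem_erase] at ha' hb'
    obtain ⟨A, -, hA⟩ := hmem {p, a} (by
      intro i hi
      rcases Finset.mem_insert.1 hi with rfl | hi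
      · exact hp
      · rw [Finset.mem_singleton.1 hi]; exact ha'.2) (by simp)
    have h1 : x a ∈ A := (hA a ha'.2).2 (by simp)
    have h2 := (hA b hb'.2).1 (hab ▸ h1)
    rcases Finset.mem_insert.1 h2 with h | h
    · exact absurd h hb'.1
    · exact (Finset.mem_singleton.1 h).symm
  refine hk ((s'.erase p).image x) ?_ fun J hJ => ?_
  · rw [Finset.card_image_of_injOn hinj, Finset.card_erase_of_mem hp]; omega
  · obtain ⟨A, hA, h⟩ := hmem (insert p ((s'.erase p).filter fun i => x i ∈ J)) (by
      intro i hi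
      rcases Finset.mem_insert.1 hi with rfl | hi
      · exact hp
      · exact Finset.mem_of_mem_erase (Finset.mem_filter.1 hi).1) (Finset.mem_insert_self _ _)
    refine ⟨A, hA, ?_⟩
    ext z
    simp only [Set.mem_inter_iff, Finset.mem_coe]
    constructor
    · rintro ⟨hz, hzA⟩
      obtain ⟨i, hi, rfl⟩ := Finset.mem_image.1 hz
      have hi' := Finset.mem_erase.1 hi
      rcases Finset.mem_insert.1 ((h i hi'.2).1 hzA) with h1 | h1
      · exact absurd h1 hi'.1
      · exact (Finset.mem_filter.1 h1).2
    · intro hz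
      have hz' := hJ hz
      obtain ⟨i, hi, rfl⟩ := Finset.mem_image.1 hz'
      exact ⟨hz', (h i (Finset.mem_of_mem_erase hi)).2
        (Finset.mem_insert_of_mem (Finset.mem_filter.2 ⟨hi, hz⟩))⟩

variable [MeasurableSpace 𝕏] {μ : Measure 𝕏}

lemma measurePreserving_comp_equiv [IsProbabilityMeasure μ] {κ' : Type*} [Fintype κ'] (σ : κ ≃ κ') :
    MeasurePreserving (fun (x : κ' → 𝕏) i => x (σ i)) (Measure.pi fun _ : κ' => μ)
      (Measure.pi fun _ : κ => μ) := by
  have h := measurePreserving_piCongrLeft (fun _ : κ => μ) σ.symm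
  convert h using 1
  funext x i
  have := Equiv.piCongrLeft_apply_apply (fun _ : κ => 𝕏) σ.symm x (σ i)
  rw [Equiv.symm_apply_apply] at this
  exact this.symm

/-- A nonempty index set `J` is a trace of `𝓜` on the sample if and only if the supremum in
`IsMeasurableClass`, for weights `1` on `J` and small negative weights off `J`, reaches `|J|`. -/
lemma nullMeasurableSet_mem_traces_fin {𝓜 : Set (Set 𝕏)} (h𝓜 : IsMeasurableClass μ 𝓜)
    (hne : 𝓜.Nonempty) {k : ℕ} (J : Finset (Fin k)) :
    NullMeasurableSet {x : Fin k → 𝕏 | J ∈ traces 𝓜 x} (Measure.pi fun _ : Fin k => μ) := by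
  classical
  by_cases hJ : J = ∅
  · have : {x : Fin k → 𝕏 | J ∈ traces 𝓜 x} = Set.univ := by
      ext x; simp [mem_traces, hJ]
    rw [this]; exact MeasurableSet.univ.nullMeasurableSet
  set e : Fin k → ℝ := fun i => if i ∈ J then 1 else -(1 / (k + 1)) with he
  let val : Finset (Fin k) → ℝ := fun K =>
    |((J ∩ K).card : ℝ) - (1 / (k + 1)) * (K \ J).card|
  have hval : ∀ (x : Fin k → 𝕏) (A : Set 𝕏),
      |∑ i, e i * A.indicator (fun _ => (1 : ℝ)) (x i)| = val (traceOf A x) := by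
    intro x A
    have : ∀ i, e i * A.indicator (fun _ => (1 : ℝ)) (x i)
        = (if i ∈ J ∩ traceOf A x then 1 else 0)
          - (1 / (k + 1)) * (if i ∈ traceOf A x \ J then 1 else 0) := by
      intro i
      by_cases h1 : i ∈ J <;> by_cases h2 : x i ∈ A <;> simp [he, h1, h2]
    simp only [this, val]
    rw [Finset.sum_sub_distrib, ← Finset.mul_sum, Finset.sum_boole, Finset.sum_boole,
      Finset.filter_univ_mem, Finset.filter_univ_mem]
  have hvalJ : val J = J.card := by simp [val]
  have hvalK : ∀ K, K ≠ J → val K ≤ J.card - 1 / (k + 1) := fun K hK =>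
    abs_card_inter_sub_le (Finset.nonempty_of_ne_empty hJ) hK
  have hset : {x : Fin k → 𝕏 | J ∈ traces 𝓜 x}
      = (fun x : Fin k → 𝕏 => ⨆ A : 𝓜,
        |∑ i, e i * (A : Set 𝕏).indicator (fun _ => (1 : ℝ)) (x i)|) ⁻¹' Set.Ici (J.card : ℝ) := by
    ext x
    simp only [Set.mem_ofPred_eq, Set.mem_preimage, Set.mem_Ici, hval]
    constructor
    · intro hx
      rcases mem_traces.1 hx with h | ⟨A, hA, hAJ⟩
      · exact absurd h hJ
      · have hb : BddAbove (Set.range fun A : 𝓜 => val (traceOf (A : Set 𝕏) x)) :=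
          (Set.finite_range val).bddAbove.mono
            (Set.range_subset_iff.2 fun A => Set.mem_range_self _)
        refine le_trans (le_of_eq ?_) (le_ciSup hb ⟨A, hA⟩)
        rw [hAJ, hvalJ]
    · intro hx
      by_contra hcon
      have : Nonempty 𝓜 := hne.to_subtype
      have hle : (⨆ A : 𝓜, val (traceOf (A : Set 𝕏) x)) ≤ J.card - 1 / (k + 1) :=
        ciSup_le fun A => hvalK _ fun h => hcon (mem_traces.2 (Or.inr ⟨A, A.2, h⟩))
      have hk : (0 : ℝ) < 1 / (k + 1) := by positivity
      linarith
  rw [hset]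
  exact h𝓜 k e measurableSet_Ici

lemma nullMeasurableSet_traces_eq [IsProbabilityMeasure μ] {𝓜 : Set (Set 𝕏)}
    (h𝓜 : IsMeasurableClass μ 𝓜)
    (hne : 𝓜.Nonempty) (T : Finset (Finset κ)) :
    NullMeasurableSet {x : κ → 𝕏 | traces 𝓜 x = T} (Measure.pi fun _ : κ => μ) := by
  classical
  have hmem : ∀ J : Finset κ, NullMeasurableSet {x : κ → 𝕏 | J ∈ traces 𝓜 x}
      (Measure.pi fun _ : κ => μ) := by
    intro J
    let σ := Fintype.equivFin κ
    have h := (nullMeasurableSet_mem_traces_fin h𝓜 hne (J.map σ.toEmbedding)).preimage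
      (measurePreserving_comp_equiv (μ := μ) σ.symm).quasiMeasurePreserving
    convert h using 1
    ext x
    simp only [Set.mem_ofPred_eq, Set.mem_preimage, mem_traces, Finset.map_eq_empty]
    refine or_congr Iff.rfl (exists_congr fun A => and_congr Iff.rfl ?_)
    have : traceOf A (fun i => x (σ.symm i)) = (traceOf A x).map σ.toEmbedding := by
      ext i; simp [Finset.mem_map_equiv]
    rw [this, Finset.map_inj]
  have : {x : κ → 𝕏 | traces 𝓜 x = T}
      = ⋂ J : Finset κ, {x : κ → 𝕏 | J ∈ traces 𝓜 x ↔ J ∈ T} := by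
    ext x; simp [Finset.ext_iff]
  rw [this]
  refine NullMeasurableSet.iInter fun J => ?_
  by_cases hJ : J ∈ T
  · simpa [hJ] using hmem J
  · simp only [hJ, iff_false]; exact (hmem J).compl

lemma aemeasurable_comp_traces [IsProbabilityMeasure μ] {𝓜 : Set (Set 𝕏)}
    (h𝓜 : IsMeasurableClass μ 𝓜)
    (hne : 𝓜.Nonempty) (h : Finset (Finset κ) → ℝ≥0∞) :
    AEMeasurable (fun x : κ → 𝕏 => h (traces 𝓜 x)) (Measure.pi fun _ : κ => μ) := by
  refine NullMeasurable.aemeasurable fun s _ => ?_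
  have : (fun x : κ → 𝕏 => h (traces 𝓜 x)) ⁻¹' s
      = ⋃ T ∈ {T | h T ∈ s}, {x : κ → 𝕏 | traces 𝓜 x = T} := by
    ext x; simp
  rw [this]
  exact NullMeasurableSet.biUnion (Set.to_countable _)
    fun T _ => nullMeasurableSet_traces_eq h𝓜 hne T

end Traces

/-! ### Uniform law of large numbers over a VC class -/

section GlivenkoCantelli

variable {κ : Type*} [DecidableEq κ]

/-- The number of points of the first half of a double sample that are in `J ∆ K`, minus the number
of such points of the second half, as a sum over `j`. -/
noncomputable def halfDiff (J K : Finset (κ ⊕ κ)) (j : κ) : ℝ :=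
  (if Sum.inl j ∈ J ∆ K then 1 else 0) - (if Sum.inr j ∈ J ∆ K then 1 else 0)

lemma halfDiff_sq_le (J K : Finset (κ ⊕ κ)) (j : κ) : ‖halfDiff J K j‖ ^ 2 ≤ 1 := by
  unfold halfDiff
  split_ifs <;> simp

variable [Fintype κ]

/-- The largest deviation between the two halves of a double sample over the symmetric differences
of pairs of members of `T`. -/
noncomputable def ghostDev (T : Finset (Finset (κ ⊕ κ))) : ℝ :=
  ‖fun p : (T ×ˢ T : Finset _) => ∑ j, halfDiff p.1.1 p.1.2 j‖

lemma abs_sum_halfDiff_le_ghostDev {T : Finset (Finset (κ ⊕ κ))} {J K : Finset (κ ⊕ κ)}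
    (hJ : J ∈ T) (hK : K ∈ T) : |∑ j, halfDiff J K j| ≤ ghostDev T :=
  norm_le_pi_norm (fun p : (T ×ˢ T : Finset _) => ∑ j, halfDiff p.1.1 p.1.2 j)
    ⟨(J, K), Finset.mem_product.2 ⟨hJ, hK⟩⟩

/-- The permutation of the double sample that exchanges the two copies of the indices off `s`. -/
def swapOff (s : Finset κ) : Equiv.Perm (κ ⊕ κ) where
  toFun := Sum.elim (fun j => if j ∈ s then Sum.inl j else Sum.inr j)
    (fun j => if j ∈ s then Sum.inr j else Sum.inl j)
  invFun := Sum.elim (fun j => if j ∈ s then Sum.inl j else Sum.inr j)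
    (fun j => if j ∈ s then Sum.inr j else Sum.inl j)
  left_inv := by rintro (j | j) <;> by_cases h : j ∈ s <;> simp [h]
  right_inv := by rintro (j | j) <;> by_cases h : j ∈ s <;> simp [h]

variable {𝕏 : Type*}

lemma ghostDev_traces_swapOff_le (𝓜 : Set (Set 𝕏)) (s : Finset κ) (x : κ ⊕ κ → 𝕏) :
    ghostDev (traces 𝓜 fun i => x (swapOff s i))
      ≤ ‖fun p : (traces 𝓜 x ×ˢ traces 𝓜 x : Finset _) =>
          ∑ j, signOn s j • halfDiff p.1.1 p.1.2 j‖ := by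
  have hmap : ∀ J ∈ traces 𝓜 (fun i => x (swapOff s i)),
      ∃ J' ∈ traces 𝓜 x, ∀ i, i ∈ J ↔ swapOff s i ∈ J' := by
    intro J hJ
    rcases mem_traces.1 hJ with rfl | ⟨A, hA, rfl⟩
    · exact ⟨∅, mem_traces.2 (Or.inl rfl), by simp⟩
    · exact ⟨traceOf A x, traceOf_mem_traces x hA, by simp⟩
  refine (pi_norm_le_iff_of_nonneg (norm_nonneg _)).2 ?_
  rintro ⟨⟨J, K⟩, hp⟩
  obtain ⟨hJ, hK⟩ := Finset.mem_product.1 hp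
  obtain ⟨J', hJ', hJJ⟩ := hmap J hJ
  obtain ⟨K', hK', hKK⟩ := hmap K hK
  refine le_trans (le_of_eq ?_) (norm_le_pi_norm
    (fun p : (traces 𝓜 x ×ˢ traces 𝓜 x : Finset _) =>
      ∑ j, signOn s j • halfDiff p.1.1 p.1.2 j) ⟨(J', K'), Finset.mem_product.2 ⟨hJ', hK'⟩⟩)
  congr 1
  refine Finset.sum_congr rfl fun j _ => ?_
  simp only [halfDiff, Finset.mem_symmDiff, hJJ, hKK]
  by_cases h : j ∈ s <;> simp [swapOff, signOn, h]

/-- The bound on the expected deviation between the two halves of a double sample of size `2 n`. -/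
noncomputable def ghostBound (v n : ℕ) : ℝ :=
  √n * (Real.log (2 * ((2 * n + 1 : ℝ) ^ v) ^ 2) + 1 / 2)

lemma sum_ghostDev_swapOff_le {𝓜 : Set (Set 𝕏)} {v : ℕ} (x : κ ⊕ κ → 𝕏)
    (hv : (traces 𝓜 x).vcDim ≤ v) :
    ∑ s : Finset κ, ghostDev (traces 𝓜 fun i => x (swapOff s i))
      ≤ 2 ^ Fintype.card κ * ghostBound v (Fintype.card κ) := by
  refine (Finset.sum_le_sum fun s _ => ghostDev_traces_swapOff_le 𝓜 s x).trans ?_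
  refine sum_norm_signOn_le (fun (p : (traces 𝓜 x ×ˢ traces 𝓜 x : Finset _)) j =>
    halfDiff p.1.1 p.1.2 j) (Real.sqrt_nonneg _) (M := ((2 * (Fintype.card κ : ℝ) + 1) ^ v) ^ 2)
    ?_ ?_ fun p => ?_
  · refine one_le_pow₀ (one_le_pow₀ ?_)
    linarith [(Nat.cast_nonneg (Fintype.card κ) : (0 : ℝ) ≤ _)]
  · have h := card_le_pow_of_vcDim_le hv
    rw [Fintype.card_sum] at h
    have h' : ((traces 𝓜 x).card : ℝ) ≤ (2 * (Fintype.card κ : ℝ) + 1) ^ v := by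
      have : ((traces 𝓜 x).card : ℝ) ≤ ((Fintype.card κ : ℝ) + Fintype.card κ + 1) ^ v := by
        exact_mod_cast h
      rwa [two_mul]
    rw [Fintype.card_coe, Finset.card_product, Nat.cast_mul, sq]
    gcongr
  · rw [Real.sq_sqrt (Nat.cast_nonneg _)]
    calc ∑ j, ‖halfDiff p.1.1 p.1.2 j‖ ^ 2 ≤ ∑ _j : κ, (1 : ℝ) :=
          Finset.sum_le_sum fun j _ => halfDiff_sq_le _ _ j
      _ = Fintype.card κ := by simp

variable [MeasurableSpace 𝕏] {μ : Measure 𝕏} [IsProbabilityMeasure μ]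

/-- The exchange of corresponding points of the two halves preserves the law of a double sample, so
that random signs can be introduced. -/
lemma lintegral_ghostDev_le {𝓜 : Set (Set 𝕏)} (h𝓜 : IsMeasurableClass μ 𝓜) (hne : 𝓜.Nonempty)
    {v : ℕ} (hv : ∀ x : κ ⊕ κ → 𝕏, (traces 𝓜 x).vcDim ≤ v) :
    ∫⁻ x : κ ⊕ κ → 𝕏, ENNReal.ofReal (ghostDev (traces 𝓜 x)) ∂(Measure.pi fun _ => μ)
      ≤ ENNReal.ofReal (ghostBound v (Fintype.card κ)) := by
  set Q : Measure (κ ⊕ κ → 𝕏) := Measure.pi fun _ => μ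
  have hm : AEMeasurable (fun x : κ ⊕ κ → 𝕏 => ENNReal.ofReal (ghostDev (traces 𝓜 x))) Q :=
    aemeasurable_comp_traces h𝓜 hne fun T => ENNReal.ofReal (ghostDev T)
  have hmp : ∀ s : Finset κ, MeasurePreserving (fun (x : κ ⊕ κ → 𝕏) i => x (swapOff s i)) Q Q :=
    fun s => measurePreserving_comp_equiv (swapOff s)
  have hms : ∀ s : Finset κ, AEMeasurable (fun x : κ ⊕ κ → 𝕏 =>
      ENNReal.ofReal (ghostDev (traces 𝓜 fun i => x (swapOff s i)))) Q := fun s =>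
    hm.comp_quasiMeasurePreserving (hmp s).quasiMeasurePreserving
  have hinv : ∀ s : Finset κ, ∫⁻ x, ENNReal.ofReal (ghostDev (traces 𝓜 x)) ∂Q
      = ∫⁻ x, ENNReal.ofReal (ghostDev (traces 𝓜 fun i => x (swapOff s i))) ∂Q := by
    intro s
    conv_lhs => rw [← (hmp s).map_eq]
    exact lintegral_map' (by rw [(hmp s).map_eq]; exact hm) (hmp s).measurable.aemeasurable
  have hsum : ((2 : ℝ≥0∞) ^ Fintype.card κ) * ∫⁻ x, ENNReal.ofReal (ghostDev (traces 𝓜 x)) ∂Q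
      ≤ 2 ^ Fintype.card κ * ENNReal.ofReal (ghostBound v (Fintype.card κ)) := by
    calc ((2 : ℝ≥0∞) ^ Fintype.card κ) * ∫⁻ x, ENNReal.ofReal (ghostDev (traces 𝓜 x)) ∂Q
        = ∑ s : Finset κ,
            ∫⁻ x, ENNReal.ofReal (ghostDev (traces 𝓜 fun i => x (swapOff s i))) ∂Q := by
          rw [← Finset.sum_congr rfl fun s _ => hinv s, Finset.sum_const, Finset.card_univ,
            Fintype.card_finset, nsmul_eq_mul]
          push_cast; rfl
      _ = ∫⁻ x, ∑ s : Finset κ, ENNReal.ofReal (ghostDev (traces 𝓜 fun i => x (swapOff s i))) ∂Q :=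
          (lintegral_finsetSum' _ fun s _ => hms s).symm
      _ ≤ ∫⁻ _, ENNReal.ofReal (2 ^ Fintype.card κ * ghostBound v (Fintype.card κ)) ∂Q := by
          refine lintegral_mono fun x => ?_
          rw [← ENNReal.ofReal_sum_of_nonneg
            (f := fun s => ghostDev (traces 𝓜 fun i => x (swapOff s i))) fun s _ => norm_nonneg _]
          exact ENNReal.ofReal_le_ofReal (sum_ghostDev_swapOff_le x (hv x))
      _ = _ := by
          rw [lintegral_const, measure_univ, mul_one, ENNReal.ofReal_mul (by positivity),
            ENNReal.ofReal_pow (by norm_num), ENNReal.ofReal_ofNat]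
  exact (ENNReal.mul_le_mul_iff_right (by positivity) (by finiteness)).1 hsum

/-- The deviation of the empirical measure from its mean is at most the conditional expectation of
the deviation from an independent copy. -/
lemma ofReal_abs_card_sub_le {𝓜 : Set (Set 𝕏)} {A B : Set 𝕏} (hA : A ∈ 𝓜) (hB : B ∈ 𝓜)
    (hAm : MeasurableSet A) (hBm : MeasurableSet B) (u : κ → 𝕏) :
    ENNReal.ofReal |((traceOf A u ∆ traceOf B u).card : ℝ) - Fintype.card κ * μ.real (A ∆ B)|
      ≤ ∫⁻ u' : κ → 𝕏, ENNReal.ofReal (ghostDev (traces 𝓜 (Sum.elim u u')))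
        ∂(Measure.pi fun _ => μ) := by
  classical
  set D : Set 𝕏 := A ∆ B with hD
  have hDm : MeasurableSet D := hAm.symmDiff hBm
  let f : 𝕏 → ℝ := D.indicator fun _ => 1
  have hf : Integrable f μ := (integrable_const _).indicator hDm
  have hfj : ∀ j : κ, Integrable (fun u' : κ → 𝕏 => f (u' j)) (Measure.pi fun _ => μ) :=
    fun j => integrable_comp_eval (μ := fun _ : κ => μ) hf
  have hcard : ((traceOf A u ∆ traceOf B u).card : ℝ) = ∑ j, f (u j) := by
    have : ∀ j, f (u j) = if j ∈ traceOf A u ∆ traceOf B u then 1 else 0 := by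
      intro j
      simp only [f, Set.indicator_apply, hD, Finset.mem_symmDiff, mem_traceOf, Set.mem_symmDiff]
    simp only [this]
    rw [Finset.sum_boole, Finset.filter_univ_mem]
  have hint : ((traceOf A u ∆ traceOf B u).card : ℝ) - Fintype.card κ * μ.real D
      = ∫ u' : κ → 𝕏, ∑ j, (f (u j) - f (u' j)) ∂(Measure.pi fun _ => μ) := by
    have hij : ∀ j : κ, Integrable (fun u' : κ → 𝕏 => f (u j) - f (u' j))
        (Measure.pi fun _ => μ) := fun j => (integrable_const _).sub (hfj j)
    rw [integral_finsetSum _ fun j _ => hij j, hcard]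
    have : ∀ j, ∫ u' : κ → 𝕏, (f (u j) - f (u' j)) ∂(Measure.pi fun _ => μ)
        = f (u j) - μ.real D := by
      intro j
      rw [integral_sub (integrable_const _) (hfj j),
        integral_comp_eval (μ := fun _ : κ => μ) hf.aestronglyMeasurable]
      simp [f, integral_indicator hDm]
    simp only [this, Finset.sum_sub_distrib, Finset.sum_const, Finset.card_univ, nsmul_eq_mul]
  rw [hint, ← Real.norm_eq_abs, ofReal_norm]
  refine (enorm_integral_le_lintegral_enorm _).trans (lintegral_mono fun u' => ?_)
  rw [← ofReal_norm, Real.norm_eq_abs]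
  refine ENNReal.ofReal_le_ofReal (le_trans (le_of_eq ?_) (abs_sum_halfDiff_le_ghostDev
    (traceOf_mem_traces (Sum.elim u u') hA) (traceOf_mem_traces (Sum.elim u u') hB)))
  congr 1
  refine Finset.sum_congr rfl fun j _ => ?_
  simp only [halfDiff, f, Set.indicator_apply, hD, Finset.mem_symmDiff, mem_traceOf,
    Set.mem_symmDiff, Sum.elim_inl, Sum.elim_inr]

lemma measure_exists_abs_card_sub_le {𝓜 : Set (Set 𝕏)} (h𝓜 : IsMeasurableClass μ 𝓜)
    (hne : 𝓜.Nonempty) (hmeas : ∀ A ∈ 𝓜, MeasurableSet A)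
    {v : ℕ} (hv : ∀ x : κ ⊕ κ → 𝕏, (traces 𝓜 x).vcDim ≤ v) {θ : ℝ} (hθ : 0 < θ) :
    (Measure.pi fun _ : κ => μ) {u | ∃ A ∈ 𝓜, ∃ B ∈ 𝓜,
      θ ≤ |((traceOf A u ∆ traceOf B u).card : ℝ) - Fintype.card κ * μ.real (A ∆ B)|}
      ≤ ENNReal.ofReal (ghostBound v (Fintype.card κ) / θ) := by
  set Q : Measure (κ → 𝕏) := Measure.pi fun _ => μ with hQ
  let H : (κ ⊕ κ → 𝕏) → ℝ≥0∞ := fun x => ENNReal.ofReal (ghostDev (traces 𝓜 x))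
  have hH : AEMeasurable H (Measure.pi fun _ => μ) :=
    aemeasurable_comp_traces h𝓜 hne fun T => ENNReal.ofReal (ghostDev T)
  have hmp : MeasurePreserving (fun p : (κ → 𝕏) × (κ → 𝕏) => Sum.elim p.1 p.2) (Q.prod Q)
      (Measure.pi fun _ : κ ⊕ κ => μ) := by
    have h := measurePreserving_sumPiEquivProdPi_symm (fun _ : κ ⊕ κ => μ)
    convert h using 1
    funext p i
    rcases i with i | i <;> rfl
  have hH' : AEMeasurable (fun p : (κ → 𝕏) × (κ → 𝕏) => H (Sum.elim p.1 p.2)) (Q.prod Q) :=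
    hH.comp_quasiMeasurePreserving hmp.quasiMeasurePreserving
  have hI : ∫⁻ u, ∫⁻ u', H (Sum.elim u u') ∂Q ∂Q
      ≤ ENNReal.ofReal (ghostBound v (Fintype.card κ)) := by
    rw [← lintegral_prod _ hH']
    refine le_trans (le_of_eq ?_) (lintegral_ghostDev_le h𝓜 hne hv)
    rw [← hmp.map_eq]
    exact (lintegral_map' (by rw [hmp.map_eq]; exact hH) hmp.measurable.aemeasurable).symm
  have hmarkov := mul_meas_ge_le_lintegral₀ hH'.lintegral_prod_right' (ENNReal.ofReal θ)
  have hsub : {u | ∃ A ∈ 𝓜, ∃ B ∈ 𝓜,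
      θ ≤ |((traceOf A u ∆ traceOf B u).card : ℝ) - Fintype.card κ * μ.real (A ∆ B)|}
      ⊆ {u | ENNReal.ofReal θ ≤ ∫⁻ u', H (Sum.elim u u') ∂Q} := by
    rintro u ⟨A, hA, B, hB, h⟩
    exact (ENNReal.ofReal_le_ofReal h).trans
      (ofReal_abs_card_sub_le hA hB (hmeas A hA) (hmeas B hB) u)
  rw [ENNReal.ofReal_div_of_pos hθ, ENNReal.le_div_iff_mul_le (Or.inl (by simpa using hθ))
    (Or.inl (by finiteness)), mul_comm]
  exact (mul_le_mul_right (measure_mono hsub) _).trans (hmarkov.trans hI)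

lemma tendsto_ghostBound_div (v : ℕ) :
    Tendsto (fun n : ℕ => ghostBound v n / n) atTop (𝓝 0) := by
  let f : ℝ → ℝ := fun x => 2 * (((Real.log 2 + 1 / 2) * (x ^ (1 / 2 : ℝ))⁻¹)
    + 2 * v * (Real.log x / x ^ (1 / 2 : ℝ)))
  have hf : Tendsto f atTop (𝓝 0) := by
    have h1 : Tendsto (fun x : ℝ => (x ^ (1 / 2 : ℝ))⁻¹) atTop (𝓝 0) :=
      (tendsto_rpow_atTop (by norm_num)).inv_tendsto_atTop
    have h2 : Tendsto (fun x : ℝ => Real.log x / x ^ (1 / 2 : ℝ)) atTop (𝓝 0) :=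
      (isLittleO_log_rpow_atTop (by norm_num)).tendsto_div_nhds_zero
    have h3 := ((h1.const_mul (Real.log 2 + 1 / 2)).add (h2.const_mul (2 * (v : ℝ)))).const_mul 2
    rwa [mul_zero, mul_zero, add_zero, mul_zero] at h3
  have hg : Tendsto (fun n : ℕ => (2 * n + 1 : ℝ)) atTop atTop :=
    tendsto_atTop_add_const_right _ _ (tendsto_natCast_atTop_atTop.const_mul_atTop two_pos)
  refine squeeze_zero' (.of_forall fun n => ?_) ?_ (hf.comp hg)
  · refine div_nonneg (mul_nonneg (Real.sqrt_nonneg _) (add_nonneg (Real.log_nonneg ?_)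
      (by norm_num))) (Nat.cast_nonneg _)
    have : (1 : ℝ) ≤ ((2 * n + 1 : ℝ) ^ v) ^ 2 :=
      one_le_pow₀ (one_le_pow₀ (by linarith [(Nat.cast_nonneg n : (0 : ℝ) ≤ n)]))
    linarith
  · filter_upwards [eventually_ge_atTop 1] with n hn
    have hn1 : (1 : ℝ) ≤ n := by exact_mod_cast hn
    have hlog : Real.log (2 * ((2 * n + 1 : ℝ) ^ v) ^ 2)
        = Real.log 2 + 2 * v * Real.log (2 * n + 1) := by
      rw [Real.log_mul (by norm_num) (by positivity), Real.log_pow, Real.log_pow]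
      push_cast; ring
    have hlog0 : 0 ≤ Real.log (2 * n + 1) := Real.log_nonneg (by linarith)
    have hlog2 : 0 ≤ Real.log 2 := Real.log_nonneg (by norm_num)
    have hs : (√(n : ℝ)) / n ≤ 2 * (√(2 * n + 1 : ℝ))⁻¹ := by
      rw [Real.sqrt_div_self, ← div_eq_mul_inv, inv_le_comm₀ (by positivity)
        (by positivity), inv_div, div_le_iff₀ two_pos]
      refine Real.sqrt_le_iff.2 ⟨by positivity, ?_⟩
      rw [mul_pow, Real.sq_sqrt (by positivity)]; linarith
    simp only [ghostBound, hlog, f, Function.comp_apply, ← Real.sqrt_eq_rpow]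
    calc √(n : ℝ) * (Real.log 2 + 2 * v * Real.log (2 * n + 1) + 1 / 2) / n
        = √(n : ℝ) / n * (Real.log 2 + 2 * v * Real.log (2 * n + 1) + 1 / 2) := by ring
      _ ≤ 2 * (√(2 * n + 1 : ℝ))⁻¹ * (Real.log 2 + 2 * v * Real.log (2 * n + 1) + 1 / 2) := by
          gcongr
      _ = _ := by rw [div_eq_mul_inv]; ring

/-- The Glivenko-Cantelli theorem for the symmetric differences of the members of a measurable VC
class. The exceptional set need not be measurable, and its outer measure is meant. -/
theorem tendsto_measure_exists_abs_card_sub {𝓜 : Set (Set 𝕏)} (h𝓜 : IsMeasurableClass μ 𝓜)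
    (hne : 𝓜.Nonempty) (hmeas : ∀ A ∈ 𝓜, MeasurableSet A)
    {v : ℕ} (hv : ∀ k (x : Fin k ⊕ Fin k → 𝕏), (traces 𝓜 x).vcDim ≤ v) {θ : ℝ} (hθ : 0 < θ) :
    Tendsto (fun n => (Measure.pi fun _ : Fin n => μ) {u | ∃ A ∈ 𝓜, ∃ B ∈ 𝓜,
      θ * n ≤ |((traceOf A u ∆ traceOf B u).card : ℝ) - n * μ.real (A ∆ B)|}) atTop (𝓝 0) := by
  have hlim : Tendsto (fun n : ℕ => ENNReal.ofReal (ghostBound v n / n / θ)) atTop (𝓝 0) := by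
    have := ENNReal.tendsto_ofReal ((tendsto_ghostBound_div v).div_const θ)
    simpa using this
  refine tendsto_of_tendsto_of_tendsto_of_le_of_le' tendsto_const_nhds hlim
    (.of_forall fun _ => zero_le) ?_
  filter_upwards [eventually_ge_atTop 1] with n hn
  have hn0 : (0 : ℝ) < n := by exact_mod_cast hn
  have h := measure_exists_abs_card_sub_le (κ := Fin n) h𝓜 hne hmeas (hv n) (mul_pos hθ hn0)
  rw [Fintype.card_fin] at h
  refine h.trans (le_of_eq ?_)
  rw [div_div, mul_comm θ]

end GlivenkoCantelli

/-! ### Sums over index sets that obey a uniform law of large numbers -/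

section UniformLaw

/-- The form of `ghTendstoInProbability_range_of_net` in which the counting metric converges
uniformly in probability to the squared metric of `Y`. No nets need to be given: one good `d` and
`ω` yield them, when one parameter is kept for each of the finitely many index sets. -/
theorem ghTendstoInProbability_range_of_uniform_law
    {Ω : Type*} [MeasurableSpace Ω] {P : Measure Ω} [IsProbabilityMeasure P]
    {ξ : (d : ℕ) → Ω → EuclideanSpace ℝ (Fin d)}
    {ι : ℕ → Type*} [∀ d, Fintype (ι d)] [∀ d, DecidableEq (ι d)]
    {X : (d : ℕ) → ι d → Ω → EuclideanSpace ℝ (Fin d)}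
    (hξ : IncrementConditions P ξ) (hX : IsIncrementArray P ξ X)
    (hcard : Tendsto (fun d => Fintype.card (ι d)) atTop atTop)
    {s : ℕ → ℝ} (hs0 : ∀ d, 0 ≤ s d)
    (hs : Tendsto (fun d => s d ^ 2 * Fintype.card (ι d)) atTop (𝓝 1))
    {𝒜 : Type*} [Nonempty 𝒜] (J : (d : ℕ) → 𝒜 → Ω → Finset (ι d))
    {Y : Type*} [MetricSpace Y] {y : 𝒜 → Y} (hy : Function.Surjective y) {v : ℕ}
    (T : (d : ℕ) → Ω → Finset (Finset (ι d))) (hJT : ∀ d A ω, J d A ω ∈ T d ω)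
    (hv : ∀ d ω, (T d ω).vcDim ≤ v)
    (hT : ∀ d, 1 ≤ d → IndepOfFinite P (fun ω j => X d j ω) (T d))
    (hJ : ∀ d, 1 ≤ d → ∀ A B, IndepOfFinite P (fun ω j => X d j ω) fun ω => (J d A ω, J d B ω))
    (hlaw : ∀ θ : ℝ, 0 < θ → Tendsto (fun d => P {ω | ∃ A B, θ * Fintype.card (ι d) ≤
      |((J d A ω ∆ J d B ω).card : ℝ) - Fintype.card (ι d) * dist (y A) (y B) ^ 2|})
      atTop (𝓝 0)) :
    GHTendstoInProbability P (fun d ω => range fun A => s d • ∑ j ∈ J d A ω, X d j ω) Y := by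
  classical
  refine ghTendstoInProbability_range_of_net hξ hX hcard hs0 hs J y T hJT hv hT hJ
    (fun A B ε hε => ?_) fun δ hδ => ?_
  · refine tendsto_of_tendsto_of_tendsto_of_le_of_le' tendsto_const_nhds (hlaw ε hε)
      (.of_forall fun _ => zero_le) ?_
    filter_upwards [hcard.eventually_ge_atTop 1] with d hd
    refine measure_mono fun ω hω => ⟨A, B, ?_⟩
    have hn0 : (0 : ℝ) < Fintype.card (ι d) := by exact_mod_cast hd
    have e : ((J d A ω ∆ J d B ω).card : ℝ) - Fintype.card (ι d) * dist (y A) (y B) ^ 2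
        = (((J d A ω ∆ J d B ω).card : ℝ) / Fintype.card (ι d) - dist (y A) (y B) ^ 2)
          * Fintype.card (ι d) := by
      field_simp
    rw [e, abs_mul, abs_of_pos hn0]
    exact mul_le_mul_of_nonneg_right (le_of_lt hω) hn0.le
  · have hθ : 0 < min (δ ^ 2) (δ / 2) := lt_min (pow_pos hδ 2) (half_pos hδ)
    obtain ⟨d, hd, hlt⟩ := ((hcard.eventually_ge_atTop 1).and
      ((hlaw _ hθ).eventually_lt_const one_pos)).exists
    have hn0 : (0 : ℝ) < Fintype.card (ι d) := by exact_mod_cast hd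
    obtain ⟨ω, hω⟩ : ∃ ω, ¬ ∃ A B, min (δ ^ 2) (δ / 2) * Fintype.card (ι d) ≤
        |((J d A ω ∆ J d B ω).card : ℝ) - Fintype.card (ι d) * dist (y A) (y B) ^ 2| := by
      by_contra! hall
      rw [show {ω | ∃ A B, min (δ ^ 2) (δ / 2) * Fintype.card (ι d) ≤
        |((J d A ω ∆ J d B ω).card : ℝ) - Fintype.card (ι d) * dist (y A) (y B) ^ 2|} = Set.univ
        from Set.eq_univ_of_forall hall, measure_univ] at hlt
      exact lt_irrefl _ hlt
    push Not at hω
    let g : Finset (ι d) → 𝒜 := Function.invFun fun A => J d A ω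
    have hg : ∀ A, dist (y A) (y (g (J d A ω))) ^ 2 < min (δ ^ 2) (δ / 2) := by
      intro A
      have h := hω A (g (J d A ω))
      rw [show J d (g (J d A ω)) ω = J d A ω from
          Function.invFun_eq (f := fun A => J d A ω) ⟨A, rfl⟩,
        symmDiff_self, Finset.bot_eq_empty, Finset.card_empty, Nat.cast_zero, zero_sub, abs_neg,
        abs_of_nonneg (by positivity), mul_comm (min _ _)] at h
      exact lt_of_mul_lt_mul_left h hn0.le
    refine ⟨Finset.univ.image g, fun z => ?_, ?_⟩
    · obtain ⟨A, rfl⟩ := hy z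
      refine ⟨g (J d A ω), Finset.mem_image_of_mem _ (Finset.mem_univ _), ?_⟩
      exact (pow_le_pow_iff_left₀ dist_nonneg hδ.le two_ne_zero).1
        ((hg A).le.trans (min_le_left _ _))
    · refine tendsto_of_tendsto_of_tendsto_of_le_of_le tendsto_const_nhds
        (hlaw (δ / 2) (half_pos hδ)) (fun _ => zero_le) fun e => measure_mono ?_
      rintro ω' ⟨A, hA⟩
      refine ⟨A, g (J d A ω), le_trans ?_ (le_abs_self _)⟩
      have h1 := hA _ (Finset.mem_image_of_mem g (Finset.mem_univ (J d A ω)))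
      have h2 := mul_le_mul_of_nonneg_left ((hg A).le.trans (min_le_right _ _))
        (Nat.cast_nonneg (Fintype.card (ι e)) : (0 : ℝ) ≤ _)
      linarith

end UniformLaw

/-! ### Set-indexed sums -/

section SetIndexed

lemma indepOfFinite_comp {Ω β γ κ : Type*} [MeasurableSpace Ω] [MeasurableSpace β]
    [MeasurableSpace γ] {P : Measure Ω} {Z : Ω → β} {V : Ω → γ} (h : IndepFun Z V P)
    (hV : AEMeasurable V P) {g : γ → κ}
    (hg : ∀ r, NullMeasurableSet {x | g x = r} (P.map V)) :
    IndepOfFinite P Z fun ω => g (V ω) := by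
  have key : ∀ r, ∃ t, MeasurableSet t ∧ {ω | g (V ω) = r} =ᵐ[P] V ⁻¹' t := by
    intro r
    obtain ⟨t, ht, hrt⟩ := hg r
    exact ⟨t, ht, ae_of_ae_map hV hrt⟩
  refine ⟨fun r => ?_, fun r B hB => ?_⟩
  · obtain ⟨t, ht, hrt⟩ := key r
    exact (hV.nullMeasurable ht).congr hrt.symm
  · obtain ⟨t, ht, hrt⟩ := key r
    rw [measure_congr hrt, measure_congr ((ae_eq_refl (Z ⁻¹' B)).inter hrt)]
    exact h.measure_inter_preimage_eq_mul _ _ hB ht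

variable {𝕏 : Type*} [MeasurableSpace 𝕏] {μ : Measure 𝕏}

lemma map_sample_eq_pi {Ω : Type*} [MeasurableSpace Ω] {P : Measure Ω} [IsProbabilityMeasure P]
    {U : ℕ → Ω → 𝕏} (hU : iIndepFun U P) (hμ : ∀ j, HasLaw (U j) μ P) (k : ℕ) :
    P.map (fun ω (j : Fin k) => U j ω) = Measure.pi fun _ => μ := by
  have h := (iIndepFun_iff_map_fun_eq_pi_map (f := fun j : Fin k => U j)
    (fun j => (hμ j).aemeasurable)).1 (hU.precomp Fin.val_injective)
  simpa only [(hμ _).map_eq] using h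

variable [IsProbabilityMeasure μ]

/-- The point of the Wiener spiral that represents a member of the family. -/
noncomputable def spiralPoint (μ : Measure 𝕏) [IsProbabilityMeasure μ] {𝓜 : Set (Set 𝕏)}
    (A : 𝓜) : WienerSpiral μ 𝓜 :=
  SeparationQuotient.mk (⟨A.1, A.2⟩ : SetFamily μ 𝓜)

lemma dist_spiralPoint {𝓜 : Set (Set 𝕏)} (A B : 𝓜) :
    dist (spiralPoint μ A) (spiralPoint μ B) = √(μ.real ((A : Set 𝕏) ∆ B)) :=
  SeparationQuotient.dist_mk _ _

lemma dist_spiralPoint_sq {𝓜 : Set (Set 𝕏)} (A B : 𝓜) :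
    dist (spiralPoint μ A) (spiralPoint μ B) ^ 2 = μ.real ((A : Set 𝕏) ∆ B) := by
  rw [dist_spiralPoint, Real.sq_sqrt measureReal_nonneg]

lemma spiralPoint_surjective (𝓜 : Set (Set 𝕏)) :
    Function.Surjective (spiralPoint μ : 𝓜 → WienerSpiral μ 𝓜) :=
  fun z => (SeparationQuotient.surjective_mk z).imp fun _ h => h

lemma markedSum_eq_sum_traceOf {ι M E : Type*} [Fintype ι] [AddCommMonoid E]
    (x : ι → E) (mark : ι → M) (A : Set M) :
    markedSum x mark A = ∑ j ∈ traceOf A mark, x j := by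
  classical
  simp only [markedSum, traceOf, Set.indicator_apply, Finset.sum_filter]

lemma rpow_neg_half_sq_mul {x : ℝ} (hx : 0 < x) (a : ℝ) :
    (x ^ (-a / 2)) ^ 2 * x ^ a = 1 := by
  rw [← Real.rpow_natCast, ← Real.rpow_mul hx.le, ← Real.rpow_add hx]
  simp

theorem ghTendstoInProbability_setIndexed
    {Ω : Type*} [MeasurableSpace Ω] {P : Measure Ω} [IsProbabilityMeasure P]
    {n : ℕ → ℕ} (hn : Tendsto n atTop atTop)
    {ξ : (d : ℕ) → Ω → EuclideanSpace ℝ (Fin d)} (hξ : IncrementConditions P ξ)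
    {𝓜 : Set (Set 𝕏)} (hne : 𝓜.Nonempty) (hmeas : ∀ A ∈ 𝓜, MeasurableSet A)
    (hvc : IsVCClass 𝓜) (h𝓜 : IsMeasurableClass μ 𝓜)
    {X : (d : ℕ) → Fin (n d) → Ω → EuclideanSpace ℝ (Fin d)} {U : ℕ → Ω → 𝕏}
    (hX : IsIncrementArray P ξ X) (hU : iIndepFun U P) (hμ : ∀ j, HasLaw (U j) μ P)
    (hXU : ∀ d, 1 ≤ d → IndepFun (fun ω j => X d j ω) (fun ω j => U j ω) P) :
    GHTendstoInProbability P
      (fun d ω => ((n d : ℝ) ^ (-(1 : ℝ) / 2)) •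
        markedSumRange (fun j => X d j ω) (fun j => U j ω) 𝓜)
      (WienerSpiral μ 𝓜) := by
  classical
  obtain ⟨k₀, hk⟩ := hvc
  have : Nonempty 𝓜 := hne.to_subtype
  have hv : ∀ k (x : Fin k ⊕ Fin k → 𝕏), (traces 𝓜 x).vcDim ≤ k₀ + 1 :=
    fun _ x => vcDim_traces_le hk x
  have hn1 : ∀ᶠ d in atTop, 1 ≤ n d := hn.eventually_ge_atTop 1
  let V : (d : ℕ) → Ω → Fin (n d) → 𝕏 := fun d ω j => U j ω
  have hVm : ∀ d, AEMeasurable (V d) P := fun d =>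
    aemeasurable_pi_lambda _ fun j => (hμ j).aemeasurable
  have hVμ : ∀ d, P.map (V d) = Measure.pi fun _ => μ := fun d => map_sample_eq_pi hU hμ (n d)
  have hXV : ∀ d, 1 ≤ d → IndepFun (fun ω j => X d j ω) (V d) P := by
    intro d hd
    refine (hXU d hd).comp (φ := id) (ψ := fun (w : ℕ → 𝕏) (j : Fin (n d)) => w j)
      measurable_id ?_
    exact measurable_pi_lambda _ fun j => measurable_pi_apply _
  have hGC : ∀ θ : ℝ, 0 < θ → Tendsto (fun d => P {ω | ∃ A ∈ 𝓜, ∃ B ∈ 𝓜, θ * n d ≤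
      |((traceOf A (V d ω) ∆ traceOf B (V d ω)).card : ℝ) - n d * μ.real (A ∆ B)|})
      atTop (𝓝 0) := by
    intro θ hθ
    refine tendsto_of_tendsto_of_tendsto_of_le_of_le tendsto_const_nhds
      ((tendsto_measure_exists_abs_card_sub h𝓜 hne hmeas hv hθ).comp hn)
      (fun _ => zero_le) fun d => ?_
    have h := Measure.le_map_apply (hVm d) {u | ∃ A ∈ 𝓜, ∃ B ∈ 𝓜,
      θ * n d ≤ |((traceOf A u ∆ traceOf B u).card : ℝ) - n d * μ.real (A ∆ B)|}
    rwa [hVμ] at h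
  have hrange : (fun d ω => ((n d : ℝ) ^ (-(1 : ℝ) / 2)) •
      markedSumRange (fun j => X d j ω) (fun j : Fin (n d) => U j ω) 𝓜)
      = fun d ω => range fun A : 𝓜 => ((n d : ℝ) ^ (-(1 : ℝ) / 2)) •
        ∑ j ∈ traceOf A (V d ω), X d j ω := by
    funext d ω
    rw [markedSumRange, Set.image_eq_range, ← Set.range_smul]
    simp only [markedSum_eq_sum_traceOf]
    rfl
  rw [hrange]
  have hs : Tendsto (fun d => ((n d : ℝ) ^ (-(1 : ℝ) / 2)) ^ 2 * Fintype.card (Fin (n d))) atTop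
      (𝓝 1) := by
    refine tendsto_const_nhds.congr' ?_
    filter_upwards [hn1] with d hd
    have h := rpow_neg_half_sq_mul (x := n d) (by exact_mod_cast hd) 1
    rw [Real.rpow_one] at h
    rw [Fintype.card_fin, h]
  have hconv := ghTendstoInProbability_range_of_uniform_law (ι := fun d => Fin (n d)) hξ hX
    (by simpa using hn) (fun d => Real.rpow_nonneg (Nat.cast_nonneg _) _) hs
    (fun d (A : 𝓜) ω => traceOf A (V d ω)) (spiralPoint_surjective (μ := μ) 𝓜)
    (fun d ω => traces 𝓜 (V d ω))
    (fun d A ω => traceOf_mem_traces _ A.2) (fun d ω => vcDim_traces_le hk _)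
  refine hconv (fun d hd => ?_) (fun d hd A B => ?_) fun θ hθ => ?_
  · exact indepOfFinite_comp (hXV d hd) (hVm d) fun r => by
      rw [hVμ]; exact nullMeasurableSet_traces_eq h𝓜 hne r
  · refine indepOfFinite_comp (g := fun x => (traceOf (A : Set 𝕏) x, traceOf (B : Set 𝕏) x))
      (hXV d hd) (hVm d) fun r => MeasurableSet.nullMeasurableSet ?_
    have htr : ∀ C ∈ 𝓜, ∀ J, MeasurableSet {x : Fin (n d) → 𝕏 | traceOf C x = J} := by
      intro C hC J
      have : {x : Fin (n d) → 𝕏 | traceOf C x = J} = ⋂ j, {x | x j ∈ C ↔ j ∈ J} := by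
        ext x; simp [Finset.ext_iff]
      rw [this]
      refine MeasurableSet.iInter fun j => ?_
      have hj : MeasurableSet {x : Fin (n d) → 𝕏 | x j ∈ C} := measurable_pi_apply j (hmeas C hC)
      by_cases hJ : j ∈ J
      · simpa [hJ] using hj
      · simp only [hJ, iff_false]; exact hj.compl
    have : {x : Fin (n d) → 𝕏 | (traceOf (A : Set 𝕏) x, traceOf (B : Set 𝕏) x) = r}
        = {x | traceOf (A : Set 𝕏) x = r.1} ∩ {x | traceOf (B : Set 𝕏) x = r.2} := by
      ext x; simp [Prod.ext_iff]
    rw [this]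
    exact (htr A A.2 _).inter (htr B B.2 _)
  · refine tendsto_of_tendsto_of_tendsto_of_le_of_le tendsto_const_nhds (hGC θ hθ)
      (fun _ => zero_le) fun d => measure_mono ?_
    rintro ω ⟨A, B, h⟩
    rw [dist_spiralPoint_sq, Fintype.card_fin] at h
    exact ⟨A, A.2, B, B.2, h⟩

end SetIndexed

/-! ### Multiple sums -/

section MultipleSums

lemma abs_prod_sub_prod_le_sum {ι : Type*} (s : Finset ι) {a b : ι → ℝ}
    (ha : ∀ i, |a i| ≤ 1) (hb : ∀ i, |b i| ≤ 1) :
    |∏ i ∈ s, a i - ∏ i ∈ s, b i| ≤ ∑ i ∈ s, |a i - b i| := by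
  classical
  induction s using Finset.induction_on with
  | empty => simp
  | insert i s hi ih =>
    rw [Finset.prod_insert hi, Finset.prod_insert hi, Finset.sum_insert hi]
    have e : a i * ∏ j ∈ s, a j - b i * ∏ j ∈ s, b j
        = (a i - b i) * ∏ j ∈ s, a j + b i * (∏ j ∈ s, a j - ∏ j ∈ s, b j) := by ring
    have h1 : |∏ j ∈ s, a j| ≤ 1 := by
      rw [Finset.abs_prod]; exact Finset.prod_le_one (fun _ _ => abs_nonneg _) fun j _ => ha j
    rw [e]
    refine (abs_add_le _ _).trans ?_
    rw [abs_mul, abs_mul]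
    exact add_le_add (mul_le_of_le_one_right (abs_nonneg _) h1)
      ((mul_le_of_le_one_left (abs_nonneg _) (hb i)).trans ih)

variable {m : ℕ}

/-- The integer rectangle with upper corner `k`. -/
def latticeBox (k : Fin m → ℕ) : Set (Fin m → ℤ) := {z | ∀ i, 0 ≤ z i ∧ z i ≤ (k i : ℤ)}

/-- A set of `m + 1` points is not shattered: an integer rectangle that contains, for each
coordinate, a point of the set at which this coordinate is largest contains the whole set. -/
lemma not_shattersFinset_integerRectangles (I : Finset (Fin m → ℤ)) (hI : I.card = m + 1) :
    ¬ ShattersFinset (integerRectangles m) I := by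
  classical
  intro hsh
  have hne : I.Nonempty := Finset.card_pos.1 (by omega)
  have hnonneg : ∀ z ∈ I, ∀ i, 0 ≤ z i := by
    obtain ⟨A, ⟨k, rfl⟩, hA⟩ := hsh I Finset.Subset.rfl
    intro z hz i
    have : z ∈ (I : Set (Fin m → ℤ)) := hz
    rw [← hA] at this
    exact (this.2 i).1
  choose p hpI hp using fun i : Fin m => I.exists_max_image (fun z => z i) hne
  obtain ⟨A, ⟨k, rfl⟩, hA⟩ := hsh (Finset.univ.image p) (by
    intro z hz
    obtain ⟨i, -, rfl⟩ := Finset.mem_image.1 hz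
    exact hpI i)
  have hsub : I ⊆ Finset.univ.image p := by
    intro z hz
    rw [← Finset.mem_coe, ← hA]
    refine ⟨hz, fun i => ⟨hnonneg z hz i, (hp i z hz).trans ?_⟩⟩
    have : p i ∈ ((Finset.univ.image p : Finset _) : Set (Fin m → ℤ)) := by simp
    rw [← hA] at this
    exact (this.2 i).2
  have h1 := Finset.card_le_card hsub
  have h2 : (Finset.univ.image p).card ≤ m :=
    Finset.card_image_le.trans_eq (Finset.card_fin m)
  omega

/-- The multi-indices `k ∈ {0, …, n}^m` with `k ≤ n t`. -/
noncomputable def boxIndices (n : ℕ) (t : Fin m → unitInterval) : Finset (Fin m → Fin (n + 1)) :=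
  traceOf (latticeBox fun i => ⌊n * (t i : ℝ)⌋₊) latticeMark

lemma mem_boxIndices {n : ℕ} {t : Fin m → unitInterval} {k : Fin m → Fin (n + 1)} :
    k ∈ boxIndices n t ↔ ∀ i, (k i : ℕ) ≤ ⌊n * (t i : ℝ)⌋₊ := by
  simp [boxIndices, latticeBox, latticeMark]

lemma boxIndices_inter (n : ℕ) (t u : Fin m → unitInterval) [DecidableEq (Fin m → Fin (n + 1))] :
    boxIndices n t ∩ boxIndices n u = boxIndices n (t ⊓ u) := by
  ext k
  have hmono : Monotone fun x : unitInterval => ⌊n * (x : ℝ)⌋₊ := fun x y hxy =>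
    Nat.floor_mono (mul_le_mul_of_nonneg_left hxy (Nat.cast_nonneg n))
  have h : ∀ i, ⌊n * ((t ⊓ u) i : ℝ)⌋₊ = min ⌊n * (t i : ℝ)⌋₊ ⌊n * (u i : ℝ)⌋₊ :=
    fun i => hmono.map_inf (t i) (u i)
  simp only [Finset.mem_inter, mem_boxIndices, h, le_min_iff, forall_and]

lemma card_boxIndices (n : ℕ) (t : Fin m → unitInterval) :
    (boxIndices n t).card = ∏ i, (⌊n * (t i : ℝ)⌋₊ + 1) := by
  have hlt : ∀ i, ⌊n * (t i : ℝ)⌋₊ < n + 1 := fun i => Nat.lt_succ_of_le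
    (Nat.floor_le_of_le (mul_le_of_le_one_right (Nat.cast_nonneg n) (t i).2.2))
  have : boxIndices n t = Fintype.piFinset fun i => Finset.Iic ⟨⌊n * (t i : ℝ)⌋₊, hlt i⟩ := by
    ext k
    simp [mem_boxIndices, Fin.le_def]
  rw [this, Fintype.card_piFinset]
  simp only [Fin.card_Iic]

lemma abs_card_boxIndices_sub_le (n : ℕ) (t : Fin m → unitInterval) :
    |((boxIndices n t).card : ℝ) - (n + 1 : ℝ) ^ m * ∏ i, (t i : ℝ)|
      ≤ (n + 1 : ℝ) ^ m * (m / (n + 1)) := by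
  have hn : (0 : ℝ) < n + 1 := by positivity
  have hn0 : (0 : ℝ) ≤ n := Nat.cast_nonneg n
  set a : Fin m → ℝ := fun i => (⌊n * (t i : ℝ)⌋₊ + 1 : ℝ) / (n + 1) with ha
  have hcard : ((boxIndices n t).card : ℝ) = (n + 1 : ℝ) ^ m * ∏ i, a i := by
    rw [card_boxIndices, ha, Finset.prod_div_distrib, Finset.prod_const, Finset.card_fin]
    push_cast
    field_simp
  have hfl : ∀ i, (⌊n * (t i : ℝ)⌋₊ : ℝ) ≤ n * t i := fun i =>
    Nat.floor_le (mul_nonneg hn0 (t i).2.1)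
  have ht1 : ∀ i, (n : ℝ) * t i ≤ n := fun i => mul_le_of_le_one_right hn0 (t i).2.2
  have hai : ∀ i, |a i| ≤ 1 := by
    intro i
    rw [abs_of_nonneg (by positivity), div_le_one hn]
    linarith [hfl i, ht1 i]
  have hti : ∀ i, |(t i : ℝ)| ≤ 1 := fun i => by
    rw [abs_of_nonneg (t i).2.1]; exact (t i).2.2
  have hdiff : ∀ i, |a i - t i| ≤ 1 / (n + 1) := by
    intro i
    have e : a i - t i = ((⌊n * (t i : ℝ)⌋₊ + 1 : ℝ) - (n + 1) * t i) / (n + 1) := by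
      rw [ha]; field_simp
    rw [e, abs_div, abs_of_pos hn]
    gcongr
    have h1 := Nat.lt_floor_add_one (n * (t i : ℝ))
    have h2 := (t i).2.1
    have h3 := (t i).2.2
    exact abs_le.2 ⟨by linarith, by linarith [hfl i]⟩
  rw [hcard, ← mul_sub, abs_mul, abs_of_pos (by positivity)]
  refine mul_le_mul_of_nonneg_left ?_ (by positivity)
  refine (abs_prod_sub_prod_le_sum _ hai hti).trans
    ((Finset.sum_le_sum fun i _ => hdiff i).trans ?_)
  rw [Finset.sum_const, Finset.card_fin, nsmul_eq_mul, mul_one_div]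

/-- The rectangle in `[0, 1]^m` with upper corner `t`. -/
def unitBox (t : Fin m → unitInterval) : Set (Fin m → unitInterval) :=
  Set.univ.pi fun i => Set.Icc 0 (t i)

lemma unitBox_inter (t u : Fin m → unitInterval) : unitBox t ∩ unitBox u = unitBox (t ⊓ u) := by
  ext x
  simp only [unitBox, Set.mem_inter_iff, Set.mem_pi, Set.mem_univ, true_implies, Set.mem_Icc,
    Pi.inf_apply, le_inf_iff, forall_and]
  tauto

lemma measurableSet_unitBox (t : Fin m → unitInterval) : MeasurableSet (unitBox t) :=
  MeasurableSet.univ_pi fun _ => measurableSet_Icc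

lemma volume_real_unitBox (t : Fin m → unitInterval) :
    volume.real (unitBox t) = ∏ i, (t i : ℝ) := by
  rw [Measure.real, unitBox, volume_pi_pi, ENNReal.toReal_prod]
  refine Finset.prod_congr rfl fun i _ => ?_
  rw [unitInterval.volume_Icc, ENNReal.toReal_ofReal (by simpa using (t i).2.1)]
  simp

lemma measureReal_symmDiff_eq_add_sub {α : Type*} [MeasurableSpace α] {μ : Measure α}
    [IsFiniteMeasure μ] {A B : Set α} (hA : MeasurableSet A) (hB : MeasurableSet B) :
    μ.real (A ∆ B) = μ.real A + μ.real B - 2 * μ.real (A ∩ B) := by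
  have h1 := measureReal_inter_add_sdiff (μ := μ) (s := A) hB
  have h2 := measureReal_inter_add_sdiff (μ := μ) (s := B) hA
  rw [Set.inter_comm] at h2
  rw [Set.symmDiff_def, measureReal_union
    (disjoint_sdiff_sdiff) (hB.diff hA)]
  linarith

lemma card_symmDiff_eq_add_sub {α : Type*} [DecidableEq α] (J K : Finset α) :
    ((J ∆ K).card : ℝ) = J.card + K.card - 2 * (J ∩ K).card := by
  have h1 := Finset.card_inter_add_card_sdiff J K
  have h2 := Finset.card_inter_add_card_sdiff K J
  rw [Finset.inter_comm] at h2
  have h3 : (J ∆ K).card = (J \ K).card + (K \ J).card :=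
    Finset.card_union_of_disjoint disjoint_sdiff_sdiff
  rify at h1 h2 h3
  linarith

lemma abs_card_boxIndices_symmDiff_sub_le (n : ℕ) (t u : Fin m → unitInterval)
    [DecidableEq (Fin m → Fin (n + 1))] :
    |((boxIndices n t ∆ boxIndices n u).card : ℝ)
        - (n + 1 : ℝ) ^ m * volume.real (unitBox t ∆ unitBox u)|
      ≤ (n + 1 : ℝ) ^ m * (4 * m / (n + 1)) := by
  rw [card_symmDiff_eq_add_sub, measureReal_symmDiff_eq_add_sub (measurableSet_unitBox t)
    (measurableSet_unitBox u), boxIndices_inter, unitBox_inter, volume_real_unitBox,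
    volume_real_unitBox, volume_real_unitBox]
  have h1 := abs_le.1 (abs_card_boxIndices_sub_le n t)
  have h2 := abs_le.1 (abs_card_boxIndices_sub_le n u)
  have h3 := abs_le.1 (abs_card_boxIndices_sub_le n (t ⊓ u))
  have e : (n + 1 : ℝ) ^ m * (4 * m / (n + 1)) = 4 * ((n + 1 : ℝ) ^ m * (m / (n + 1))) := by ring
  rw [e, abs_le]
  constructor <;> linarith [h1.1, h1.2, h2.1, h2.2, h3.1, h3.2]

lemma exists_boxIndices_eq {n : ℕ} (hn : 1 ≤ n) (k : Fin m → ℕ) :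
    ∃ t : Fin m → unitInterval,
      boxIndices n t = traceOf (latticeBox k) (latticeMark (m := m) (n := n)) := by
  have hn0 : (0 : ℝ) < n := by exact_mod_cast hn
  let t : Fin m → unitInterval := fun i => ⟨(min (k i) n : ℕ) / (n : ℝ), by positivity, by
    rw [div_le_one hn0]; exact_mod_cast min_le_right _ _⟩
  refine ⟨t, ?_⟩
  ext j
  have ht : ∀ i, ⌊n * (t i : ℝ)⌋₊ = min (k i) n := by
    intro i
    have : n * (t i : ℝ) = (min (k i) n : ℕ) := mul_div_cancel₀ _ hn0.ne'
    rw [this, Nat.floor_natCast]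
  rw [mem_boxIndices]
  simp only [ht, mem_traceOf, latticeBox, latticeMark, Set.mem_ofPred_eq, Nat.cast_le,
    Nat.cast_nonneg, true_and]
  exact forall_congr' fun i => by have := (j i).2; omega

lemma indepOfFinite_const {Ω β κ : Type*} [MeasurableSpace Ω] [MeasurableSpace β]
    (P : Measure Ω) [IsProbabilityMeasure P] (Z : Ω → β) (c : κ) :
    IndepOfFinite P Z fun _ => c := by
  refine ⟨fun r => ?_, fun r B _ => ?_⟩ <;> by_cases h : c = r <;> simp [h]

theorem ghTendstoInProbability_multipleSums
    {Ω : Type*} [MeasurableSpace Ω] {P : Measure Ω} [IsProbabilityMeasure P]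
    {n : ℕ → ℕ} (hn : Tendsto n atTop atTop)
    {ξ : (d : ℕ) → Ω → EuclideanSpace ℝ (Fin d)} (hξ : IncrementConditions P ξ) (hm : 1 ≤ m)
    {X : (d : ℕ) → (Fin m → Fin (n d + 1)) → Ω → EuclideanSpace ℝ (Fin d)}
    (hX : IsIncrementArray P ξ X) :
    GHTendstoInProbability P
      (fun d ω => ((n d : ℝ) ^ (-(m : ℝ) / 2)) •
        markedSumRange (fun k => X d k ω) latticeMark (integerRectangles m))
      (MultivariateWienerSpiral m) := by
  classical
  have hn1 : ∀ᶠ d in atTop, 1 ≤ n d := hn.eventually_ge_atTop 1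
  have hcardN : ∀ d, (Fintype.card (Fin m → Fin (n d + 1)) : ℝ) = (n d + 1 : ℝ) ^ m := by
    intro d; simp
  have hcard : Tendsto (fun d => Fintype.card (Fin m → Fin (n d + 1))) atTop atTop := by
    refine tendsto_atTop_mono (fun d => ?_) hn
    rw [Fintype.card_fun, Fintype.card_fin, Fintype.card_fin]
    exact (Nat.le_succ _).trans (Nat.le_self_pow (by omega) _)
  have hnR : Tendsto (fun d => (n d : ℝ)) atTop atTop := tendsto_natCast_atTop_atTop.comp hn
  have hs : Tendsto (fun d => ((n d : ℝ) ^ (-(m : ℝ) / 2)) ^ 2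
      * Fintype.card (Fin m → Fin (n d + 1))) atTop (𝓝 1) := by
    have h1 : Tendsto (fun d => (1 + (n d : ℝ)⁻¹) ^ m) atTop (𝓝 1) := by
      have := ((tendsto_inv_atTop_zero.comp hnR).const_add 1).pow m
      simpa using this
    refine h1.congr' ?_
    filter_upwards [hn1] with d hd
    have hn0 : (0 : ℝ) < n d := by exact_mod_cast hd
    have h := rpow_neg_half_sq_mul hn0 m
    rw [Real.rpow_natCast] at h
    have e : (n d + 1 : ℝ) ^ m = (n d : ℝ) ^ m * (1 + (n d : ℝ)⁻¹) ^ m := by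
      rw [← mul_pow]; congr 1; field_simp
    rw [hcardN, e, ← mul_assoc, h, one_mul]
  let y : (Fin m → unitInterval) → MultivariateWienerSpiral m := fun t =>
    spiralPoint volume ⟨unitBox t, t, rfl⟩
  have hy : Function.Surjective y := by
    intro z
    obtain ⟨⟨A, t, rfl⟩, rfl⟩ := spiralPoint_surjective (μ := volume) _ z
    exact ⟨t, rfl⟩
  have hconv := ghTendstoInProbability_range_of_uniform_law hξ hX hcard
    (fun d => Real.rpow_nonneg (Nat.cast_nonneg _) _) hs
    (fun d (t : Fin m → unitInterval) (_ : Ω) => boxIndices (n d) t) hy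
    (fun d _ => traces (integerRectangles m) (latticeMark (m := m) (n := n d)))
    (fun d t _ => traceOf_mem_traces _ ⟨_, rfl⟩)
    (fun d _ => vcDim_traces_le not_shattersFinset_integerRectangles _)
    (fun d _ => indepOfFinite_const P _ _) (fun d _ t u => indepOfFinite_const P _ _)
    fun θ hθ => by
      have hsmall : ∀ᶠ d in atTop, 4 * m / ((n d : ℝ) + 1) < θ := by
        have h0 : Tendsto (fun d => 4 * (m : ℝ) / ((n d : ℝ) + 1)) atTop (𝓝 0) :=
          (tendsto_atTop_add_const_right _ _ hnR).const_div_atTop _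
        exact h0.eventually_lt_const hθ
      refine tendsto_const_nhds.congr' ?_
      filter_upwards [hsmall] with d hd
      refine (measure_mono_null (t := ∅) ?_ measure_empty).symm
      rintro ω ⟨t, u, h⟩
      rw [dist_spiralPoint_sq, hcardN] at h
      have h1 := h.trans (abs_card_boxIndices_symmDiff_sub_le (n d) t u)
      rw [mul_comm θ] at h1
      exact absurd (le_of_mul_le_mul_left h1 (by positivity)) (not_le.2 hd)
  -- The integer rectangles correspond to the parameters `t` only if `n d` is positive.
  intro ε hε
  refine (hconv ε hε).congr' ?_
  filter_upwards [hn1] with d hd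
  have hrange : ∀ ω, ((n d : ℝ) ^ (-(m : ℝ) / 2)) •
      markedSumRange (fun k => X d k ω) latticeMark (integerRectangles m)
      = range fun t : Fin m → unitInterval => ((n d : ℝ) ^ (-(m : ℝ) / 2)) •
        ∑ k ∈ boxIndices (n d) t, X d k ω := by
    intro ω
    rw [← Set.smul_set_range, markedSumRange]
    congr 1
    ext x
    constructor
    · rintro ⟨A, ⟨k, rfl⟩, rfl⟩
      obtain ⟨t, ht⟩ := exists_boxIndices_eq (m := m) hd k
      refine ⟨t, ?_⟩
      rw [markedSum_eq_sum_traceOf]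
      simp only [ht]
      rfl
    · rintro ⟨t, rfl⟩
      exact ⟨_, ⟨_, rfl⟩, markedSum_eq_sum_traceOf _ _ _⟩
  exact congrArg (fun K : Ω → Set (EuclideanSpace ℝ (Fin d)) =>
    P {ω | ε ≤ ghEDist (K ω) (MultivariateWienerSpiral m)}) (funext hrange).symm

end MultipleSums

/-! ### Convergence to Wiener spirals -/

theorem mainTheorem1
    {Ω : Type*} [MeasurableSpace Ω] (P : Measure Ω) [IsProbabilityMeasure P]
    (n : ℕ → ℕ) (hn : Tendsto n atTop atTop)
    (ξ : (d : ℕ) → Ω → EuclideanSpace ℝ (Fin d)) (hξ : IncrementConditions P ξ) :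
    -- multiple sums
    (∀ (m : ℕ), 1 ≤ m →
      ∀ X : (d : ℕ) → (Fin m → Fin (n d + 1)) → Ω → EuclideanSpace ℝ (Fin d),
        IsIncrementArray P ξ X →
        GHTendstoInProbability P
          (fun d ω => ((n d : ℝ) ^ (-(m : ℝ) / 2)) •
            markedSumRange (fun k => X d k ω) latticeMark (integerRectangles m))
          (MultivariateWienerSpiral m)) ∧
    -- set-indexed sums
    (∀ {𝕏 : Type*} [MeasurableSpace 𝕏] (μ : Measure 𝕏) [IsProbabilityMeasure μ]
      (𝓜 : Set (Set 𝕏)), 𝓜.Nonempty → (∀ A ∈ 𝓜, MeasurableSet A) → IsVCClass 𝓜 →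
      IsMeasurableClass μ 𝓜 →
      ∀ (X : (d : ℕ) → Fin (n d) → Ω → EuclideanSpace ℝ (Fin d)) (U : ℕ → Ω → 𝕏),
        IsIncrementArray P ξ X →
        iIndepFun U P → (∀ j, HasLaw (U j) μ P) →
        (∀ d, 1 ≤ d → IndepFun (fun ω j => X d j ω) (fun ω j => U j ω) P) →
        GHTendstoInProbability P
          (fun d ω => ((n d : ℝ) ^ (-(1 : ℝ) / 2)) •
            markedSumRange (fun j => X d j ω) (fun j => U j ω) 𝓜)
          (WienerSpiral μ 𝓜)) := by
  refine ⟨fun m hm X hX => ghTendstoInProbability_multipleSums hn hξ hm hX, ?_⟩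
  intro 𝕏 _ μ _ 𝓜 hne hmeas hvc h𝓜 X U hX hU hμ hXU
  exact ghTendstoInProbability_setIndexed hn hξ hne hmeas hvc h𝓜 hX hU hμ hXU
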